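/- **Setting.** A balanced allocation process with $n\ge 1$ bins starts from the empty load vector $x^0=(0,\dots,0)$; in each round $t=0,1,2,\dots$ it chooses one bin, at random with a law that may depend on the whole history $\mathfrak F^t$ of the first $t$ allocations, and places some number of balls into it. Let $x^t_i$ be the load of bin $i$ after $t$ rounds, $W^t=\sum_i x_i^t$, $y_i^t=x_i^t-W^t/n$, $\mathrm{Gap}(t)=\max_i x^t_i-W^t/n$, $B_+^t=\{i: y_i^t\ge 0\}$ (overloaded bins), $B_-^t=\{i:y_i^t<0\}$ (underloaded bins) and $\delta^t=|B_+^t|/n$. In each round label the bins so that $x_1^t\ge\dots\ge x_n^t$ (ties broken arbitrarily), let $p_i^t$ be the conditional probability given $\mathfrak F^t$ that the next allocation is to the $i$-th heaviest bin, and $P_-^t=\sum_{i\in B_-^t}p_i^t$. For vectors $p,q$ of the same length $N$ write $p\succeq q$ (equivalently $q\preceq p$) if $\sum_{i\le k}p_i\ge\sum_{i\le k}q_i$ for all $1\le k\le N$. * $\mathcal P_2$ with constants $k_1\in\mathbb N$, $k_1\ge1$, and $k_2,k_3,k_4\in(0,1]$: in every round $t\ge0$, $\max_{i\in B_+^t}p_i^t\le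 \frac{k_1}{n}$, $\min_{i\in B_-^t}p_i^t\ge\frac{k_2}{n}$, and $$(p_1^t,\dots,p^t_{\delta^tn})\preceq\Big(\tfrac1n-\tfrac{k_3(1-\delta^t)}{n},\dots,\tfrac1n-\tfrac{k_3(1-\delta^t)}{n}\Big),\qquad (p_n^t,\dots,p^t_{\delta^tn+1})\succeq\Big(\tfrac1n+\tfrac{k_4\delta^t}{n},\dots,\tfrac1n+\tfrac{k_4\delta^t}{n}\Big).$$ * $\mathcal P_1$ with constants $k_1,k_2$: the same, with both right-hand vectors replaced by $(\frac1n,\dots,\frac1n)$. * $\mathcal W_1$ with integers $1\le w_+\le w_-$: in every round, if the chosen bin $i$ has $y_i^t<0$ then $w_-$ balls are placed into it, and if $y_i^t\ge0$ then $w_+$ balls are placed into it. * $\mathcal W_2$: $\mathcal W_1$ with $w_+<w_-$, and in every round $(p_n^t,\dots,p^t_{\delta^tn+1})\succeq\big(\tfrac{P_-^t}{|B_-^t|},\dots,\tfrac{P_-^t}{|B_-^t|}\big)$. **Theorem (Main Theorem).** For all values of the constants $k_1,k_2,k_3,k_4,w_+,w_-$ there is a constant $\kappa>0$, depending only on them,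 such that for every $n\ge1$, every process with $n$ bins that satisfies $\mathcal P_2\cap\mathcal W_1$ (probability bias) or $\mathcal P_1\cap\mathcal W_2$ (weight bias) with these constants, and every round $m\ge0$, $$\Pr\Big[\max_{i\in[n]}\Big|x_i^m-\frac{W^m}{n}\Big|\le\kappa\log n\Big]\ge 1-n^{-4};$$ in particular $\Pr[\mathrm{Gap}(m)\le\kappa\log n]\ge1-n^{-4}$. -/

import Mathlib

namespace BalancedAllocation

/-! ### Load vectors -/

section Loads

variable {n : ℕ}

/-- The total number of balls `W = ∑ i, x i`. -/
def total (x : Fin n → ℕ) : ℕ := ∑ i, x i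

/-- The normalized load `y i = x i - W / n`. -/
noncomputable def normLoad (x : Fin n → ℕ) (i : Fin n) : ℝ :=
  (x i : ℝ) - (total x : ℝ) / (n : ℝ)

/-- The set `B₊` of overloaded bins. -/
noncomputable def overloaded (x : Fin n → ℕ) : Finset (Fin n) :=
  Finset.univ.filter fun i => 0 ≤ normLoad x i

/-- The set `B₋` of underloaded bins. -/
noncomputable def underloaded (x : Fin n → ℕ) : Finset (Fin n) :=
  Finset.univ.filter fun i => normLoad x i < 0

theorem card_overloaded_le (x : Fin n → ℕ) : (overloaded x).card ≤ n := by
  simpa using Finset.card_le_univ (overloaded x)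

/-- The mean quantile `δ = |B₊| / n`. -/
noncomputable def meanQuantile (x : Fin n → ℕ) : ℝ := ((overloaded x).card : ℝ) / (n : ℝ)

/-- `max_i |x i - W / n|` (used for `n ≥ 1` only). -/
noncomputable def maxDeviation (x : Fin n → ℕ) : ℝ := ⨆ i, |normLoad x i|

/-- `Gap = max_i x i - W / n` (used for `n ≥ 1` only). -/
noncomputable def gap (x : Fin n → ℕ) : ℝ := (⨆ i, (x i : ℝ)) - (total x : ℝ) / (n : ℝ)

/-- `p` majorizes `q`: every prefix sum of `p` is at least that of `q`
(no rearrangement, and the total sums need not agree). -/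
def Majorizes {N : ℕ} (p q : Fin N → ℝ) : Prop :=
  ∀ k : Fin N, ∑ i ∈ Finset.Iic k, q i ≤ ∑ i ∈ Finset.Iic k, p i

end Loads

/-! ### Allocation processes -/

/-- A history: the allocations made so far, the most recent one first. An allocation is a pair
consisting of the chosen bin and the number of balls placed into it. -/
abbrev History (n : ℕ) : Type := List (Fin n × ℕ)

/-- The load vector after the allocations in `h`, starting from empty bins. -/
def load {n : ℕ} (h : History n) (i : Fin n) : ℕ :=
  ((h.filter fun a => a.1 = i).map Prod.snd).sum

/-- A balanced allocation process with `n` bins. Given the history of all previous allocations,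
the next allocation (the bin and the number of balls) has law `step h`. For every history the
process comes with a labeling that lists the bins by non-increasing load, ties being broken
arbitrarily: `label h k` is the `(k+1)`-st heaviest bin. -/
structure AllocProcess (n : ℕ) where
  step : History n → PMF (Fin n × ℕ)
  label : History n → Equiv.Perm (Fin n)
  label_sorted : ∀ h, Antitone fun k => load h (label h k)

namespace AllocProcess

variable {n : ℕ} (P : AllocProcess n)

/-- The law of the history after `t` rounds. -/
noncomputable def histLaw : ℕ → PMF (History n)
  | 0 => PMF.pure []
  | t + 1 => (histLaw t).bind fun h => (P.step h).map fun a => a :: h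

/-- The law of the load vector `x^t`. -/
noncomputable def loadLaw (t : ℕ) : PMF (Fin n → ℕ) := (P.histLaw t).map load

/-- `h` has positive probability of being the history after some number of rounds. -/
def Reachable (h : History n) : Prop := ∃ t : ℕ, h ∈ (P.histLaw t).support

/-- The probability, given the history `h`, that the next allocation is to bin `i`. -/
noncomputable def binProb (h : History n) (i : Fin n) : ℝ :=
  (((P.step h).map Prod.fst) i).toReal

/-- The probability allocation vector: entry `k` is the probability, given the history `h`, that
the next allocation is to the `(k+1)`-st heaviest bin. -/
noncomputable def allocVec (h : History n) (k : Fin n) : ℝ := P.binProb h (P.label h k)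

/-- `(p_1, …, p_{δn})`: the allocation probabilities of the overloaded bins, heaviest first. -/
noncomputable def overVec (h : History n) (j : Fin (overloaded (load h)).card) : ℝ :=
  P.allocVec h (Fin.castLE (card_overloaded_le (load h)) j)

/-- `(p_n, …, p_{δn+1})`: the allocation probabilities of the underloaded bins, lightest first. -/
noncomputable def underVec (h : History n) (j : Fin (n - (overloaded (load h)).card)) : ℝ :=
  P.allocVec h (Fin.rev (Fin.castLE (Nat.sub_le n (overloaded (load h)).card) j))

/-- `P₋`: the probability, given the history `h`, of allocating to an underloaded bin. -/
noncomputable def underProb (h : History n) : ℝ := ∑ i ∈ underloaded (load h), P.binProb h i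

/-- Condition `P₁` with constants `k₁`, `k₂`. -/
structure CondP1 (k₁ : ℕ) (k₂ : ℝ) : Prop where
  one_le_k₁ : 1 ≤ k₁
  k₂_mem : k₂ ∈ Set.Ioc (0 : ℝ) 1
  over_max : ∀ h, P.Reachable h → ∀ i ∈ overloaded (load h), P.binProb h i ≤ (k₁ : ℝ) / n
  over_maj : ∀ h, P.Reachable h → Majorizes (fun _ => 1 / (n : ℝ)) (P.overVec h)
  under_min : ∀ h, P.Reachable h → ∀ i ∈ underloaded (load h), k₂ / n ≤ P.binProb h i
  under_maj : ∀ h, P.Reachable h → Majorizes (P.underVec h) (fun _ => 1 / (n : ℝ))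

/-- Condition `P₂` (probability bias) with constants `k₁`, `k₂`, `k₃`, `k₄`. -/
structure CondP2 (k₁ : ℕ) (k₂ k₃ k₄ : ℝ) : Prop where
  one_le_k₁ : 1 ≤ k₁
  k₂_mem : k₂ ∈ Set.Ioc (0 : ℝ) 1
  k₃_mem : k₃ ∈ Set.Ioc (0 : ℝ) 1
  k₄_mem : k₄ ∈ Set.Ioc (0 : ℝ) 1
  over_max : ∀ h, P.Reachable h → ∀ i ∈ overloaded (load h), P.binProb h i ≤ (k₁ : ℝ) / n
  over_maj : ∀ h, P.Reachable h →
    Majorizes (fun _ => 1 / (n : ℝ) - k₃ * (1 - meanQuantile (load h)) / n) (P.overVec h)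
  under_min : ∀ h, P.Reachable h → ∀ i ∈ underloaded (load h), k₂ / n ≤ P.binProb h i
  under_maj : ∀ h, P.Reachable h →
    Majorizes (P.underVec h) (fun _ => 1 / (n : ℝ) + k₄ * meanQuantile (load h) / n)

/-- Condition `W₁` with weights `w₊` (overloaded bins) and `w₋` (underloaded bins). -/
structure CondW1 (wplus wminus : ℕ) : Prop where
  one_le_wplus : 1 ≤ wplus
  wplus_le_wminus : wplus ≤ wminus
  balls_eq : ∀ h, P.Reachable h → ∀ a ∈ (P.step h).support,
    a.2 = if normLoad (load h) a.1 < 0 then wminus else wplus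

/-- Condition `W₂` (weight bias) with weights `w₊ < w₋`. -/
structure CondW2 (wplus wminus : ℕ) : Prop extends CondW1 P wplus wminus where
  wplus_lt_wminus : wplus < wminus
  under_maj_avg : ∀ h, P.Reachable h →
    Majorizes (P.underVec h) (fun _ => P.underProb h / ((underloaded (load h)).card : ℝ))

end AllocProcess

end BalancedAllocation

namespace BalancedAllocation

/-! ### Loads after one allocation and the one-round bias condition -/

variable {n : ℕ}

/-! Both kinds of bias lead to the same one-round condition `MeanBiased`. By Abel summation
(`sum_mul_nonneg_of_prefix`), majorization by constant vectors gives average drifts -c(1-δ)/n for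
overloaded and cδ/n for underloaded bins, in every sum weighted by a nonnegative function that grows
with the distance from the mean. It then suffices to find V with E[V'] ≤ (1-γ/n)V + bn that
dominates an exponential of the maximum deviation (`exists_lyapunov`): E[V] stays below bn²/γ in all
rounds, and Markov's inequality gives the logarithmic bound.

The hyperbolic cosine potential with small exponent α is not enough. If ε ≤ δ ≤ 1-ε it falls at a
relative rate of order α/n (`sum_coshPot_le_of_mid`), but for δ near 0 or 1 the drift on one side
nearly vanishes and the potential may grow at a rate of order α²/n. Two further potentials, with
exponents of order α², compensate for this.

If the average deviation is large, `rootPot` does it: the drift of the quadratic potential combines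
the two sides with weights 1-δ and δ, which add to one, so it is negative whatever δ is
(`sum_weight_mul_normLoad_le`).

If the average deviation is bounded, the bounded potential of `exists_sidePot` does it. When most
bins are underloaded, the large upward jump of a chosen bin outweighs, in the capped exponential
`lowPot`, the slow sinking of the others. When most bins are overloaded, the rising mean sweeps
through the integer load levels; the discounted mass of the levels above it grows, and a level that
is passed is credited to the fraction of bins below (`thresholdPot_shift`). Jensen's inequality
(`exp_neg_absPot_le`) shows that one of the two effects is present.

The Lyapunov function `mixedPot` is the geometric mean of the three potentials, since by AM-GM their
relative drifts then average. The constants are chosen in the order K₂, K₃, ε, α: K₂ beats the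
growth of the cosine potential, K₃ beats that and the growth of the `rootPot` factor, ε makes the
errors of the side potential harmless, and α makes the first-order drift in the middle range beat
all terms of order α². -/

/-- The load vector after placing `w` balls into bin `i`. -/
def place (x : Fin n → ℕ) (i : Fin n) (w : ℕ) (j : Fin n) : ℕ := x j + if j = i then w else 0

/-- The number of balls placed into bin `i` under condition `W₁`. -/
noncomputable def weight (wp wm : ℕ) (x : Fin n → ℕ) (i : Fin n) : ℕ :=
  if normLoad x i < 0 then wm else wp

/-- The average load. -/
noncomputable def mean (x : Fin n → ℕ) : ℝ := (total x : ℝ) / n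

theorem normLoad_eq (x : Fin n → ℕ) (i : Fin n) : normLoad x i = x i - mean x := rfl

theorem total_place (x : Fin n → ℕ) (i : Fin n) (w : ℕ) :
    total (place x i w) = total x + w := by
  simp [total, place, Finset.sum_add_distrib]

theorem mean_place (x : Fin n → ℕ) (i : Fin n) (w : ℕ) :
    mean (place x i w) = mean x + w / n := by
  rw [mean, total_place, mean]; push_cast; ring

theorem normLoad_place (x : Fin n → ℕ) (i j : Fin n) (w : ℕ) :
    normLoad (place x i w) j = normLoad x j + w * ((if j = i then 1 else 0) - 1 / n) := by
  rw [normLoad_eq, normLoad_eq, mean_place]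
  by_cases h : j = i <;> simp [place, h] <;> ring

theorem sum_normLoad (hn : 0 < n) (x : Fin n → ℕ) : ∑ i, normLoad x i = 0 := by
  have : (n : ℝ) ≠ 0 := by positivity
  simp only [normLoad, Finset.sum_sub_distrib, Finset.sum_const, Finset.card_univ,
    Fintype.card_fin, nsmul_eq_mul, total]
  push_cast
  field_simp
  simp

theorem mem_overloaded {x : Fin n → ℕ} {i : Fin n} : i ∈ overloaded x ↔ 0 ≤ normLoad x i := by
  simp [overloaded]

theorem mem_underloaded {x : Fin n → ℕ} {i : Fin n} : i ∈ underloaded x ↔ normLoad x i < 0 := by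
  simp [underloaded]

theorem sum_over_add_sum_under (x : Fin n → ℕ) (f : Fin n → ℝ) :
    ∑ i ∈ overloaded x, f i + ∑ i ∈ underloaded x, f i = ∑ i, f i := by
  rw [← Finset.sum_filter_add_sum_filter_not Finset.univ (fun i => 0 ≤ normLoad x i) f]
  simp [overloaded, underloaded]

theorem card_over_add_card_under (x : Fin n → ℕ) :
    ((overloaded x).card : ℝ) + (underloaded x).card = n := by
  have := sum_over_add_sum_under x (fun _ => 1)
  simpa using this

theorem card_overloaded_eq (hn : 0 < n) (x : Fin n → ℕ) :
    ((overloaded x).card : ℝ) = meanQuantile x * n := by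
  have : (n : ℝ) ≠ 0 := by positivity
  rw [meanQuantile]; field_simp

theorem card_underloaded_eq (hn : 0 < n) (x : Fin n → ℕ) :
    ((underloaded x).card : ℝ) = (1 - meanQuantile x) * n := by
  have := card_over_add_card_under x
  have := card_overloaded_eq hn x
  linarith

theorem meanQuantile_nonneg (x : Fin n → ℕ) : 0 ≤ meanQuantile x := by
  unfold meanQuantile; positivity

theorem meanQuantile_le_one (x : Fin n → ℕ) : meanQuantile x ≤ 1 := by
  unfold meanQuantile
  exact div_le_one_of_le₀ (by exact_mod_cast card_overloaded_le x) (by positivity)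

/-- The expected number of balls placed in one round. -/
noncomputable def meanWeight (wp wm : ℕ) (x : Fin n → ℕ) (p : Fin n → ℝ) : ℝ :=
  ∑ i, p i * weight wp wm x i

/-- The expected change of the normalized load of bin `i` in one round. -/
noncomputable def loadDrift (wp wm : ℕ) (x : Fin n → ℕ) (p : Fin n → ℝ) (i : Fin n) : ℝ :=
  p i * weight wp wm x i - meanWeight wp wm x p / n

/-- The properties of a single round, from the load vector `x` with allocation probabilities `p`,
that force both overloaded and underloaded bins towards the mean. -/
structure MeanBiased (k₁ k₂ c : ℝ) (wp wm : ℕ) (x : Fin n → ℕ) (p : Fin n → ℝ) : Prop where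
  nonneg : ∀ i, 0 ≤ p i
  sum_eq_one : ∑ i, p i = 1
  one_le_wp : 1 ≤ wp
  wp_le_wm : wp ≤ wm
  over_le : ∀ i ∈ overloaded x, p i ≤ k₁ / n
  under_ge : ∀ i ∈ underloaded x, k₂ / n ≤ p i
  over_drift : ∀ f : ℝ → ℝ, MonotoneOn f (Set.Ici 0) → (∀ y, 0 ≤ y → 0 ≤ f y) →
    ∑ i ∈ overloaded x, f (normLoad x i) * loadDrift wp wm x p i ≤
      -(c * (1 - meanQuantile x) / n) * ∑ i ∈ overloaded x, f (normLoad x i)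
  under_drift : ∀ f : ℝ → ℝ, AntitoneOn f (Set.Iio 0) → (∀ y, y < 0 → 0 ≤ f y) →
    c * meanQuantile x / n * ∑ i ∈ underloaded x, f (normLoad x i) ≤
      ∑ i ∈ underloaded x, f (normLoad x i) * loadDrift wp wm x p i

theorem weight_of_over {wp wm : ℕ} {x : Fin n → ℕ} {i : Fin n} (h : i ∈ overloaded x) :
    weight wp wm x i = wp := by
  rw [mem_overloaded] at h
  simp [weight, not_lt.2 h]

theorem weight_of_under {wp wm : ℕ} {x : Fin n → ℕ} {i : Fin n} (h : i ∈ underloaded x) :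
    weight wp wm x i = wm := by
  rw [mem_underloaded] at h
  simp [weight, h]

namespace MeanBiased

variable {k₁ k₂ c : ℝ} {wp wm : ℕ} {x : Fin n → ℕ} {p : Fin n → ℝ}

theorem one_le_wm (h : MeanBiased k₁ k₂ c wp wm x p) : (1 : ℝ) ≤ wm := by
  exact_mod_cast h.one_le_wp.trans h.wp_le_wm

theorem weight_le (h : MeanBiased k₁ k₂ c wp wm x p) (i : Fin n) :
    (weight wp wm x i : ℝ) ≤ wm := by
  have := h.wp_le_wm
  unfold weight
  split_ifs
  · exact le_rfl
  · exact_mod_cast this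

theorem one_le_weight (h : MeanBiased k₁ k₂ c wp wm x p) (i : Fin n) :
    (1 : ℝ) ≤ weight wp wm x i := by
  have := h.one_le_wp
  have := h.wp_le_wm
  unfold weight
  split_ifs
  · exact_mod_cast this.trans' h.one_le_wp
  · exact_mod_cast h.one_le_wp

theorem meanWeight_nonneg (h : MeanBiased k₁ k₂ c wp wm x p) : 0 ≤ meanWeight wp wm x p :=
  Finset.sum_nonneg fun i _ => mul_nonneg (h.nonneg i) (by positivity)

theorem meanWeight_le (h : MeanBiased k₁ k₂ c wp wm x p) : meanWeight wp wm x p ≤ wm := by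
  calc meanWeight wp wm x p ≤ ∑ i, p i * wm :=
        Finset.sum_le_sum fun i _ => mul_le_mul_of_nonneg_left (h.weight_le i) (h.nonneg i)
    _ = wm := by rw [← Finset.sum_mul, h.sum_eq_one, one_mul]

theorem sum_over_le_one (h : MeanBiased k₁ k₂ c wp wm x p) : ∑ i ∈ overloaded x, p i ≤ 1 := by
  rw [← h.sum_eq_one]
  exact Finset.sum_le_univ_sum_of_nonneg h.nonneg

theorem sum_under_le_one (h : MeanBiased k₁ k₂ c wp wm x p) : ∑ i ∈ underloaded x, p i ≤ 1 := by
  rw [← h.sum_eq_one]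
  exact Finset.sum_le_univ_sum_of_nonneg h.nonneg

end MeanBiased

theorem exp_le_one_add_add_sq {z : ℝ} (hz : |z| ≤ 1) : Real.exp z ≤ 1 + z + z ^ 2 := by
  have := Real.abs_exp_sub_one_sub_id_le hz
  have := (abs_le.1 this).2
  linarith

/-! ### The smoothed Euclidean norm and its drift -/

/-- The quadratic potential. -/
noncomputable def quadPot (x : Fin n → ℕ) : ℝ := ∑ i, normLoad x i ^ 2

/-- The absolute value potential. -/
noncomputable def absPot (x : Fin n → ℕ) : ℝ := ∑ i, |normLoad x i|

/-- A smoothed Euclidean norm of the normalized load vector. -/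
noncomputable def rootPot (x : Fin n → ℕ) : ℝ := √(quadPot x + (n : ℝ) ^ 2)

theorem quadPot_nonneg (x : Fin n → ℕ) : 0 ≤ quadPot x :=
  Finset.sum_nonneg fun _ _ => sq_nonneg _

theorem absPot_nonneg (x : Fin n → ℕ) : 0 ≤ absPot x :=
  Finset.sum_nonneg fun _ _ => abs_nonneg _

theorem rootPot_sq (x : Fin n → ℕ) : rootPot x ^ 2 = quadPot x + (n : ℝ) ^ 2 :=
  Real.sq_sqrt (by have := quadPot_nonneg x; positivity)

/-- The shift by n² inside the root serves this bound: second-order terms of a step carry a factor 1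
/ `rootPot`, which is therefore O(1/n) even for flat load vectors. -/
theorem le_rootPot (x : Fin n → ℕ) : (n : ℝ) ≤ rootPot x :=
  Real.le_sqrt_of_sq_le (by have := quadPot_nonneg x; linarith)

theorem abs_normLoad_le_rootPot (x : Fin n → ℕ) (i : Fin n) : |normLoad x i| ≤ rootPot x := by
  apply Real.le_sqrt_of_sq_le
  rw [sq_abs]
  have : normLoad x i ^ 2 ≤ quadPot x :=
    Finset.single_le_sum (f := fun i => normLoad x i ^ 2) (fun _ _ => sq_nonneg _)
      (Finset.mem_univ i)
  nlinarith [sq_nonneg (n : ℝ)]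

theorem rootPot_le (x : Fin n → ℕ) : rootPot x ≤ absPot x + n := by
  have h0 := absPot_nonneg x
  apply Real.sqrt_le_iff.2 ⟨by positivity, ?_⟩
  have : quadPot x ≤ absPot x ^ 2 := by
    calc quadPot x = ∑ i, |normLoad x i| ^ 2 := by simp [quadPot]
      _ ≤ absPot x ^ 2 := Finset.sum_sq_le_sq_sum_of_nonneg fun _ _ => abs_nonneg _
  nlinarith [show (0 : ℝ) ≤ n by positivity]

theorem quadPot_place (hn : 0 < n) (x : Fin n → ℕ) (i : Fin n) (w : ℕ) :
    quadPot (place x i w) = quadPot x + 2 * w * normLoad x i + (w : ℝ) ^ 2 * (1 - 1 / n) := by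
  have hn' : (n : ℝ) ≠ 0 := by positivity
  have h1 : ∀ j, normLoad (place x i w) j ^ 2 = normLoad x j ^ 2
      + (if j = i then 2 * w * normLoad x j + (w : ℝ) ^ 2 * (1 - 2 / n) else 0)
      - 2 * w / n * normLoad x j + (w : ℝ) ^ 2 / n ^ 2 := by
    intro j
    rw [normLoad_place]
    split_ifs <;> field_simp <;> ring
  simp only [quadPot, h1, Finset.sum_add_distrib, Finset.sum_sub_distrib, ← Finset.mul_sum,
    sum_normLoad hn, Finset.sum_ite_eq', Finset.mem_univ, if_true, Finset.sum_const,
    Finset.card_univ, Fintype.card_fin, nsmul_eq_mul]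
  field_simp
  ring

/-- Concavity of the square root: S' - S ≤ (S'² - S²) / (2S), with the increment of the square taken
from `quadPot_place`. -/
theorem rootPot_place_le (hn : 0 < n) (x : Fin n → ℕ) (i : Fin n) (w : ℕ) :
    rootPot (place x i w) - rootPot x ≤
      w * normLoad x i / rootPot x + (w : ℝ) ^ 2 / (2 * rootPot x) := by
  have hn' : (0 : ℝ) < n := by positivity
  have hS : 0 < rootPot x := hn'.trans_le (le_rootPot x)
  have h1 := rootPot_sq x
  have h2 := rootPot_sq (place x i w)
  rw [quadPot_place hn] at h2
  have h3 : (w : ℝ) * normLoad x i / rootPot x + (w : ℝ) ^ 2 / (2 * rootPot x) =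
      (2 * w * normLoad x i + (w : ℝ) ^ 2) / (2 * rootPot x) := by field_simp
  rw [h3, le_div_iff₀ (by positivity)]
  have : 0 ≤ (w : ℝ) ^ 2 * (1 / n) := by positivity
  nlinarith [sq_nonneg (rootPot (place x i w) - rootPot x)]

/-- The deviations sum to zero, so the two sides of the mean carry equal shares. -/
theorem sum_over_normLoad (hn : 0 < n) (x : Fin n → ℕ) :
    ∑ i ∈ overloaded x, normLoad x i = absPot x / 2 ∧
      ∑ i ∈ underloaded x, -normLoad x i = absPot x / 2 := by
  have h1 := sum_over_add_sum_under x (normLoad x)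
  have h2 := sum_over_add_sum_under x (fun i => |normLoad x i|)
  rw [sum_normLoad hn] at h1
  have h3 : ∑ i ∈ overloaded x, |normLoad x i| = ∑ i ∈ overloaded x, normLoad x i :=
    Finset.sum_congr rfl fun i hi => abs_of_nonneg (mem_overloaded.1 hi)
  have h4 : ∑ i ∈ underloaded x, |normLoad x i| = ∑ i ∈ underloaded x, -normLoad x i :=
    Finset.sum_congr rfl fun i hi => abs_of_neg (mem_underloaded.1 hi)
  rw [h3, h4, ← absPot] at h2
  rw [Finset.sum_neg_distrib] at *
  constructor <;> linarith

namespace MeanBiased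

variable {k₁ k₂ c : ℝ} {wp wm : ℕ} {x : Fin n → ℕ} {p : Fin n → ℝ}

/-- The mean weight drops out because the deviations sum to zero. The test functions y and -y then
give the rates 1-δ and δ on equal halves of `absPot`, so δ cancels. -/
theorem sum_weight_mul_normLoad_le (h : MeanBiased k₁ k₂ c wp wm x p) (hn : 0 < n) :
    ∑ i, p i * (weight wp wm x i * normLoad x i) ≤ -(c / (2 * n)) * absPot x := by
  have hn' : (n : ℝ) ≠ 0 := by positivity
  have h1 : ∑ i, p i * (weight wp wm x i * normLoad x i) =
      ∑ i, normLoad x i * loadDrift wp wm x p i := by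
    have : ∀ i, normLoad x i * loadDrift wp wm x p i =
        p i * (weight wp wm x i * normLoad x i) -
          meanWeight wp wm x p / n * normLoad x i := by
      intro i; rw [loadDrift]; ring
    simp only [this, Finset.sum_sub_distrib, ← Finset.mul_sum, sum_normLoad hn]
    simp
  have h2 := h.over_drift id (fun _ _ _ _ h => h) (fun _ h => h)
  have h3 := h.under_drift (fun y => -y) (fun _ _ _ _ h => neg_le_neg h)
    (fun y hy => by linarith)
  obtain ⟨h4, h5⟩ := sum_over_normLoad hn x
  rw [h5] at h3
  simp only [id, h4] at h2
  simp only [neg_mul, Finset.sum_neg_distrib] at h3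
  rw [h1, ← sum_over_add_sum_under]
  have : -(c * (1 - meanQuantile x) / n) * (absPot x / 2) -
      c * meanQuantile x / n * (absPot x / 2) = -(c / (2 * n)) * absPot x := by
    field_simp; ring
  linarith

set_option maxHeartbeats 1000000 in
/-- The drift of `exp (η * rootPot)`. -/
theorem sum_exp_rootPot_le (h : MeanBiased k₁ k₂ c wp wm x p) (hn : 0 < n) (hk₁ : 1 ≤ k₁)
    (hc : 0 < c) (hc1 : c ≤ 1) {η : ℝ} (hη : 0 < η) (hη1 : η * (128 * k₁ * wm ^ 2) ≤ c) :
    ∑ i, p i * Real.exp (η * (rootPot (place x i (weight wp wm x i)) - rootPot x)) ≤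
      1 + η * (-(c / 8) * (absPot x / (n * rootPot x)) + wm ^ 2 / rootPot x
        + 2 * η * k₁ * wm ^ 2 / n) := by
  have hn' : (1 : ℝ) ≤ n := by exact_mod_cast hn
  have hS := le_rootPot x
  have hS0 : 0 < rootPot x := by linarith
  have hw := h.one_le_wm
  set w : ℝ := (wm : ℝ) with hwdef
  set S := rootPot x with hSdef
  set u : Fin n → ℝ := fun i => weight wp wm x i * normLoad x i / S with hu
  set v : ℝ := w ^ 2 / (2 * S) with hv
  have hw2 : 1 ≤ w ^ 2 := one_le_pow₀ hw
  have hww : w ≤ w ^ 2 := by nlinarith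
  have hkw : w ^ 2 ≤ k₁ * w ^ 2 := by nlinarith
  have hηw : η * (128 * w ^ 2) ≤ 1 := by nlinarith
  have hv0 : 0 ≤ v := by positivity
  have hv1 : v ≤ w ^ 2 / 2 := by
    rw [hv, div_le_div_iff₀ (by positivity) (by positivity)]; nlinarith
  have hus : ∀ i, |u i| ≤ w := by
    intro i
    rw [hu]
    simp only
    rw [abs_div, abs_of_pos hS0, div_le_iff₀ hS0, abs_mul, Nat.abs_cast]
    exact mul_le_mul (h.weight_le i) (abs_normLoad_le_rootPot x i) (abs_nonneg _) (by linarith)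
  have hstep : ∀ i, Real.exp (η * (rootPot (place x i (weight wp wm x i)) - S)) ≤
      1 + η * (u i + v) + 2 * η ^ 2 * u i ^ 2 + 2 * η ^ 2 * v ^ 2 := by
    intro i
    have h1 : rootPot (place x i (weight wp wm x i)) - S ≤ u i + v := by
      refine (rootPot_place_le hn x i _).trans (add_le_add le_rfl ?_)
      have := h.weight_le i
      rw [hv]
      gcongr
    have h2 := abs_le.1 (hus i)
    have h3 : |η * (u i + v)| ≤ 1 := by
      rw [abs_mul, abs_of_pos hη]
      have : |u i + v| ≤ 2 * w ^ 2 := by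
        rw [abs_le]; constructor <;> nlinarith
      nlinarith
    have h4 := exp_le_one_add_add_sq h3
    have h5 := Real.exp_le_exp.2 (mul_le_mul_of_nonneg_left h1 hη.le)
    have h6 : (u i + v) ^ 2 ≤ 2 * u i ^ 2 + 2 * v ^ 2 := by nlinarith [sq_nonneg (u i - v)]
    nlinarith [mul_le_mul_of_nonneg_left h6 (sq_nonneg η)]
  set X : ℝ := absPot x / (n * S) with hX
  have hX0 : 0 ≤ X := by have := absPot_nonneg x; positivity
  have hA : ∑ i, p i * u i ≤ -(c / 2) * X := by
    have h1 := h.sum_weight_mul_normLoad_le hn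
    have h2 : ∑ i, p i * u i = (∑ i, p i * (weight wp wm x i * normLoad x i)) / S := by
      rw [Finset.sum_div]; exact Finset.sum_congr rfl fun i _ => by rw [hu]; ring
    rw [h2, div_le_iff₀ hS0]
    refine h1.trans (le_of_eq ?_)
    rw [hX]; field_simp
  have hO1 : ∑ i ∈ overloaded x, p i * u i ≤ k₁ * w / 2 * X := by
    have h1 : ∀ i ∈ overloaded x, p i * u i ≤ k₁ * w / (n * S) * normLoad x i := by
      intro i hi
      have h2 := mem_overloaded.1 hi
      calc p i * u i ≤ k₁ / n * (w * normLoad x i / S) := by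
            refine mul_le_mul (h.over_le i hi) ?_ ?_ (by positivity)
            · rw [hu]; simp only; gcongr; exact h.weight_le i
            · rw [hu]; positivity
        _ = _ := by field_simp
    refine (Finset.sum_le_sum h1).trans (le_of_eq ?_)
    rw [← Finset.mul_sum, (sum_over_normLoad hn x).1, hX]; field_simp
  have hO2 : ∑ i ∈ overloaded x, p i * u i ^ 2 ≤ k₁ * w ^ 2 / n := by
    have h1 : ∀ i ∈ overloaded x, p i * u i ^ 2 ≤ k₁ * w ^ 2 / (n * S ^ 2) * normLoad x i ^ 2 := by
      intro i hi
      have h2 := mem_overloaded.1 hi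
      calc p i * u i ^ 2 ≤ k₁ / n * (w * normLoad x i / S) ^ 2 := by
            refine mul_le_mul (h.over_le i hi) ?_ (by positivity) (by positivity)
            rw [hu]; simp only; gcongr; exact h.weight_le i
        _ = _ := by field_simp
    refine (Finset.sum_le_sum h1).trans ?_
    rw [← Finset.mul_sum]
    have h3 : ∑ i ∈ overloaded x, normLoad x i ^ 2 ≤ S ^ 2 := by
      rw [hSdef, rootPot_sq]
      have : ∑ i ∈ overloaded x, normLoad x i ^ 2 ≤ quadPot x :=
        Finset.sum_le_univ_sum_of_nonneg fun _ => sq_nonneg _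
      nlinarith
    calc _ ≤ k₁ * w ^ 2 / (n * S ^ 2) * S ^ 2 := by gcongr
      _ = _ := by field_simp
  -- Underloaded bins have no upper bound of order 1/n on `p i`. Their second moment is instead
  -- charged to their first moment, which `hA` and `hO1` control.
  have hU2 : ∑ i ∈ underloaded x, p i * u i ^ 2 ≤ w * (-∑ i ∈ underloaded x, p i * u i) := by
    rw [← Finset.sum_neg_distrib, Finset.mul_sum]
    refine Finset.sum_le_sum fun i hi => ?_
    have h2 := mem_underloaded.1 hi
    have h3 : u i ≤ 0 := by
      rw [hu]; simp only
      exact div_nonpos_of_nonpos_of_nonneg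
        (mul_nonpos_of_nonneg_of_nonpos (by positivity) h2.le) hS0.le
    have h4 := (abs_le.1 (hus i)).1
    have h5 := h.nonneg i
    have h6 : u i ^ 2 ≤ w * -u i := by nlinarith
    nlinarith
  have hsplit1 := sum_over_add_sum_under x (fun i => p i * u i)
  have hsplit2 := sum_over_add_sum_under x (fun i => p i * u i ^ 2)
  have htot : ∑ i, p i * Real.exp (η * (rootPot (place x i (weight wp wm x i)) - S)) ≤
      1 + η * (∑ i, p i * u i + v) + 2 * η ^ 2 * ∑ i, p i * u i ^ 2 + 2 * η ^ 2 * v ^ 2 := by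
    refine (Finset.sum_le_sum fun i _ => mul_le_mul_of_nonneg_left (hstep i) (h.nonneg i)).trans
      (le_of_eq ?_)
    have : ∀ i, p i * (1 + η * (u i + v) + 2 * η ^ 2 * u i ^ 2 + 2 * η ^ 2 * v ^ 2) =
        (1 + η * v + 2 * η ^ 2 * v ^ 2) * p i + η * (p i * u i) + 2 * η ^ 2 * (p i * u i ^ 2) := by
      intro i; ring
    simp only [this, Finset.sum_add_distrib, ← Finset.mul_sum, h.sum_eq_one]
    ring
  refine htot.trans ?_
  set A := ∑ i, p i * u i
  set B := ∑ i, p i * u i ^ 2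
  have hB : B ≤ k₁ * w ^ 2 / n + w * (-A + k₁ * w / 2 * X) := by
    have : w * (-∑ i ∈ underloaded x, p i * u i) ≤ w * (-A + k₁ * w / 2 * X) :=
      mul_le_mul_of_nonneg_left (by linarith) (by linarith)
    linarith
  have hv2 : 2 * η * v ^ 2 ≤ v := by nlinarith
  have hvv : w ^ 2 / S = 2 * v := by rw [hv]; field_simp
  have e1 : 2 * η * B ≤ 2 * η * (k₁ * w ^ 2 / n + w * (-A + k₁ * w / 2 * X)) :=
    mul_le_mul_of_nonneg_left hB (by linarith)
  -- The part of the second moment charged to `A` thus uses up at most half of the drift.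
  have hηw1 : 2 * η * w ≤ 1 / 2 := by nlinarith
  have e2 : A * (1 - 2 * η * w) ≤ -(c / 2) * X * (1 - 2 * η * w) :=
    mul_le_mul_of_nonneg_right hA (by linarith)
  have e3 : -(c / 2) * X * (1 - 2 * η * w) ≤ -(c / 4) * X := by
    have : 0 ≤ c * X := by positivity
    nlinarith
  have e4 : η * (k₁ * w ^ 2) * X ≤ c / 128 * X := mul_le_mul_of_nonneg_right (by linarith) hX0
  have e5 : 0 ≤ c * X := by positivity
  have key : A + v + 2 * η * B + 2 * η * v ^ 2 ≤
      -(c / 8) * X + w ^ 2 / S + 2 * η * k₁ * w ^ 2 / n := by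
    have : 2 * η * (k₁ * w ^ 2 / n + w * (-A + k₁ * w / 2 * X)) =
      2 * η * k₁ * w ^ 2 / n - 2 * η * w * A + η * (k₁ * w ^ 2) * X := by ring
    rw [hvv]
    linarith
  have := mul_le_mul_of_nonneg_left key hη.le
  linarith

theorem sum_exp_rootPot_le_always (h : MeanBiased k₁ k₂ c wp wm x p) (hn : 0 < n) (hk₁ : 1 ≤ k₁)
    (hc : 0 < c) (hc1 : c ≤ 1) {η : ℝ} (hη : 0 < η) (hη1 : η * (128 * k₁ * wm ^ 2) ≤ c) :
    ∑ i, p i * Real.exp (η * (rootPot (place x i (weight wp wm x i)) - rootPot x)) ≤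
      1 + η * (2 * wm ^ 2) / n := by
  refine (h.sum_exp_rootPot_le hn hk₁ hc hc1 hη hη1).trans ?_
  have hn' : (0 : ℝ) < n := by positivity
  have hS := le_rootPot x
  have hS0 : 0 < rootPot x := by linarith
  have hw := h.one_le_wm
  have h1 : 0 ≤ (c / 8) * (absPot x / (n * rootPot x)) := by
    have := absPot_nonneg x; positivity
  have h2 : (wm : ℝ) ^ 2 / rootPot x ≤ wm ^ 2 / n := by gcongr
  have h3 : 2 * η * k₁ * (wm : ℝ) ^ 2 / n ≤ wm ^ 2 / n := by
    gcongr; nlinarith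
  have h4 : -(c / 8) * (absPot x / (n * rootPot x)) + wm ^ 2 / rootPot x
        + 2 * η * k₁ * wm ^ 2 / n ≤ 2 * wm ^ 2 / n := by
    have : 2 * (wm : ℝ) ^ 2 / n = wm ^ 2 / n + wm ^ 2 / n := by ring
    linarith
  have := mul_le_mul_of_nonneg_left h4 hη.le
  calc _ ≤ 1 + η * (2 * wm ^ 2 / n) := by linarith
    _ = _ := by ring

/-- Here `rootPot` is at most twice `absPot`, so the ratio absPot / (n · rootPot) is at least
1/(2n). Half of the drift c/8 absorbs the term w²/S; the other half is worth c/32 per n, and half of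
that absorbs the term quadratic in η. -/
theorem sum_exp_rootPot_le_of_absPot (h : MeanBiased k₁ k₂ c wp wm x p) (hn : 0 < n)
    (hk₁ : 1 ≤ k₁) (hc : 0 < c) (hc1 : c ≤ 1) {η : ℝ} (hη : 0 < η)
    (hη1 : η * (128 * k₁ * wm ^ 2) ≤ c) (hx : 16 * wm ^ 2 / c * n ≤ absPot x) :
    ∑ i, p i * Real.exp (η * (rootPot (place x i (weight wp wm x i)) - rootPot x)) ≤
      1 - η * (c / 64) / n := by
  refine (h.sum_exp_rootPot_le hn hk₁ hc hc1 hη hη1).trans ?_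
  have hn' : (0 : ℝ) < n := by positivity
  have hS := le_rootPot x
  have hS0 : 0 < rootPot x := by linarith
  have hw := h.one_le_wm
  have hw2 : (1 : ℝ) ≤ wm ^ 2 := one_le_pow₀ hw
  have hS2 : rootPot x ≤ 2 * absPot x := by
    have h1 := rootPot_le x
    have h2 : (n : ℝ) ≤ 16 * wm ^ 2 / c * n := by
      have : 1 ≤ 16 * (wm : ℝ) ^ 2 / c := by rw [le_div_iff₀ hc]; linarith
      nlinarith
    linarith
  have h1 : (wm : ℝ) ^ 2 / rootPot x ≤ c / 16 * (absPot x / (n * rootPot x)) := by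
    have : 16 * wm ^ 2 * n ≤ c * absPot x := by
      have := mul_le_mul_of_nonneg_left hx hc.le
      calc _ = c * (16 * wm ^ 2 / c * n) := by field_simp
        _ ≤ _ := this
    have h3 : c / 16 * (absPot x / (n * rootPot x)) = (c / 16 * absPot x / n) / rootPot x := by
      field_simp
    rw [h3]
    gcongr
    rw [le_div_iff₀ hn']; linarith
  have h2 : 1 / (2 * (n : ℝ)) ≤ absPot x / (n * rootPot x) := by
    rw [div_le_div_iff₀ (by positivity) (by positivity)]; nlinarith
  have h3 : 2 * η * k₁ * (wm : ℝ) ^ 2 / n ≤ c / 64 / n := by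
    gcongr; linarith
  have h4 : -(c / 8) * (absPot x / (n * rootPot x)) + wm ^ 2 / rootPot x
        + 2 * η * k₁ * wm ^ 2 / n ≤ -(c / 64 / n) := by
    have h5 := mul_le_mul_of_nonneg_left h2 (show 0 ≤ c / 16 by positivity)
    have h6 : c / 16 * (1 / (2 * (n : ℝ))) = 2 * (c / 64 / n) := by field_simp; norm_num
    linarith
  have := mul_le_mul_of_nonneg_left h4 hη.le
  calc _ ≤ 1 + η * (-(c / 64 / n)) := by linarith
    _ = _ := by ring

end MeanBiased

/-! ### The hyperbolic cosine potential and its drift -/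

/-- The hyperbolic cosine potential. -/
noncomputable def coshPot (α : ℝ) (x : Fin n → ℕ) : ℝ :=
  ∑ i, (Real.exp (α * normLoad x i) + Real.exp (-α * normLoad x i))

/-- The exponential potential of the overloaded bins. -/
noncomputable def overPot (α : ℝ) (x : Fin n → ℕ) : ℝ :=
  ∑ i ∈ overloaded x, Real.exp (α * normLoad x i)

/-- The exponential potential of the underloaded bins. -/
noncomputable def underPot (α : ℝ) (x : Fin n → ℕ) : ℝ :=
  ∑ i ∈ underloaded x, Real.exp (-α * normLoad x i)

theorem overPot_nonneg (α : ℝ) (x : Fin n → ℕ) : 0 ≤ overPot α x :=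
  Finset.sum_nonneg fun _ _ => (Real.exp_pos _).le

theorem underPot_nonneg (α : ℝ) (x : Fin n → ℕ) : 0 ≤ underPot α x :=
  Finset.sum_nonneg fun _ _ => (Real.exp_pos _).le

theorem coshPot_eq (α : ℝ) (x : Fin n → ℕ) :
    coshPot α x = overPot α x + underPot α x + ∑ i ∈ overloaded x, Real.exp (-α * normLoad x i)
      + ∑ i ∈ underloaded x, Real.exp (α * normLoad x i) := by
  rw [coshPot, ← sum_over_add_sum_under, Finset.sum_add_distrib, Finset.sum_add_distrib, overPot,
    underPot]
  ring

theorem overPot_add_underPot_le (α : ℝ) (x : Fin n → ℕ) :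
    overPot α x + underPot α x ≤ coshPot α x := by
  rw [coshPot_eq]
  have h1 : 0 ≤ ∑ i ∈ overloaded x, Real.exp (-α * normLoad x i) :=
    Finset.sum_nonneg fun _ _ => (Real.exp_pos _).le
  have h2 : 0 ≤ ∑ i ∈ underloaded x, Real.exp (α * normLoad x i) :=
    Finset.sum_nonneg fun _ _ => (Real.exp_pos _).le
  linarith

theorem coshPot_le {α : ℝ} (hα : 0 ≤ α) (x : Fin n → ℕ) :
    coshPot α x ≤ overPot α x + underPot α x + n := by
  rw [coshPot_eq]
  have h1 : ∑ i ∈ overloaded x, Real.exp (-α * normLoad x i) ≤ ∑ i ∈ overloaded x, 1 :=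
    Finset.sum_le_sum fun i hi => Real.exp_le_one_iff.2 (by
      have := mem_overloaded.1 hi; nlinarith)
  have h2 : ∑ i ∈ underloaded x, Real.exp (α * normLoad x i) ≤ ∑ i ∈ underloaded x, 1 :=
    Finset.sum_le_sum fun i hi => Real.exp_le_one_iff.2 (by
      have := mem_underloaded.1 hi; nlinarith)
  have h3 := card_over_add_card_under x
  simp only [Finset.sum_const, nsmul_eq_mul, mul_one] at h1 h2
  linarith

theorem exp_abs_le_coshPot (α : ℝ) (x : Fin n → ℕ) (i : Fin n) :
    Real.exp (α * |normLoad x i|) ≤ coshPot α x := by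
  have h1 : Real.exp (α * normLoad x i) + Real.exp (-α * normLoad x i) ≤ coshPot α x :=
    Finset.single_le_sum (f := fun i => Real.exp (α * normLoad x i) + Real.exp (-α * normLoad x i))
      (fun _ _ => by positivity) (Finset.mem_univ i)
  refine le_trans ?_ h1
  rcases abs_cases (normLoad x i) with h | h <;> rw [h.1]
  · linarith [Real.exp_pos (-α * normLoad x i)]
  · rw [mul_neg, ← neg_mul]; linarith [Real.exp_pos (α * normLoad x i)]

theorem two_mul_le_coshPot (α : ℝ) (x : Fin n → ℕ) : 2 * (n : ℝ) ≤ coshPot α x := by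
  have : ∑ i : Fin n, (2 : ℝ) ≤ coshPot α x := by
    refine Finset.sum_le_sum fun i _ => ?_
    have h1 := Real.add_one_le_exp (α * normLoad x i)
    have h2 := Real.add_one_le_exp (-α * normLoad x i)
    linarith
  simpa [mul_comm] using this

namespace MeanBiased

variable {k₁ k₂ c : ℝ} {wp wm : ℕ} {x : Fin n → ℕ} {p : Fin n → ℝ}

/-- Second-order expansion for one fixed bin j: the squared step is at most w²(1_{j=i} + 1/n), which
averages to w²(p_j + 1/n). -/
theorem sum_exp_place_le (h : MeanBiased k₁ k₂ c wp wm x p) (hn : 0 < n)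
    {β : ℝ} (hβ : |β| * wm ≤ 1) (j : Fin n) :
    ∑ i, p i * Real.exp (β * normLoad (place x i (weight wp wm x i)) j) ≤
      Real.exp (β * normLoad x j) *
        (1 + β * loadDrift wp wm x p j + β ^ 2 * wm ^ 2 * (p j + 1 / n)) := by
  have hn' : (1 : ℝ) ≤ n := by exact_mod_cast hn
  have hn1 : 1 / (n : ℝ) ≤ 1 := by rw [div_le_one (by linarith)]; exact hn'
  have hn0 : 0 < 1 / (n : ℝ) := by positivity
  have hw := h.one_le_wm
  have h1 : ∀ i, p i * Real.exp (β * normLoad (place x i (weight wp wm x i)) j) ≤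
      Real.exp (β * normLoad x j) * (p i + β * (p i * weight wp wm x i) *
        ((if j = i then 1 else 0) - 1 / n) +
          β ^ 2 * wm ^ 2 * (p i * ((if j = i then 1 else 0) + 1 / n))) := by
    intro i
    rw [normLoad_place, mul_add, Real.exp_add]
    set e : ℝ := if j = i then 1 else 0 with he
    have he' : e = 0 ∨ e = 1 := by rw [he]; split_ifs <;> simp
    have habs : |e - 1 / n| ≤ 1 := by
      rw [abs_le]; rcases he' with h | h <;> rw [h] <;> constructor <;> linarith
    have hsq : (e - 1 / n) ^ 2 ≤ e + 1 / n := by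
      rcases he' with h | h <;> rw [h] <;> nlinarith
    have hwt := h.weight_le i
    have hwt0 := h.one_le_weight i
    have hz : |β * (weight wp wm x i * (e - 1 / n))| ≤ 1 := by
      rw [abs_mul, abs_mul, Nat.abs_cast]
      calc |β| * (weight wp wm x i * |e - 1 / n|) ≤ |β| * (wm * 1) := by gcongr
        _ ≤ 1 := by linarith
    have h2 := exp_le_one_add_add_sq hz
    have h3 : (β * (weight wp wm x i * (e - 1 / n))) ^ 2 ≤ β ^ 2 * wm ^ 2 * (e + 1 / n) := by
      rw [mul_pow, mul_pow, mul_assoc]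
      gcongr
    have h4 := mul_le_mul_of_nonneg_left (h2.trans (add_le_add_right h3 _)) (h.nonneg i)
    have h5 := mul_le_mul_of_nonneg_left h4 (Real.exp_pos (β * normLoad x j)).le
    calc _ = Real.exp (β * normLoad x j) *
        (p i * Real.exp (β * (weight wp wm x i * (e - 1 / n)))) := by ring
      _ ≤ _ := h5
      _ = _ := by ring
  refine (Finset.sum_le_sum fun i _ => h1 i).trans (le_of_eq ?_)
  rw [← Finset.mul_sum]
  congr 1
  have h2 : ∀ i, (p i + β * (p i * weight wp wm x i) *
        ((if j = i then 1 else 0) - 1 / n) +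
          β ^ 2 * wm ^ 2 * (p i * ((if j = i then 1 else 0) + 1 / n))) =
      p i + (if j = i then β * (p i * weight wp wm x i) + β ^ 2 * wm ^ 2 * p i else 0)
        - β / n * (p i * weight wp wm x i) + β ^ 2 * wm ^ 2 / n * p i := by
    intro i
    split_ifs <;> ring
  simp only [h2, Finset.sum_add_distrib, Finset.sum_sub_distrib, ← Finset.mul_sum, h.sum_eq_one,
    Finset.sum_ite_eq, Finset.mem_univ, if_true, loadDrift, meanWeight]
  ring

set_option maxHeartbeats 1000000 in
/-- The drift of the hyperbolic cosine potential. -/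
theorem sum_coshPot_le (h : MeanBiased k₁ k₂ c wp wm x p) (hn : 0 < n) (hk₁ : 1 ≤ k₁)
    (hc : 0 < c) {α : ℝ} (hα : 0 < α) (hα1 : α * wm ≤ 1 / 2) :
    ∑ i, p i * coshPot α (place x i (weight wp wm x i)) ≤ coshPot α x
      - α * c / (2 * n) * ((1 - meanQuantile x) * overPot α x + meanQuantile x * underPot α x)
      + 2 * k₁ * wm ^ 2 * α ^ 2 / n * coshPot α x + 4 * α * wm := by
  have hn' : (1 : ℝ) ≤ n := by exact_mod_cast hn
  have hn0 : 0 < 1 / (n : ℝ) := by positivity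
  have hw := h.one_le_wm
  set w : ℝ := (wm : ℝ) with hwdef
  set δ := meanQuantile x
  set y := normLoad x
  set d := loadDrift wp wm x p with hd
  set Q := α ^ 2 * w ^ 2 with hQ
  have hQ0 : 0 ≤ Q := by positivity
  have hQ1 : Q ≤ α * w / 2 := by rw [hQ]; nlinarith [mul_pos hα (show 0 < w by linarith)]
  have hδ0 : 0 ≤ δ := meanQuantile_nonneg x
  have hMW := h.meanWeight_le
  have hMW0 := h.meanWeight_nonneg
  have hd_ge : ∀ j, -(w / n) ≤ d j := by
    intro j
    have h1 : 0 ≤ p j * weight wp wm x j := mul_nonneg (h.nonneg j) (by positivity)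
    have h2 : meanWeight wp wm x p / n ≤ w / n := by gcongr
    rw [hd, loadDrift]; linarith
  have hd_le : ∀ j, d j ≤ w * p j := by
    intro j
    have h1 : p j * weight wp wm x j ≤ p j * w :=
      mul_le_mul_of_nonneg_left (h.weight_le j) (h.nonneg j)
    have h2 : 0 ≤ meanWeight wp wm x p / n := by positivity
    rw [hd, loadDrift]; linarith
  have hcO := card_overloaded_le x
  have hcO' : ((overloaded x).card : ℝ) ≤ n := by exact_mod_cast hcO
  have hcU' : ((underloaded x).card : ℝ) ≤ n := by
    have := card_over_add_card_under x
    have : (0 : ℝ) ≤ (overloaded x).card := by positivity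
    linarith
  have hsO : ∑ j ∈ overloaded x, (p j + 1 / n) ≤ 2 := by
    rw [Finset.sum_add_distrib, Finset.sum_const, nsmul_eq_mul]
    have h1 := h.sum_over_le_one
    have : ((overloaded x).card : ℝ) * (1 / n) ≤ 1 := by
      rw [mul_one_div, div_le_one (by linarith)]; exact hcO'
    linarith
  have hsU : ∑ j ∈ underloaded x, (p j + 1 / n) ≤ 2 := by
    rw [Finset.sum_add_distrib, Finset.sum_const, nsmul_eq_mul]
    have h1 := h.sum_under_le_one
    have : ((underloaded x).card : ℝ) * (1 / n) ≤ 1 := by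
      rw [mul_one_div, div_le_one (by linarith)]; exact hcU'
    linarith
  -- overloaded bins, growing exponential
  have b1 : ∑ j ∈ overloaded x, Real.exp (α * y j) * (α * d j + Q * (p j + 1 / n)) ≤
      -(α * c * (1 - δ) / n) * overPot α x + 2 * k₁ * Q / n * overPot α x := by
    have h1 := h.over_drift (fun y => Real.exp (α * y))
      (fun a _ b _ hab => Real.exp_le_exp.2 (by gcongr)) (fun _ _ => (Real.exp_pos _).le)
    have h2 : ∀ j ∈ overloaded x, Real.exp (α * y j) * (α * d j + Q * (p j + 1 / n)) ≤
        α * (Real.exp (α * y j) * d j) + 2 * k₁ * Q / n * Real.exp (α * y j) := by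
      intro j hj
      have h3 : p j + 1 / n ≤ 2 * k₁ / n := by
        have := h.over_le j hj
        have : 1 / (n : ℝ) ≤ k₁ / n := by gcongr
        have : 2 * k₁ / n = k₁ / n + k₁ / n := by ring
        linarith
      have h4 := mul_le_mul_of_nonneg_left h3 hQ0
      have h5 := mul_le_mul_of_nonneg_left h4 (Real.exp_pos (α * y j)).le
      have h6 : Real.exp (α * y j) * (Q * (2 * k₁ / n)) =
        2 * k₁ * Q / n * Real.exp (α * y j) := by ring
      linarith
    refine (Finset.sum_le_sum h2).trans ?_
    rw [Finset.sum_add_distrib, ← Finset.mul_sum, ← Finset.mul_sum]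
    have h3 := mul_le_mul_of_nonneg_left h1 hα.le
    have h4 : α * (-(c * (1 - δ) / n) * ∑ i ∈ overloaded x, Real.exp (α * y i)) =
      -(α * c * (1 - δ) / n) * overPot α x := by rw [overPot]; ring
    rw [← overPot]
    linarith
  -- On the side where the exponential is at most one, only a bounded additive contribution arises,
  -- as also in `b3`.
  have b2 : ∑ j ∈ underloaded x, Real.exp (α * y j) * (α * d j + Q * (p j + 1 / n)) ≤
      2 * α * w := by
    have h2 : ∀ j ∈ underloaded x, Real.exp (α * y j) * (α * d j + Q * (p j + 1 / n)) ≤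
        α * w * p j + Q * (p j + 1 / n) := by
      intro j hj
      have h3 : Real.exp (α * y j) ≤ 1 :=
        Real.exp_le_one_iff.2 (by have := mem_underloaded.1 hj; nlinarith)
      have h4 := mul_le_mul_of_nonneg_left (hd_le j) hα.le
      have h5 := h.nonneg j
      have h6 : 0 ≤ α * w * p j + Q * (p j + 1 / n) := by positivity
      calc _ ≤ Real.exp (α * y j) * (α * w * p j + Q * (p j + 1 / n)) :=
            mul_le_mul_of_nonneg_left (by linarith) (Real.exp_pos _).le
        _ ≤ 1 * (α * w * p j + Q * (p j + 1 / n)) := by gcongr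
        _ = _ := one_mul _
    refine (Finset.sum_le_sum h2).trans ?_
    rw [Finset.sum_add_distrib, ← Finset.mul_sum, ← Finset.mul_sum]
    have h3 := h.sum_under_le_one
    have h4 : α * w * ∑ i ∈ underloaded x, p i ≤ α * w * 1 := by gcongr
    have h5 : Q * ∑ i ∈ underloaded x, (p i + 1 / n) ≤ Q * 2 := by gcongr
    linarith
  have b3 : ∑ j ∈ overloaded x, Real.exp (-α * y j) * (-α * d j + Q * (p j + 1 / n)) ≤
      2 * α * w := by
    have h2 : ∀ j ∈ overloaded x, Real.exp (-α * y j) * (-α * d j + Q * (p j + 1 / n)) ≤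
        α * w * (1 / n) + Q * (p j + 1 / n) := by
      intro j hj
      have h3 : Real.exp (-α * y j) ≤ 1 :=
        Real.exp_le_one_iff.2 (by have := mem_overloaded.1 hj; nlinarith)
      have h4 := mul_le_mul_of_nonneg_left (hd_ge j) hα.le
      have h5 := h.nonneg j
      have h6 : 0 ≤ α * w * (1 / n) + Q * (p j + 1 / n) := by positivity
      have h7 : α * -(w / n) = -(α * w * (1 / n)) := by ring
      calc _ ≤ Real.exp (-α * y j) * (α * w * (1 / n) + Q * (p j + 1 / n)) :=
            mul_le_mul_of_nonneg_left (by linarith) (Real.exp_pos _).le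
        _ ≤ 1 * (α * w * (1 / n) + Q * (p j + 1 / n)) := by gcongr
        _ = _ := one_mul _
    refine (Finset.sum_le_sum h2).trans ?_
    rw [Finset.sum_add_distrib, Finset.sum_const, nsmul_eq_mul, ← Finset.mul_sum]
    have h4 : ((overloaded x).card : ℝ) * (α * w * (1 / n)) ≤ α * w := by
      calc _ ≤ (n : ℝ) * (α * w * (1 / n)) := by gcongr
        _ = _ := by field_simp
    have h5 : Q * ∑ i ∈ overloaded x, (p i + 1 / n) ≤ Q * 2 := by gcongr
    linarith
  have b4 : ∑ j ∈ underloaded x, Real.exp (-α * y j) * (-α * d j + Q * (p j + 1 / n)) ≤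
      -(α * c * δ / (2 * n)) * underPot α x + 2 * k₁ * Q / n * underPot α x := by
    have h1 := h.under_drift (fun y => Real.exp (-α * y))
      (fun a _ b _ hab => Real.exp_le_exp.2 (by nlinarith)) (fun _ _ => (Real.exp_pos _).le)
    have h2 : ∀ j ∈ underloaded x, Real.exp (-α * y j) * (-α * d j + Q * (p j + 1 / n)) ≤
        -(α * (1 - α * w)) * (Real.exp (-α * y j) * d j) +
          2 * Q / n * Real.exp (-α * y j) := by
      intro j hj
      -- The probability of an underloaded bin may be large, so its quadratic term is expressed
      -- through the drift itself; this costs the factor 1 - αw ≥ 1/2.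
      have h3 : w * p j ≤ d j + w / n := by
        have h2 : meanWeight wp wm x p / n ≤ w / n := by gcongr
        rw [hd, loadDrift, weight_of_under hj]; linarith
      have h4 := mul_le_mul_of_nonneg_left h3 (show 0 ≤ α ^ 2 * w by positivity)
      have h5 : -α * d j + Q * (p j + 1 / n) ≤ -(α * (1 - α * w)) * d j + 2 * Q / n := by
        have : α ^ 2 * w * (w / n) = Q * (1 / n) := by rw [hQ]; ring
        have : 2 * Q / n = Q * (1 / n) + Q * (1 / n) := by ring
        rw [hQ] at *
        linarith
      have h6 := mul_le_mul_of_nonneg_left h5 (Real.exp_pos (-α * y j)).le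
      linarith
    refine (Finset.sum_le_sum h2).trans ?_
    rw [Finset.sum_add_distrib, ← Finset.mul_sum, ← Finset.mul_sum, ← underPot]
    have h6 := underPot_nonneg α x
    have h3 := mul_le_mul_of_nonneg_left h1 (show 0 ≤ α * (1 - α * w) by nlinarith)
    have h4 : α * (c * δ / (2 * n)) * underPot α x ≤
        α * (1 - α * w) * (c * δ / n * underPot α x) := by
      have h7 : 0 ≤ c * δ / n * underPot α x := by positivity
      have : α * (c * δ / (2 * n)) * underPot α x =
        α * (1 / 2) * (c * δ / n * underPot α x) := by field_simp
      rw [this]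
      gcongr
      linarith
    have h5 : 2 * Q / n * underPot α x ≤ 2 * k₁ * Q / n * underPot α x := by
      gcongr; linarith
    have h8 : underPot α x = ∑ i ∈ underloaded x, Real.exp (-α * normLoad x i) := rfl
    rw [← h8] at h3
    have h9 : α * (c * δ / (2 * n)) * underPot α x = α * c * δ / (2 * n) * underPot α x := by ring
    linarith
  have hβ1 : |α| * w ≤ 1 := by rw [abs_of_pos hα]; linarith
  have hβ2 : |(-α)| * w ≤ 1 := by rw [abs_neg]; exact hβ1
  have main : ∑ i, p i * coshPot α (place x i (weight wp wm x i)) ≤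
      coshPot α x + ∑ j, Real.exp (α * y j) * (α * d j + Q * (p j + 1 / n)) +
        ∑ j, Real.exp (-α * y j) * (-α * d j + Q * (p j + 1 / n)) := by
    simp only [coshPot, Finset.mul_sum]
    rw [Finset.sum_comm, ← Finset.sum_add_distrib, ← Finset.sum_add_distrib]
    refine Finset.sum_le_sum fun j _ => ?_
    have h1 := h.sum_exp_place_le hn hβ1 j
    have h2 := h.sum_exp_place_le hn hβ2 j
    simp only [mul_add, Finset.sum_add_distrib] at h1 h2 ⊢
    have h3 : (-α) ^ 2 = α ^ 2 := by ring
    rw [h3] at h2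
    simp only [hQ]
    linarith
  refine main.trans ?_
  rw [← sum_over_add_sum_under x (fun j => Real.exp (α * y j) * (α * d j + Q * (p j + 1 / n))),
    ← sum_over_add_sum_under x (fun j => Real.exp (-α * y j) * (-α * d j + Q * (p j + 1 / n)))]
  have hO := overPot_nonneg α x
  have hU := underPot_nonneg α x
  have hOU := overPot_add_underPot_le α x
  have e1 : 2 * k₁ * Q / n * (overPot α x + underPot α x) ≤
      2 * k₁ * wm ^ 2 * α ^ 2 / n * coshPot α x := by
    have : 2 * k₁ * Q / n = 2 * k₁ * wm ^ 2 * α ^ 2 / n := by rw [hQ]; ring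
    rw [this]
    gcongr
  have e2 : -(α * c * (1 - δ) / n) * overPot α x ≤
      -(α * c * (1 - δ) / (2 * n)) * overPot α x := by
    have h1 : 0 ≤ (α * c * (1 - δ) / (2 * n)) := by
      have : 0 ≤ 1 - δ := by linarith [meanQuantile_le_one x]
      positivity
    have h2 : α * c * (1 - δ) / n = 2 * (α * c * (1 - δ) / (2 * n)) := by field_simp
    rw [h2]; nlinarith
  have e3 : α * c / (2 * n) * ((1 - δ) * overPot α x + δ * underPot α x) =
      α * c * (1 - δ) / (2 * n) * overPot α x + α * c * δ / (2 * n) * underPot α x := by ring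
  linarith

/-- Bounding both 1-δ and δ below by ε recovers the full potential up to the additive n of
`coshPot_le`. The value ε = 0 yields the unconditional bound `sum_coshPot_le_always`. -/
theorem sum_coshPot_le_of_mid (h : MeanBiased k₁ k₂ c wp wm x p) (hn : 0 < n) (hk₁ : 1 ≤ k₁)
    (hc : 0 < c) {α : ℝ} (hα : 0 < α) (hα1 : α * wm ≤ 1 / 2) {ε : ℝ}
    (h1 : ε ≤ meanQuantile x) (h2 : meanQuantile x ≤ 1 - ε) :
    ∑ i, p i * coshPot α (place x i (weight wp wm x i)) ≤ coshPot α x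
      - α * c * ε / (2 * n) * (coshPot α x - n)
      + 2 * k₁ * wm ^ 2 * α ^ 2 / n * coshPot α x + 4 * α * wm := by
  refine (h.sum_coshPot_le hn hk₁ hc hα hα1).trans ?_
  have h3 := overPot_nonneg α x
  have h4 := underPot_nonneg α x
  have h5 := coshPot_le hα.le x
  have hn' : (0 : ℝ) < n := by positivity
  have h6 : ε * overPot α x ≤ (1 - meanQuantile x) * overPot α x := by gcongr; linarith
  have h7 : ε * underPot α x ≤ meanQuantile x * underPot α x := by gcongr
  rcases le_total ε 0 with hε | hε
  · have h8 : 0 ≤ coshPot α x - n := by linarith [two_mul_le_coshPot α x]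
    have h9 : 0 ≤ α * c / (2 * n) := by positivity
    have h10 : α * c * ε / (2 * n) * (coshPot α x - n) ≤ 0 := by
      have : α * c * ε / (2 * n) = α * c / (2 * n) * ε := by ring
      rw [this]
      exact mul_nonpos_of_nonpos_of_nonneg (mul_nonpos_of_nonneg_of_nonpos h9 hε) h8
    have h11 : 0 ≤ α * c / (2 * n) *
        ((1 - meanQuantile x) * overPot α x + meanQuantile x * underPot α x) := by
      have := meanQuantile_nonneg x
      have : 0 ≤ 1 - meanQuantile x := by linarith [meanQuantile_le_one x]
      positivity
    linarith
  · have h8 : ε * (coshPot α x - n) ≤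
        (1 - meanQuantile x) * overPot α x + meanQuantile x * underPot α x := by nlinarith
    have h9 := mul_le_mul_of_nonneg_left h8 (show 0 ≤ α * c / (2 * n) by positivity)
    have h10 : α * c * ε / (2 * n) * (coshPot α x - n) =
      α * c / (2 * n) * (ε * (coshPot α x - n)) := by ring
    linarith

theorem sum_coshPot_le_always (h : MeanBiased k₁ k₂ c wp wm x p) (hn : 0 < n) (hk₁ : 1 ≤ k₁)
    (hc : 0 < c) {α : ℝ} (hα : 0 < α) (hα1 : α * wm ≤ 1 / 2) :
    ∑ i, p i * coshPot α (place x i (weight wp wm x i)) ≤ coshPot α x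
      + 2 * k₁ * wm ^ 2 * α ^ 2 / n * coshPot α x + 4 * α * wm := by
  simpa using h.sum_coshPot_le_of_mid (ε := 0) hn hk₁ hc hα hα1 (meanQuantile_nonneg x)
    (by simpa using meanQuantile_le_one x)

end MeanBiased

/-! ### The capped exponential potential -/

/-- A bounded potential that decreases when many bins are slightly underloaded. -/
noncomputable def lowPot (ϑ w : ℝ) (x : Fin n → ℕ) : ℝ :=
  (∑ i, -Real.exp (ϑ * min (normLoad x i) w)) / n

theorem abs_lowPot_le (hn : 0 < n) {ϑ w : ℝ} (hϑ : 0 ≤ ϑ) (x : Fin n → ℕ) :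
    |lowPot ϑ w x| ≤ Real.exp (ϑ * w) := by
  have hn' : (0 : ℝ) < n := by positivity
  rw [lowPot, abs_div, Nat.abs_cast, div_le_iff₀ hn']
  refine (Finset.abs_sum_le_sum_abs _ _).trans ?_
  have : ∀ i ∈ Finset.univ, |-Real.exp (ϑ * min (normLoad x i) w)| ≤ Real.exp (ϑ * w) := by
    intro i _
    rw [abs_neg, Real.abs_exp]
    exact Real.exp_le_exp.2 (mul_le_mul_of_nonneg_left (min_le_right _ _) hϑ)
  refine (Finset.sum_le_sum this).trans (le_of_eq ?_)
  simp [mul_comm]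

/-- The contribution of the drop of bin `j` to the increase of `lowPot`. -/
noncomputable def lowTerm (ϑ w : ℝ) (x : Fin n → ℕ) (j : Fin n) : ℝ :=
  if normLoad x j < 2 * w then Real.exp (ϑ * min (normLoad x j) w) else 0

theorem lowTerm_nonneg (ϑ w : ℝ) (x : Fin n → ℕ) (j : Fin n) : 0 ≤ lowTerm ϑ w x j := by
  unfold lowTerm; split_ifs <;> positivity

theorem lowTerm_le {ϑ w : ℝ} (hϑ : 0 ≤ ϑ) (x : Fin n → ℕ) (j : Fin n) :
    lowTerm ϑ w x j ≤ Real.exp (ϑ * w) := by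
  unfold lowTerm; split_ifs
  · exact Real.exp_le_exp.2 (mul_le_mul_of_nonneg_left (min_le_right _ _) hϑ)
  · positivity

/-- The decrease of `lowPot` caused by an allocation to bin `i`. -/
noncomputable def lowGain (ϑ w : ℝ) (x : Fin n → ℕ) (i : Fin n) : ℝ :=
  if normLoad x i < 0 then
    Real.exp (ϑ * (normLoad x i - w / n)) * (Real.exp (ϑ * w) - 1) else 0

theorem lowGain_nonneg {ϑ w : ℝ} (hϑ : 0 ≤ ϑ) (hw : 0 ≤ w) (x : Fin n → ℕ) (i : Fin n) :
    0 ≤ lowGain ϑ w x i := by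
  unfold lowGain
  have : 1 ≤ Real.exp (ϑ * w) := Real.one_le_exp (by positivity)
  split_ifs
  · exact mul_nonneg (Real.exp_pos _).le (by linarith)
  · exact le_rfl

theorem lowGain_le {ϑ w : ℝ} (hϑ : 0 ≤ ϑ) (hw : 0 ≤ w) (x : Fin n → ℕ) (i : Fin n) :
    lowGain ϑ w x i ≤ Real.exp (ϑ * w) := by
  unfold lowGain
  have h1 : 1 ≤ Real.exp (ϑ * w) := Real.one_le_exp (by positivity)
  split_ifs with h
  · have h2 : Real.exp (ϑ * (normLoad x i - w / n)) ≤ 1 := by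
      apply Real.exp_le_one_iff.2
      have : 0 ≤ w / n := by positivity
      nlinarith
    nlinarith
  · positivity

theorem exp_sub_exp_le (ϑ a b : ℝ) :
    Real.exp (ϑ * a) - Real.exp (ϑ * b) ≤ Real.exp (ϑ * a) * (ϑ * (a - b)) := by
  have h1 := Real.add_one_le_exp (ϑ * (b - a))
  have h2 : Real.exp (ϑ * b) = Real.exp (ϑ * a) * Real.exp (ϑ * (b - a)) := by
    rw [← Real.exp_add]; congr 1; ring
  rw [h2]
  nlinarith [Real.exp_pos (ϑ * a)]

/-- Every bin sinks by at most w/n relative to the mean, and a chosen underloaded bin jumps by w.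
The cap does not cut off this jump, since the bin lands at or below w; bins from 2w on stay above
the cap and contribute nothing. -/
theorem lowPot_place_le (hn : 0 < n) {ϑ : ℝ} (hϑ : 0 ≤ ϑ) {wp wm : ℕ} (hw : wp ≤ wm)
    (x : Fin n → ℕ) (i : Fin n) :
    lowPot ϑ wm (place x i (weight wp wm x i)) - lowPot ϑ wm x ≤
      (wm * ϑ / n * ∑ j, lowTerm ϑ wm x j - lowGain ϑ wm x i) / n := by
  have hn' : (1 : ℝ) ≤ n := by exact_mod_cast hn
  have hw' : (weight wp wm x i : ℝ) ≤ wm := by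
    unfold weight; split_ifs
    · exact le_rfl
    · exact_mod_cast hw
  have hwn : (wm : ℝ) / n ≤ wm := div_le_self (by positivity) hn'
  have hwn0 : 0 ≤ (wm : ℝ) / n := by positivity
  have hwin : (weight wp wm x i : ℝ) / n ≤ wm / n := by gcongr
  rw [lowPot, lowPot, ← sub_div, ← Finset.sum_sub_distrib, Finset.mul_sum]
  gcongr
  have key : ∀ j, -Real.exp (ϑ * min (normLoad (place x i (weight wp wm x i)) j) wm) -
      -Real.exp (ϑ * min (normLoad x j) wm) ≤
      wm * ϑ / n * lowTerm ϑ wm x j - if j = i then lowGain ϑ wm x i else 0 := by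
    intro j
    rw [normLoad_place]
    by_cases hij : j = i ∧ normLoad x i < 0
    · obtain ⟨rfl, hneg⟩ := hij
      have h1 : weight wp wm x j = wm := by simp [weight, hneg]
      have h3 : normLoad x j < 2 * wm := by
        have : (0 : ℝ) ≤ wm := by positivity
        linarith
      have hm1 : min (normLoad x j) wm = normLoad x j := min_eq_left (by linarith)
      have hm2 : min (normLoad x j + wm * (1 - 1 / n)) (wm : ℝ) = normLoad x j - wm / n + wm := by
        have : normLoad x j + wm * (1 - 1 / n) = normLoad x j - wm / n + wm := by ring
        rw [this]
        exact min_eq_left (by linarith)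
      simp only [h1, if_true, lowGain, lowTerm, hneg, h3, hm1, hm2]
      have h4 := exp_sub_exp_le ϑ (normLoad x j) (normLoad x j - wm / n)
      have h5 : Real.exp (ϑ * (normLoad x j - wm / n + wm)) =
          Real.exp (ϑ * (normLoad x j - wm / n)) * Real.exp (ϑ * wm) := by
        rw [← Real.exp_add]; congr 1; ring
      rw [h5]
      have h6 : Real.exp (ϑ * normLoad x j) *
          (ϑ * (normLoad x j - (normLoad x j - wm / n))) =
          wm * ϑ / n * Real.exp (ϑ * normLoad x j) := by ring
      linarith
    · have hg : (if j = i then lowGain ϑ wm x i else 0) = 0 := by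
        split_ifs with h
        · have : ¬ normLoad x i < 0 := fun h' => hij ⟨h, h'⟩
          simp [lowGain, this]
        · rfl
      rw [hg, sub_zero]
      have hge : normLoad x j - wm / n ≤
          normLoad x j + weight wp wm x i * ((if j = i then 1 else 0) - 1 / n) := by
        have h1 : (0 : ℝ) ≤ weight wp wm x i := by positivity
        split_ifs
        · have : (weight wp wm x i : ℝ) * (1 - 1 / n) = weight wp wm x i - weight wp wm x i / n := by
            ring
          linarith
        · have : (weight wp wm x i : ℝ) * (0 - 1 / n) = - (weight wp wm x i / n) := by
            ring
          linarith
      set y' := normLoad x j + weight wp wm x i * ((if j = i then 1 else 0) - 1 / n)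
      unfold lowTerm
      split_ifs with h2
      · have h3 : min (normLoad x j) wm - wm / n ≤ min y' wm := by
          apply le_min
          · linarith [min_le_left (normLoad x j) (wm : ℝ)]
          · linarith [min_le_right (normLoad x j) (wm : ℝ)]
        have h4 := exp_sub_exp_le ϑ (min (normLoad x j) wm) (min y' wm)
        have h5 : ϑ * (min (normLoad x j) wm - min y' wm) ≤ ϑ * (wm / n) :=
          mul_le_mul_of_nonneg_left (by linarith) hϑ
        have h6 := mul_le_mul_of_nonneg_left h5 (Real.exp_pos (ϑ * min (normLoad x j) wm)).le
        have h7 : wm * ϑ / n * Real.exp (ϑ * min (normLoad x j) wm) =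
          Real.exp (ϑ * min (normLoad x j) wm) * (ϑ * (wm / n)) := by ring
        linarith
      · push Not at h2
        rw [min_eq_right (by linarith), min_eq_right (by linarith)]
        simp
  refine (Finset.sum_le_sum fun j _ => key j).trans (le_of_eq ?_)
  rw [Finset.sum_sub_distrib]
  simp

namespace MeanBiased

variable {k₁ k₂ c : ℝ} {wp wm : ℕ} {x : Fin n → ℕ} {p : Fin n → ℝ}

/-- For n ≥ 2 the bracket is at least e^{t/2} - e^{-t/2} ≥ t²/8, and kt ≥ 16. This is the origin of
the exponent 16/k₂. -/
theorem two_mul_le_of_exponent {t k : ℝ} (hk : 0 < k) (ht : 16 / k ≤ t) (hn : 2 ≤ n) :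
    2 * t ≤ k * (Real.exp (-(t / n)) * (Real.exp t - 1)) := by
  have hn' : (2 : ℝ) ≤ n := by exact_mod_cast hn
  have ht0 : 0 ≤ t := le_trans (by positivity) ht
  have h1 : Real.exp (-(t / 2)) ≤ Real.exp (-(t / n)) := by
    apply Real.exp_le_exp.2
    gcongr
  have h2 := Real.quadratic_le_exp_of_nonneg (show 0 ≤ t / 2 by positivity)
  have h3 : Real.exp (-(t / 2)) * (Real.exp t - 1) = Real.exp (t / 2) - Real.exp (-(t / 2)) := by
    rw [mul_sub, ← Real.exp_add, mul_one]; congr 2; ring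
  have h4 : Real.exp (-(t / 2)) ≤ 1 := Real.exp_le_one_iff.2 (by linarith)
  have h5 : 0 ≤ Real.exp t - 1 := by linarith [Real.one_le_exp ht0]
  have h6 := mul_le_mul_of_nonneg_right h1 h5
  rw [div_le_iff₀ hk] at ht
  have h7 : t ^ 2 / 8 ≤ Real.exp (-(t / n)) * (Real.exp t - 1) := by nlinarith
  nlinarith [mul_le_mul_of_nonneg_left h7 hk.le]

/-- The factor 2 matters: the underloaded bins lose half of this by sinking, so the other half
remains as net decrease of `lowPot`. -/
theorem sum_lowGain_ge (h : MeanBiased k₁ k₂ c wp wm x p) (hn : 2 ≤ n) (hk₂ : 0 < k₂) :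
    2 * (16 / k₂ * wm) / n * ∑ i ∈ underloaded x, Real.exp (16 / k₂ * normLoad x i) ≤
      ∑ i, p i * lowGain (16 / k₂) wm x i := by
  have hn' : (0 : ℝ) < n := by positivity
  have hw := h.one_le_wm
  set ϑ := 16 / k₂ with hϑ
  have hϑ0 : 0 < ϑ := by positivity
  have h1 := two_mul_le_of_exponent (n := n) (t := ϑ * wm) hk₂ (by nlinarith) hn
  rw [← sum_over_add_sum_under]
  have h2 : 0 ≤ ∑ i ∈ overloaded x, p i * lowGain ϑ wm x i :=
    Finset.sum_nonneg fun i _ => mul_nonneg (h.nonneg i) (lowGain_nonneg hϑ0.le (by linarith) x i)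
  have h3 : 2 * (ϑ * wm) / n * ∑ i ∈ underloaded x, Real.exp (ϑ * normLoad x i) ≤
      ∑ i ∈ underloaded x, p i * lowGain ϑ wm x i := by
    rw [Finset.mul_sum]
    refine Finset.sum_le_sum fun i hi => ?_
    have h4 := h.under_ge i hi
    have h5 := lowGain_nonneg hϑ0.le (show (0 : ℝ) ≤ wm by linarith) x i
    have h6 : lowGain ϑ wm x i = Real.exp (ϑ * normLoad x i) *
        (Real.exp (-(ϑ * wm / n)) * (Real.exp (ϑ * wm) - 1)) := by
      rw [lowGain, if_pos (mem_underloaded.1 hi), ← mul_assoc, ← Real.exp_add]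
      congr 2; ring
    refine le_trans ?_ (mul_le_mul_of_nonneg_right h4 h5)
    rw [h6]
    have h7 := mul_le_mul_of_nonneg_left h1
      (show 0 ≤ Real.exp (ϑ * normLoad x i) / n by positivity)
    calc _ = Real.exp (ϑ * normLoad x i) / n * (2 * (ϑ * wm)) := by ring
      _ ≤ _ := h7
      _ = _ := by ring
  linarith

theorem sum_lowTerm_le {ϑ : ℝ} (hϑ : 0 ≤ ϑ) (x : Fin n → ℕ) :
    ∑ j, lowTerm ϑ wm x j ≤ ∑ i ∈ underloaded x, Real.exp (ϑ * normLoad x i) +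
      Real.exp (ϑ * wm) * ∑ i ∈ overloaded x, (if normLoad x i < 2 * wm then 1 else 0) := by
  rw [← sum_over_add_sum_under, add_comm, Finset.mul_sum]
  refine add_le_add (Finset.sum_le_sum fun i hi => ?_) (Finset.sum_le_sum fun i hi => ?_)
  · unfold lowTerm
    split_ifs
    · exact Real.exp_le_exp.2 (mul_le_mul_of_nonneg_left (min_le_left _ _) hϑ)
    · positivity
  · have := lowTerm_le (w := wm) hϑ x i
    unfold lowTerm at *
    split_ifs at * <;> linarith

end MeanBiased

/-! ### The potential of the load levels above the mean -/

/-- The fraction of bins with load `k`. -/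
noncomputable def levelFrac (x : Fin n → ℕ) (k : ℕ) : ℝ :=
  (∑ i, if x i = k then (1 : ℝ) else 0) / n

/-- The fraction of bins with load less than `τ`. -/
noncomputable def below (x : Fin n → ℕ) (τ : ℝ) : ℝ :=
  (∑ i, if (x i : ℝ) < τ then (1 : ℝ) else 0) / n

/-- The discounted mass of the load levels from `τ` on, each reduced by `3 * ε`. -/
noncomputable def levelPot (ε θ : ℝ) (x : Fin n → ℕ) (τ : ℝ) : ℝ :=
  ∑ k ∈ Finset.range (total x + 1),
    if τ ≤ k then max 0 (levelFrac x k - 3 * ε) * Real.exp (-θ * (k - τ)) else 0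

/-- The fraction of bins with load less than `τ`, clipped to `[ε, 1 - 2 * ε]`. -/
noncomputable def clipBelow (ε : ℝ) (x : Fin n → ℕ) (τ : ℝ) : ℝ :=
  max ε (min (below x τ) (1 - 2 * ε))

theorem levelFrac_nonneg (x : Fin n → ℕ) (k : ℕ) : 0 ≤ levelFrac x k :=
  div_nonneg (Finset.sum_nonneg fun _ _ => by split_ifs <;> norm_num) (by positivity)

theorem apply_le_total (x : Fin n → ℕ) (i : Fin n) : x i ≤ total x :=
  Finset.single_le_sum (f := x) (fun _ _ => Nat.zero_le _) (Finset.mem_univ i)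

theorem levelFrac_eq_zero {x : Fin n → ℕ} {k : ℕ} (hk : total x < k) : levelFrac x k = 0 := by
  rw [levelFrac, Finset.sum_eq_zero, zero_div]
  intro i _
  have := apply_le_total x i
  rw [if_neg (by omega)]

theorem levelPot_eq_sum_range {ε θ : ℝ} (hε : 0 ≤ ε) (x : Fin n → ℕ) (τ : ℝ) {R : ℕ}
    (hR : total x < R) :
    levelPot ε θ x τ = ∑ k ∈ Finset.range R,
      if τ ≤ k then max 0 (levelFrac x k - 3 * ε) * Real.exp (-θ * (k - τ)) else 0 := by
  refine Finset.sum_subset (Finset.range_subset_range.2 hR) fun k _ hk => ?_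
  rw [Finset.mem_range, not_lt] at hk
  rw [levelFrac_eq_zero (by omega), max_eq_left (by linarith)]
  simp

theorem sum_apply_load (x : Fin n → ℕ) (F : ℕ → ℝ) {R : ℕ} (hR : total x < R) :
    (∑ i, F (x i)) / n = ∑ k ∈ Finset.range R, levelFrac x k * F k := by
  have h1 : ∀ i, F (x i) = ∑ k ∈ Finset.range R, (if x i = k then (1 : ℝ) else 0) * F k := by
    intro i
    have := apply_le_total x i
    simp only [ite_mul, one_mul, zero_mul, Finset.sum_ite_eq, Finset.mem_range]
    rw [if_pos (by omega)]
  simp only [h1]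
  rw [Finset.sum_comm, Finset.sum_div]
  refine Finset.sum_congr rfl fun k _ => ?_
  rw [levelFrac, ← Finset.sum_mul]; ring

theorem sum_levelFrac (hn : 0 < n) (x : Fin n → ℕ) {R : ℕ} (hR : total x < R) :
    ∑ k ∈ Finset.range R, levelFrac x k = 1 := by
  have := sum_apply_load x (fun _ => 1) hR
  have hn' : (n : ℝ) ≠ 0 := by positivity
  simp only [mul_one, Finset.sum_const, Finset.card_univ, Fintype.card_fin, nsmul_eq_mul,
    div_self hn'] at this
  exact this.symm

theorem levelPot_nonneg (ε θ : ℝ) (x : Fin n → ℕ) (τ : ℝ) : 0 ≤ levelPot ε θ x τ :=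
  Finset.sum_nonneg fun k _ => by split_ifs <;> positivity

theorem levelPot_le_one (hn : 0 < n) {ε θ : ℝ} (hε : 0 ≤ ε) (hθ : 0 ≤ θ) (x : Fin n → ℕ) (τ : ℝ) :
    levelPot ε θ x τ ≤ 1 := by
  rw [← sum_levelFrac hn x (Nat.lt_succ_self (total x)), levelPot]
  refine Finset.sum_le_sum fun k _ => ?_
  have h0 := levelFrac_nonneg x k
  split_ifs with h
  · have h1 : Real.exp (-θ * (k - τ)) ≤ 1 := Real.exp_le_one_iff.2 (by nlinarith)
    have h2 : max 0 (levelFrac x k - 3 * ε) ≤ levelFrac x k := max_le h0 (by linarith)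
    nlinarith [le_max_left 0 (levelFrac x k - 3 * ε), Real.exp_pos (-θ * (k - τ))]
  · exact h0

/-- Integer levels are one apart and e^{-1} ≤ 1/2, so a geometric series dominates. Because the
bound is free of `R`, cutting every level by 3ε costs at most 6ε in total. -/
theorem sum_exp_level_le {θ τ : ℝ} (hθ : 1 ≤ θ) (R : ℕ) :
    ∑ k ∈ Finset.range R, (if τ ≤ k then Real.exp (-θ * (k - τ)) else 0) ≤ 2 := by
  set m := ⌈τ⌉₊
  have h1 : ∀ k ∈ Finset.range R, (if τ ≤ (k : ℝ) then Real.exp (-θ * (k - τ)) else 0) ≤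
      if m ≤ k then (1 / 2 : ℝ) ^ (k - m) else 0 := by
    intro k _
    have hiff : τ ≤ k ↔ m ≤ k := Nat.ceil_le.symm
    by_cases h : τ ≤ k
    · rw [if_pos h, if_pos (hiff.1 h)]
      have h2 : Real.exp (-1) ≤ 1 / 2 := by
        have := Real.exp_one_gt_d9
        rw [Real.exp_neg, inv_eq_one_div]
        exact one_div_le_one_div_of_le (by norm_num) (by linarith)
      rcases le_or_gt 0 τ with hτ | hτ
      · have h3 : τ ≤ m := Nat.le_ceil τ
        have h4 : -θ * (k - τ) ≤ ((k - m : ℕ) : ℝ) * (-1) := by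
          rw [Nat.cast_sub (hiff.1 h)]
          nlinarith
        calc _ ≤ Real.exp (((k - m : ℕ) : ℝ) * (-1)) := Real.exp_le_exp.2 h4
          _ = Real.exp (-1) ^ (k - m) := Real.exp_nat_mul _ _
          _ ≤ _ := by gcongr
      · have h3 : m = 0 := Nat.ceil_eq_zero.2 hτ.le
        rw [h3, Nat.sub_zero]
        calc _ ≤ Real.exp ((k : ℝ) * (-1)) := Real.exp_le_exp.2 (by
              have : (0 : ℝ) ≤ k := by positivity
              nlinarith)
          _ = Real.exp (-1) ^ k := Real.exp_nat_mul _ _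
          _ ≤ _ := by gcongr
    · rw [if_neg h, if_neg (fun h' => h (hiff.2 h'))]
  refine (Finset.sum_le_sum h1).trans ?_
  rw [← Finset.sum_filter]
  have h2 : (Finset.range R).filter (fun k => m ≤ k) = Finset.Ico m R := by
    ext k; simp [and_comm]
  rw [h2, Finset.sum_Ico_eq_sum_range]
  simp only [Nat.add_sub_cancel_left]
  exact sum_geometric_two_le _

/-- The discounted number of bins with load at least `τ` is controlled by `levelPot`. -/
theorem sum_exp_over_le {ε θ : ℝ} (hε : 0 ≤ ε) (hθ : 1 ≤ θ) (x : Fin n → ℕ) (τ : ℝ) :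
    (∑ i, if τ ≤ x i then Real.exp (-θ * (x i - τ)) else 0) / n ≤ levelPot ε θ x τ + 6 * ε := by
  have h1 := sum_apply_load x (fun k => if τ ≤ k then Real.exp (-θ * (k - τ)) else 0)
    (Nat.lt_succ_self (total x))
  rw [h1]
  have h2 : ∀ k ∈ Finset.range (total x + 1),
      levelFrac x k * (if τ ≤ (k : ℝ) then Real.exp (-θ * (k - τ)) else 0) ≤
      (if τ ≤ k then max 0 (levelFrac x k - 3 * ε) * Real.exp (-θ * (k - τ)) else 0) +
      3 * ε * (if τ ≤ (k : ℝ) then Real.exp (-θ * (k - τ)) else 0) := by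
    intro k _
    split_ifs
    · rw [← add_mul]
      gcongr
      linarith [le_max_right 0 (levelFrac x k - 3 * ε)]
    · simp
  refine (Finset.sum_le_sum h2).trans ?_
  rw [Finset.sum_add_distrib, ← Finset.mul_sum, ← levelPot]
  have h3 := mul_le_mul_of_nonneg_left (sum_exp_level_le (τ := τ) hθ (total x + 1))
    (show 0 ≤ 3 * ε by positivity)
  linarith

theorem below_le_one (hn : 0 < n) (x : Fin n → ℕ) (τ : ℝ) : below x τ ≤ 1 := by
  have hn' : (0 : ℝ) < n := by positivity
  rw [below, div_le_one hn']
  calc _ ≤ ∑ i : Fin n, (1 : ℝ) := Finset.sum_le_sum fun i _ => by split_ifs <;> norm_num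
    _ = n := by simp

theorem below_nonneg (x : Fin n → ℕ) (τ : ℝ) : 0 ≤ below x τ :=
  div_nonneg (Finset.sum_nonneg fun _ _ => by split_ifs <;> norm_num) (by positivity)

/-- Cutting each level separately removes at least as much as one cut of the total. Hence all levels
passed in one round can be paid for by a single loss of 3ε. -/
theorem sum_max_sub_le {ι : Type*} (s : Finset ι) (a : ι → ℝ) (ha : ∀ k, 0 ≤ a k) {e : ℝ}
    (he : 0 ≤ e) : ∑ k ∈ s, max 0 (a k - e) ≤ max 0 (∑ k ∈ s, a k - e) := by
  classical
  induction s using Finset.induction_on with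
  | empty => simp
  | insert k s hk ih =>
    rw [Finset.sum_insert hk, Finset.sum_insert hk]
    have h1 := ha k
    have h2 : 0 ≤ ∑ k ∈ s, a k := Finset.sum_nonneg fun k _ => ha k
    rcases max_cases 0 (a k - e) with h3 | h3 <;> rcases max_cases 0 (∑ k ∈ s, a k - e) with h4 | h4 <;>
    rcases max_cases 0 (a k + ∑ k ∈ s, a k - e) with h5 | h5 <;> linarith

/-- Clipping hides at most ε at the bottom and 2ε at the top of an increment; this is why `levelPot`
cuts by 3ε. -/
theorem clip_sub_clip_ge {ε a b : ℝ} (hε : 0 ≤ ε) (ha : 0 ≤ a) (hab : a ≤ b)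
    (hb : b ≤ 1) :
    max 0 (b - a - 3 * ε) ≤ max ε (min b (1 - 2 * ε)) - max ε (min a (1 - 2 * ε)) := by
  rcases max_cases 0 (b - a - 3 * ε) with h1 | h1 <;>
  rcases min_cases b (1 - 2 * ε) with h2 | h2 <;>
  rcases min_cases a (1 - 2 * ε) with h3 | h3 <;>
  rcases max_cases ε (min b (1 - 2 * ε)) with h4 | h4 <;>
  rcases max_cases ε (min a (1 - 2 * ε)) with h5 | h5 <;> linarith

/-- The level potential together with the clipped fraction of bins below the threshold. -/
noncomputable def thresholdPot (ε θ K : ℝ) (x : Fin n → ℕ) (τ : ℝ) : ℝ :=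
  K * clipBelow ε x τ + levelPot ε θ x τ

/-- Raising the threshold increases `thresholdPot`. -/
theorem thresholdPot_shift (hn : 0 < n) {ε θ K w τ τ' : ℝ} (hε : 0 ≤ ε)
    (hθ : 0 ≤ θ) (hτ : τ ≤ τ') (hτw : τ' ≤ τ + w) (hK : 1 + θ * w ≤ K) (x : Fin n → ℕ) :
    thresholdPot ε θ K x τ + θ * (τ' - τ) * levelPot ε θ x τ ≤ thresholdPot ε θ K x τ' := by
  have hw : 0 ≤ w := by linarith
  have hR := Nat.lt_succ_self (total x)
  set s := (Finset.range (total x + 1)).filter (fun k : ℕ => τ ≤ k ∧ (k : ℝ) < τ') with hs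
  have h1 : below x τ' - below x τ = ∑ k ∈ s, levelFrac x k := by
    have h2 := sum_apply_load x (fun k => if τ ≤ k ∧ (k : ℝ) < τ' then 1 else 0) hR
    rw [hs, Finset.sum_filter]
    simp only [mul_ite, mul_one, mul_zero] at h2
    rw [← h2, below, below, ← sub_div, ← Finset.sum_sub_distrib]
    congr 1
    refine Finset.sum_congr rfl fun i _ => ?_
    by_cases h3 : (x i : ℝ) < τ
    · simp [h3, h3.trans_le hτ, not_le.2 h3]
    · simp [h3, not_lt.1 h3]
  have h2 := sum_max_sub_le s (levelFrac x) (levelFrac_nonneg x) (show 0 ≤ 3 * ε by positivity)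
  have h3 : below x τ ≤ below x τ' := by
    have : 0 ≤ ∑ k ∈ s, levelFrac x k := Finset.sum_nonneg fun k _ => levelFrac_nonneg x k
    linarith
  have h4 := clip_sub_clip_ge hε (below_nonneg x τ) h3 (below_le_one hn x τ')
  rw [← h1] at h2
  have h5 : ∑ k ∈ s, max 0 (levelFrac x k - 3 * ε) ≤ clipBelow ε x τ' - clipBelow ε x τ :=
    h2.trans h4
  -- Level by level: one that stays above the threshold is multiplied by exp(θ(τ'-τ)) ≥ 1 + θ(τ'-τ),
  -- while one that is passed is lost with coefficient at most 1 + θw ≤ K and repaid through `h5`.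
  have h6 : levelPot ε θ x τ + θ * (τ' - τ) * levelPot ε θ x τ ≤
      K * ∑ k ∈ s, max 0 (levelFrac x k - 3 * ε) + levelPot ε θ x τ' := by
    rw [hs, Finset.sum_filter, levelPot, levelPot, Finset.mul_sum, Finset.mul_sum,
      ← Finset.sum_add_distrib, ← Finset.sum_add_distrib]
    refine Finset.sum_le_sum fun k _ => ?_
    have hg : 0 ≤ max 0 (levelFrac x k - 3 * ε) := le_max_left _ _
    set g := max 0 (levelFrac x k - 3 * ε)
    by_cases h7 : τ ≤ k
    · by_cases h8 : (k : ℝ) < τ'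
      · rw [if_pos h7, if_pos ⟨h7, h8⟩, if_neg (not_le.2 h8)]
        have h9 : Real.exp (-θ * (k - τ)) ≤ 1 := Real.exp_le_one_iff.2 (by nlinarith)
        have h10 : θ * (τ' - τ) ≤ θ * w := mul_le_mul_of_nonneg_left (by linarith) hθ
        have h11 : 0 ≤ θ * (τ' - τ) := mul_nonneg hθ (by linarith)
        have h12 : (1 + θ * (τ' - τ)) * Real.exp (-θ * (k - τ)) ≤ K := by
          nlinarith [Real.exp_pos (-θ * (k - τ))]
        nlinarith [mul_le_mul_of_nonneg_left h12 hg]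
      · push Not at h8
        rw [if_pos h7, if_neg (fun h => not_lt.2 h8 h.2), if_pos h8]
        have h9 : Real.exp (-θ * (k - τ')) =
            Real.exp (θ * (τ' - τ)) * Real.exp (-θ * (k - τ)) := by
          rw [← Real.exp_add]; congr 1; ring
        have h10 := Real.add_one_le_exp (θ * (τ' - τ))
        rw [h9]
        have h11 : 0 ≤ g * Real.exp (-θ * (k - τ)) := by positivity
        nlinarith
    · rw [if_neg h7, if_neg (fun h => h7 h.1), if_neg (fun h => h7 (hτ.trans h))]
      simp
  have h7 := mul_le_mul_of_nonneg_left h5 (show 0 ≤ K by nlinarith)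
  rw [thresholdPot, thresholdPot]
  linarith

theorem levelFrac_place_ge (x : Fin n → ℕ) (i : Fin n) (w k : ℕ) :
    levelFrac x k - (if x i = k then 1 else 0) / n ≤ levelFrac (place x i w) k := by
  rw [levelFrac, levelFrac, ← sub_div]
  gcongr
  have h : ∑ j : Fin n, (if j = i then (if x i = k then (1 : ℝ) else 0) else 0) =
      if x i = k then 1 else 0 := by simp
  rw [← h, ← Finset.sum_sub_distrib]
  refine Finset.sum_le_sum fun j _ => ?_
  by_cases hj : j = i
  · subst hj
    simp only [if_true, sub_self]
    split_ifs <;> norm_num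
  · simp [place, hj]

/-- Only the level left by the chosen bin can lose mass, and the cut is monotone and 1-Lipschitz in
the level fraction. -/
theorem levelPot_place_ge {ε θ : ℝ} (hε : 0 ≤ ε) (x : Fin n → ℕ) (i : Fin n)
    (w : ℕ) (τ : ℝ) :
    levelPot ε θ x τ - (if τ ≤ x i then Real.exp (-θ * (x i - τ)) else 0) / n ≤
      levelPot ε θ (place x i w) τ := by
  have hR1 : total x < total x + w + 1 := by omega
  have hR2 : total (place x i w) < total x + w + 1 := by rw [total_place]; omega
  rw [levelPot_eq_sum_range hε x τ hR1, levelPot_eq_sum_range hε _ τ hR2]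
  have h : ∑ k ∈ Finset.range (total x + w + 1),
      (if x i = k then (if τ ≤ k then Real.exp (-θ * (k - τ)) else 0) / (n : ℝ) else 0) =
      (if τ ≤ x i then Real.exp (-θ * (x i - τ)) else 0) / n := by
    have := apply_le_total x i
    rw [Finset.sum_ite_eq, if_pos (Finset.mem_range.2 (by omega))]
  rw [← h, ← Finset.sum_sub_distrib]
  refine Finset.sum_le_sum fun k _ => ?_
  have h1 := levelFrac_place_ge x i w k
  by_cases hk : τ ≤ k
  · simp only [if_pos hk]
    have h2 : max 0 (levelFrac x k - 3 * ε) - (if x i = k then 1 else 0) / n ≤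
        max 0 (levelFrac (place x i w) k - 3 * ε) := by
      have h3 : (0 : ℝ) ≤ (if x i = k then 1 else 0) / n := by
        split_ifs <;> positivity
      rw [sub_le_iff_le_add]
      apply max_le
      · linarith [le_max_left 0 (levelFrac (place x i w) k - 3 * ε)]
      · linarith [le_max_right 0 (levelFrac (place x i w) k - 3 * ε)]
    have h3 := mul_le_mul_of_nonneg_right h2 (Real.exp_pos (-θ * (k - τ))).le
    refine le_trans (le_of_eq ?_) h3
    split_ifs <;> ring
  · simp [if_neg hk]

theorem below_place_ge (x : Fin n → ℕ) (i : Fin n) (w : ℕ) (τ : ℝ) :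
    below x τ - 1 / n ≤ below (place x i w) τ := by
  rw [below, below, ← sub_div]
  gcongr
  have h : ∑ j : Fin n, (if j = i then (1 : ℝ) else 0) = 1 := by simp
  rw [← h, ← Finset.sum_sub_distrib]
  refine Finset.sum_le_sum fun j _ => ?_
  by_cases hj : j = i
  · subst hj; simp only [if_true]; split_ifs <;> norm_num
  · simp [place, hj]

/-- The fraction below a fixed level drops by at most 1/n. The clip conceals this drop below ε, and
also at the top once there is a margin of 1/n. -/
theorem clipBelow_place_ge (x : Fin n → ℕ) (i : Fin n) (w : ℕ) (τ ε : ℝ) :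
    clipBelow ε x τ - (if below x τ ≤ ε ∨ 1 - 2 * ε + 1 / n ≤ below x τ then 0 else 1) / n ≤
      clipBelow ε (place x i w) τ := by
  have h1 := below_place_ge x i w τ
  have h2 : 0 ≤ 1 / (n : ℝ) := by positivity
  unfold clipBelow
  split_ifs with h
  · rw [zero_div, sub_zero]
    rcases h with h | h
    · rw [max_eq_left ((min_le_left _ _).trans h)]
      exact le_max_left _ _
    · apply max_le (le_max_left _ _)
      refine le_max_of_le_right ?_
      exact le_min ((min_le_right _ _).trans (by linarith)) (min_le_right _ _)
  · rw [sub_le_iff_le_add]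
    apply max_le
    · linarith [le_max_left ε (min (below (place x i w) τ) (1 - 2 * ε))]
    · have h3 := le_max_right ε (min (below (place x i w) τ) (1 - 2 * ε))
      have h4 : min (below x τ) (1 - 2 * ε) - 1 / n ≤ min (below (place x i w) τ) (1 - 2 * ε) :=
        le_min (by linarith [min_le_left (below x τ) (1 - 2 * ε)])
          (by linarith [min_le_right (below x τ) (1 - 2 * ε)])
      linarith

theorem below_mean (hn : 0 < n) (x : Fin n → ℕ) : below x (mean x) = 1 - meanQuantile x := by
  have hn' : (n : ℝ) ≠ 0 := by positivity
  have h1 := card_underloaded_eq hn x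
  have h2 : ((underloaded x).card : ℝ) = ∑ i, if (x i : ℝ) < mean x then (1 : ℝ) else 0 := by
    rw [underloaded, Finset.card_filter]
    push_cast
    simp only [normLoad_eq, sub_neg]
  rw [below, ← h2, h1]
  field_simp

theorem one_div_le_meanQuantile (hn : 0 < n) (x : Fin n → ℕ) : 1 / n ≤ meanQuantile x := by
  have : (overloaded x).Nonempty := by
    rw [Finset.nonempty_iff_ne_empty]
    intro h0
    have h1 := (sum_over_normLoad hn x).1
    have h2 := (sum_over_normLoad hn x).2
    rw [h0, Finset.sum_empty] at h1
    have h3 : underloaded x = Finset.univ := by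
      ext i
      have : i ∉ overloaded x := by rw [h0]; simp
      rw [mem_overloaded] at this
      simp [mem_underloaded, not_le.1 this]
    rw [h3, ← h1] at h2
    have h4 : 0 < ∑ i, -normLoad x i :=
      Finset.sum_pos (fun i _ => by
        have := mem_underloaded.1 (h3 ▸ Finset.mem_univ i : i ∈ underloaded x)
        linarith) ⟨⟨0, hn⟩, Finset.mem_univ _⟩
    linarith
  have h1 : (1 : ℝ) ≤ (overloaded x).card := by exact_mod_cast this.card_pos
  unfold meanQuantile
  gcongr

/-- The indicator that the fraction of overloaded bins is not within `ε` of `0` or `1`. -/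
noncomputable def midInd (ε : ℝ) (x : Fin n → ℕ) : ℝ :=
  if meanQuantile x ≤ ε ∨ 1 - ε ≤ meanQuantile x then 0 else 1

theorem midInd_nonneg (ε : ℝ) (x : Fin n → ℕ) : 0 ≤ midInd ε x := by
  unfold midInd; split_ifs <;> norm_num

theorem midInd_le_one (ε : ℝ) (x : Fin n → ℕ) : midInd ε x ≤ 1 := by
  unfold midInd; split_ifs <;> norm_num

/-- The increase of `thresholdPot` in one round. -/
theorem thresholdPot_place_ge (hn : 0 < n) {ε θ K w : ℝ} (hε : 0 ≤ ε) (hθ : 0 ≤ θ)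
    (hK : 1 + θ * w ≤ K) (x : Fin n → ℕ) (i : Fin n) {u : ℕ} (hu : 1 ≤ u) (huw : (u : ℝ) ≤ w) :
    thresholdPot ε θ K x (mean x) + (θ * levelPot ε θ x (mean x)
      - (if 0 ≤ normLoad x i then Real.exp (-θ * normLoad x i) + θ * w / n else 0)
      - K * midInd ε x) / n ≤
    thresholdPot ε θ K (place x i u) (mean (place x i u)) := by
  have hn' : (1 : ℝ) ≤ n := by exact_mod_cast hn
  have hu' : (1 : ℝ) ≤ u := by exact_mod_cast hu
  have hun : (u : ℝ) / n ≤ w := (div_le_self (by positivity) hn').trans huw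
  have hun0 : 0 ≤ (u : ℝ) / n := by positivity
  have hw0 : 0 ≤ w := by linarith
  have hK0 : 0 ≤ K := by nlinarith
  -- The allocation is performed at the old threshold first; then the threshold is raised to the new
  -- mean, by at least 1/n since u ≥ 1.
  have h1 := thresholdPot_shift hn hε hθ (τ := mean x) (τ' := mean x + u / n) (w := w)
    (by linarith) (by linarith) hK (place x i u)
  rw [mean_place]
  refine le_trans ?_ h1
  have h2 := levelPot_place_ge (θ := θ) hε x i u (mean x)
  have h3 := clipBelow_place_ge x i u (mean x) ε
  have h4 : (if below x (mean x) ≤ ε ∨ 1 - 2 * ε + 1 / n ≤ below x (mean x) then (0 : ℝ) else 1) ≤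
      midInd ε x := by
    rw [midInd, below_mean hn]
    have := one_div_le_meanQuantile hn x
    split_ifs with h5 h6 h6
    · exact le_rfl
    · norm_num
    -- The upper clip at 1-2ε, not 1-ε, is needed here: δ ≤ ε forces 1/n ≤ δ ≤ ε, so 1-δ still
    -- clears 1-2ε by 1/n.
    · exfalso
      apply h5
      rcases h6 with h6 | h6
      · right; linarith
      · left; linarith
    · exact le_rfl
  have h5 : clipBelow ε x (mean x) - midInd ε x / n ≤ clipBelow ε (place x i u) (mean x) := by
    refine le_trans ?_ h3
    gcongr
  have h6 : (if mean x ≤ x i then Real.exp (-θ * (x i - mean x)) else 0) =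
      if 0 ≤ normLoad x i then Real.exp (-θ * normLoad x i) else 0 := by
    simp only [normLoad_eq, sub_nonneg]
  rw [h6] at h2
  have hL := levelPot_nonneg ε θ x (mean x)
  set L := levelPot ε θ x (mean x)
  set L' := levelPot ε θ (place x i u) (mean x)
  have h7 := mul_le_mul_of_nonneg_left h5 hK0
  have h9 : θ * (1 / n) * L ≤ θ * (u / n) * L := by gcongr
  have h8 : L + (θ * L - (if 0 ≤ normLoad x i then Real.exp (-θ * normLoad x i) + θ * w / n else 0))
      / n ≤ L' + θ * (u / n) * L' := by
    have h10 : 0 ≤ 1 + θ * (u / n) := by positivity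
    have h11 := mul_le_mul_of_nonneg_left h2 h10
    split_ifs at h11 ⊢ with h12
    · have h13 : Real.exp (-θ * normLoad x i) ≤ 1 := Real.exp_le_one_iff.2 (by nlinarith)
      have h14 : θ * (u / n) * (Real.exp (-θ * normLoad x i) / n) ≤ θ * (w / n) * (1 / n) := by
        gcongr
      have h15 : (θ * L - (Real.exp (-θ * normLoad x i) + θ * w / n)) / n =
        θ * (1 / n) * L - Real.exp (-θ * normLoad x i) / n - θ * (w / n) * (1 / n) := by ring
      rw [h15]
      linarith
    · have h15 : (θ * L - 0) / n = θ * (1 / n) * L := by ring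
      rw [h15]
      rw [zero_div, sub_zero] at h11
      linarith
  have h16 : mean x + (u : ℝ) / n - mean x = u / n := by ring
  rw [thresholdPot, thresholdPot, h16, sub_div _ (K * midInd ε x)]
  have h17 : K * (midInd ε x / n) = K * midInd ε x / n := by ring
  linarith

theorem abs_thresholdPot_le (hn : 0 < n) {ε θ K : ℝ} (hε : 0 ≤ ε) (hε' : ε ≤ 1) (hθ : 0 ≤ θ)
    (hK : 0 ≤ K) (x : Fin n → ℕ) (τ : ℝ) : |thresholdPot ε θ K x τ| ≤ K + 1 := by
  have h1 := levelPot_nonneg ε θ x τ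
  have h2 := levelPot_le_one hn hε hθ x τ
  have h3 : 0 ≤ clipBelow ε x τ := le_max_of_le_left hε
  have h4 : clipBelow ε x τ ≤ 1 := max_le hε' ((min_le_left _ _).trans (below_le_one hn x τ))
  rw [thresholdPot, abs_of_nonneg (by positivity)]
  nlinarith

/-! ### The bounded side potential -/

/-- A bounded potential that decreases in expectation whenever nearly all bins are on the same
side of the mean and the loads are typically close to the mean. -/
noncomputable def sidePot (ε ϑ θ w K B : ℝ) (x : Fin n → ℕ) : ℝ :=
  lowPot ϑ w x - (B + 1) * thresholdPot ε θ K x (mean x)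

/-- Jensen's inequality for the average of exp(-M|y|), via the tangent line at the average
deviation. -/
theorem exp_neg_absPot_le (hn : 0 < n) {θ ϑ M : ℝ} (hθ : θ ≤ M) (hϑ : ϑ ≤ M) (x : Fin n → ℕ) :
    Real.exp (-(M * absPot x / n)) ≤ (∑ i ∈ overloaded x, Real.exp (-θ * normLoad x i)) / n +
      (∑ i ∈ underloaded x, Real.exp (ϑ * normLoad x i)) / n := by
  have hn' : (0 : ℝ) < n := by positivity
  set a := M * absPot x / n with ha
  have h1 : ∑ i, Real.exp (-(M * |normLoad x i|)) ≤
      ∑ i ∈ overloaded x, Real.exp (-θ * normLoad x i) +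
      ∑ i ∈ underloaded x, Real.exp (ϑ * normLoad x i) := by
    rw [← sum_over_add_sum_under]
    refine add_le_add (Finset.sum_le_sum fun i hi => ?_) (Finset.sum_le_sum fun i hi => ?_)
    · have := mem_overloaded.1 hi
      rw [abs_of_nonneg this]
      exact Real.exp_le_exp.2 (by nlinarith)
    · have := mem_underloaded.1 hi
      rw [abs_of_neg this]
      exact Real.exp_le_exp.2 (by nlinarith)
  have h2 : ∀ i, Real.exp (-a) * (1 + a - M * |normLoad x i|) ≤
      Real.exp (-(M * |normLoad x i|)) := by
    intro i
    have h3 := Real.add_one_le_exp (a - M * |normLoad x i|)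
    have h4 : Real.exp (-(M * |normLoad x i|)) =
        Real.exp (-a) * Real.exp (a - M * |normLoad x i|) := by
      rw [← Real.exp_add]; congr 1; ring
    rw [h4]
    exact mul_le_mul_of_nonneg_left (by linarith) (Real.exp_pos _).le
  have h3 : ∑ i, Real.exp (-a) * (1 + a - M * |normLoad x i|) = n * Real.exp (-a) := by
    rw [← Finset.mul_sum, Finset.sum_sub_distrib, ← Finset.mul_sum, ← absPot]
    simp only [Finset.sum_const, Finset.card_univ, Fintype.card_fin, nsmul_eq_mul]
    have : (n : ℝ) * (1 + a) - M * absPot x = n := by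
      rw [ha]; field_simp; ring
    rw [this]; ring
  rw [← add_div, le_div_iff₀ hn']
  have h4 := Finset.sum_le_sum fun i (_ : i ∈ Finset.univ) => h2 i
  rw [h3] at h4
  linarith

namespace MeanBiased

variable {k₁ k₂ c : ℝ} {wp wm : ℕ} {x : Fin n → ℕ} {p : Fin n → ℝ}

theorem sum_over_exp_le {ε θ : ℝ} (hε : 0 ≤ ε) (hθ : 1 ≤ θ) (x : Fin n → ℕ) :
    (∑ i ∈ overloaded x, Real.exp (-θ * normLoad x i)) / n ≤ levelPot ε θ x (mean x) + 6 * ε := by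
  have h1 := sum_exp_over_le hε hθ x (mean x)
  refine le_trans (le_of_eq ?_) h1
  rw [overloaded, Finset.sum_filter]
  simp only [normLoad_eq, sub_nonneg]

/-- An upper bound for `n` times the increase of `sidePot` when bin `i` is chosen. -/
noncomputable def sideIncr (ε ϑ θ w K B : ℝ) (x : Fin n → ℕ) (i : Fin n) : ℝ :=
  w * ϑ / n * ∑ j, lowTerm ϑ w x j - lowGain ϑ w x i
    - (B + 1) * (θ * levelPot ε θ x (mean x)
      - (if 0 ≤ normLoad x i then Real.exp (-θ * normLoad x i) + θ * w / n else 0)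
      - K * midInd ε x)

theorem sidePot_place_le (h : MeanBiased k₁ k₂ c wp wm x p) (hn : 0 < n) {ε ϑ θ K B : ℝ}
    (hε : 0 ≤ ε) (hϑ : 0 ≤ ϑ) (hθ : 0 ≤ θ) (hK : 1 + θ * wm ≤ K) (hB : 0 ≤ B) (i : Fin n) :
    sidePot ε ϑ θ wm K B (place x i (weight wp wm x i)) - sidePot ε ϑ θ wm K B x ≤
      sideIncr ε ϑ θ wm K B x i / n := by
  have h1 := lowPot_place_le hn hϑ h.wp_le_wm x i
  have h2 := thresholdPot_place_ge hn hε hθ hK x i (u := weight wp wm x i)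
    (by exact_mod_cast h.one_le_weight i) (h.weight_le i)
  have h3 := mul_le_mul_of_nonneg_left h2 (show 0 ≤ B + 1 by linarith)
  rw [sidePot, sidePot, sideIncr, sub_div _ _ (n : ℝ)]
  rw [mul_add] at h3
  rw [mul_div_assoc (B + 1)]
  linarith

theorem abs_sideIncr_le (h : MeanBiased k₁ k₂ c wp wm x p) (hn : 0 < n) {ε ϑ θ K B : ℝ}
    (hε : 0 ≤ ε) (hϑ : 0 ≤ ϑ) (hθ : 0 ≤ θ) (hK : 0 ≤ K) (hB : 0 ≤ B) (i : Fin n) :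
    |sideIncr ε ϑ θ wm K B x i| ≤ wm * ϑ * Real.exp (ϑ * wm) + Real.exp (ϑ * wm)
      + (B + 1) * (θ + (1 + θ * wm) + K) := by
  have hn' : (1 : ℝ) ≤ n := by exact_mod_cast hn
  have hw := h.one_le_wm
  have a1 : wm * ϑ / n * ∑ j, lowTerm ϑ wm x j ≤ wm * ϑ * Real.exp (ϑ * wm) := by
    have : ∑ j, lowTerm ϑ wm x j ≤ ∑ j : Fin n, Real.exp (ϑ * wm) :=
      Finset.sum_le_sum fun j _ => lowTerm_le hϑ x j
    simp only [Finset.sum_const, Finset.card_univ, Fintype.card_fin, nsmul_eq_mul] at this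
    calc _ ≤ wm * ϑ / n * (n * Real.exp (ϑ * wm)) := by gcongr
      _ = _ := by field_simp
  have a2 : 0 ≤ wm * ϑ / n * ∑ j, lowTerm ϑ wm x j := by
    have : 0 ≤ ∑ j, lowTerm ϑ wm x j := Finset.sum_nonneg fun j _ => lowTerm_nonneg _ _ _ _
    positivity
  have b1 := lowGain_le (w := wm) hϑ (by positivity) x i
  have b2 := lowGain_nonneg (w := wm) hϑ (by positivity) x i
  have l1 := mul_le_mul_of_nonneg_left (levelPot_le_one hn hε hθ x (mean x)) hθ
  have l2 := mul_nonneg hθ (levelPot_nonneg ε θ x (mean x))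
  have m1 := mul_le_mul_of_nonneg_left (midInd_le_one ε x) hK
  have m2 := mul_nonneg hK (midInd_nonneg ε x)
  have o : 0 ≤ (if 0 ≤ normLoad x i then Real.exp (-θ * normLoad x i) + θ * wm / n else 0) ∧
      (if 0 ≤ normLoad x i then Real.exp (-θ * normLoad x i) + θ * wm / n else 0) ≤
        1 + θ * wm := by
    split_ifs with h0
    · have h1 : Real.exp (-θ * normLoad x i) ≤ 1 := Real.exp_le_one_iff.2 (by nlinarith)
      have h2 : θ * wm / n ≤ θ * wm := div_le_self (by positivity) hn'
      exact ⟨by positivity, by linarith⟩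
    · exact ⟨le_rfl, by positivity⟩
  set o' := (if 0 ≤ normLoad x i then Real.exp (-θ * normLoad x i) + θ * wm / n else 0)
  have t : |θ * levelPot ε θ x (mean x) - o' - K * midInd ε x| ≤ θ + (1 + θ * wm) + K := by
    rw [abs_le]; constructor <;> linarith [o.1, o.2]
  have t2 : |(B + 1) * (θ * levelPot ε θ x (mean x) - o' - K * midInd ε x)| ≤
      (B + 1) * (θ + (1 + θ * wm) + K) := by
    rw [abs_mul, abs_of_nonneg (show 0 ≤ B + 1 by linarith)]
    exact mul_le_mul_of_nonneg_left t (by linarith)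
  have t3 := abs_le.1 t2
  rw [sideIncr, abs_le]
  have e := Real.exp_pos (ϑ * wm)
  constructor <;> linarith [t3.1, t3.2]

theorem sum_sideIncr_le (h : MeanBiased k₁ k₂ c wp wm x p) (hn : 2 ≤ n) (hk₁ : 1 ≤ k₁)
    (hk₂ : 0 < k₂) (hk₂' : k₂ ≤ 1) {ε ϑ θ K B M : ℝ} (hε : 0 ≤ ε) (hϑ : ϑ = 16 / k₂)
    (hθ : θ = 2 * k₁) (hB : B = wm * ϑ * Real.exp (ϑ * wm) * Real.exp (2 * θ * wm))
    (hM1 : θ ≤ M) (hM2 : ϑ ≤ M) :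
    ∑ i, p i * sideIncr ε ϑ θ wm K B x i ≤
      -Real.exp (-(M * absPot x / n)) + 6 * ε * (B + (B + 1) * k₁ + 1) + (B + 1) * θ * wm / n
        + (B + 1) * K * midInd ε x := by
  have hn0 : 0 < n := by omega
  have hn' : (0 : ℝ) < n := by positivity
  have hw := h.one_le_wm
  have hϑ1 : 1 ≤ ϑ := by rw [hϑ, le_div_iff₀ hk₂]; linarith
  have hθ1 : 1 ≤ θ := by linarith
  have hB0 : 0 ≤ B := by rw [hB]; positivity
  set L := levelPot ε θ x (mean x) with hL
  have hL0 : 0 ≤ L := levelPot_nonneg _ _ _ _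
  set Us := (∑ i ∈ underloaded x, Real.exp (ϑ * normLoad x i)) / n with hUs
  set Os := (∑ i ∈ overloaded x, Real.exp (-θ * normLoad x i)) / n with hOs
  have hUs0 : 0 ≤ Us := div_nonneg (Finset.sum_nonneg fun _ _ => (Real.exp_pos _).le) hn'.le
  have hOL : Os ≤ L + 6 * ε := sum_over_exp_le hε hθ1 x
  have hJ : Real.exp (-(M * absPot x / n)) ≤ Os + Us := exp_neg_absPot_le hn0 hM1 hM2 x
  have g1 : 2 * (ϑ * wm) * Us ≤ ∑ i, p i * lowGain ϑ wm x i := by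
    have := h.sum_lowGain_ge hn hk₂
    rw [← hϑ] at this
    refine le_trans (le_of_eq ?_) this
    rw [hUs]; ring
  -- An overloaded bin below 2w has discount at least exp(-2θw), so the discounted sum controls the
  -- number of such bins; `B` collects the resulting factors.
  have g2 : wm * ϑ / n * ∑ j, lowTerm ϑ wm x j ≤ wm * ϑ * Us + B * (L + 6 * ε) := by
    have h1 := sum_lowTerm_le (wm := wm) (show 0 ≤ ϑ by linarith) x
    have h2 : ∑ i ∈ overloaded x, (if normLoad x i < 2 * wm then (1 : ℝ) else 0) ≤
        Real.exp (2 * θ * wm) * ∑ i ∈ overloaded x, Real.exp (-θ * normLoad x i) := by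
      rw [Finset.mul_sum]
      refine Finset.sum_le_sum fun i hi => ?_
      split_ifs with h3
      · rw [← Real.exp_add]
        apply Real.one_le_exp
        nlinarith
      · positivity
    have h3 : ∑ j, lowTerm ϑ wm x j ≤ n * Us + Real.exp (ϑ * wm) * (Real.exp (2 * θ * wm) * (n * Os)) := by
      have e1 : n * Us = ∑ i ∈ underloaded x, Real.exp (ϑ * normLoad x i) := by
        rw [hUs]; field_simp
      have e2 : n * Os = ∑ i ∈ overloaded x, Real.exp (-θ * normLoad x i) := by
        rw [hOs]; field_simp
      rw [e1, e2]
      refine h1.trans (add_le_add le_rfl ?_)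
      gcongr
    calc wm * ϑ / n * ∑ j, lowTerm ϑ wm x j
        ≤ wm * ϑ / n * (n * Us + Real.exp (ϑ * wm) * (Real.exp (2 * θ * wm) * (n * Os))) := by
          gcongr
      _ = wm * ϑ * Us + B * Os := by rw [hB]; field_simp
      _ ≤ _ := by gcongr
  have g3 : ∑ i, p i * (if 0 ≤ normLoad x i then
      Real.exp (-θ * normLoad x i) + θ * wm / n else 0) ≤ k₁ * (L + 6 * ε) + θ * wm / n := by
    have e1 : ∑ i, p i * (if 0 ≤ normLoad x i then
      Real.exp (-θ * normLoad x i) + θ * wm / n else 0) =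
      ∑ i ∈ overloaded x, (p i * Real.exp (-θ * normLoad x i) + p i * (θ * wm / n)) := by
      rw [overloaded, Finset.sum_filter]
      refine Finset.sum_congr rfl fun i _ => ?_
      split_ifs
      · ring
      · ring
    rw [e1, Finset.sum_add_distrib, ← Finset.sum_mul]
    have e2 : ∑ i ∈ overloaded x, p i * Real.exp (-θ * normLoad x i) ≤ k₁ * Os := by
      rw [hOs, Finset.sum_div, Finset.mul_sum]
      refine Finset.sum_le_sum fun i hi => ?_
      have := mul_le_mul_of_nonneg_right (h.over_le i hi) (Real.exp_pos (-θ * normLoad x i)).le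
      refine this.trans (le_of_eq (by ring))
    have e3 := mul_le_mul_of_nonneg_right h.sum_over_le_one
      (show 0 ≤ θ * wm / n by positivity)
    have e4 := mul_le_mul_of_nonneg_left hOL (show 0 ≤ k₁ by linarith)
    linarith
  have e : ∑ i, p i * sideIncr ε ϑ θ wm K B x i =
      wm * ϑ / n * ∑ j, lowTerm ϑ wm x j - ∑ i, p i * lowGain ϑ wm x i
      - (B + 1) * θ * L + (B + 1) * ∑ i, p i * (if 0 ≤ normLoad x i then
      Real.exp (-θ * normLoad x i) + θ * wm / n else 0) + (B + 1) * K * midInd ε x := by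
    have e1 : ∀ i, p i * sideIncr ε ϑ θ wm K B x i =
        (wm * ϑ / n * ∑ j, lowTerm ϑ wm x j - (B + 1) * θ * L + (B + 1) * K * midInd ε x) * p i
        - p i * lowGain ϑ wm x i + (B + 1) * (p i * (if 0 ≤ normLoad x i then
      Real.exp (-θ * normLoad x i) + θ * wm / n else 0)) := by
      intro i; rw [sideIncr]; ring
    rw [Finset.sum_congr rfl fun i _ => e1 i, Finset.sum_add_distrib, Finset.sum_sub_distrib,
      ← Finset.mul_sum, ← Finset.mul_sum, h.sum_eq_one]
    ring
  rw [e]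
  have g4 := mul_le_mul_of_nonneg_left g3 (show 0 ≤ B + 1 by linarith)
  -- After all losses one copy of `Us` and one of `L` remain: θ = 2k₁ pays twice for departures from
  -- levels, and the weight B+1 also covers the term B · L of `g2`.
  have g5 : Us ≤ ϑ * wm * Us := by
    have : 1 ≤ ϑ * wm := by nlinarith
    nlinarith
  have g6 : L ≤ ((B + 1) * k₁ - B) * L := by
    have : 1 ≤ (B + 1) * k₁ - B := by nlinarith
    nlinarith
  have g7 : (B + 1) * θ * L = 2 * ((B + 1) * k₁ * L) := by rw [hθ]; ring
  have g8 : (B + 1) * (θ * wm / n) = (B + 1) * θ * wm / n := by ring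
  rw [g7]
  rw [mul_add, g8] at g4
  linarith

/-- Increments of `sidePot` are bounded above by a quantity of size at most C/n, so with ηC ≤ 1 the
quadratic term of the exponential only adds an error of order 1/n inside the bracket. -/
theorem sum_exp_sidePot_le (h : MeanBiased k₁ k₂ c wp wm x p) (hn : 2 ≤ n) (hk₁ : 1 ≤ k₁)
    (hk₂ : 0 < k₂) (hk₂' : k₂ ≤ 1) {ε ϑ θ K B M C : ℝ} (hε : 0 ≤ ε) (hϑ : ϑ = 16 / k₂)
    (hθ : θ = 2 * k₁) (hB : B = wm * ϑ * Real.exp (ϑ * wm) * Real.exp (2 * θ * wm))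
    (hM1 : θ ≤ M) (hM2 : ϑ ≤ M) (hK : 1 + θ * wm ≤ K)
    (hC : wm * ϑ * Real.exp (ϑ * wm) + Real.exp (ϑ * wm)
      + (B + 1) * (θ + (1 + θ * wm) + K) ≤ C) {η : ℝ} (hη : 0 < η) (hη1 : η * C ≤ 1) :
    ∑ i, p i * Real.exp (η * (sidePot ε ϑ θ wm K B (place x i (weight wp wm x i)) -
      sidePot ε ϑ θ wm K B x)) ≤
    1 + η / n * (-Real.exp (-(M * absPot x / n)) + 6 * ε * (B + (B + 1) * k₁ + 1)
      + 2 * C / n + (B + 1) * K * midInd ε x) := by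
  have hn0 : 0 < n := by omega
  have hn' : (1 : ℝ) ≤ n := by exact_mod_cast hn0
  have hw := h.one_le_wm
  have hϑ0 : 0 ≤ ϑ := by rw [hϑ]; positivity
  have hθ0 : 0 ≤ θ := by linarith
  have hB0 : 0 ≤ B := by rw [hB]; positivity
  have hK0 : 0 ≤ K := by nlinarith
  have hC0 : 0 ≤ C := by
    have : 0 ≤ wm * ϑ * Real.exp (ϑ * wm) + Real.exp (ϑ * wm)
      + (B + 1) * (θ + (1 + θ * wm) + K) := by positivity
    linarith
  set U := sideIncr ε ϑ θ wm K B x with hU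
  have h1 : ∀ i, p i * Real.exp (η * (sidePot ε ϑ θ wm K B (place x i (weight wp wm x i)) -
      sidePot ε ϑ θ wm K B x)) ≤ η / n * (p i * U i) + (1 + η / n * (C / n)) * p i := by
    intro i
    have h2 := h.sidePot_place_le hn0 hε hϑ0 hθ0 hK hB0 i
    have h3 := (h.abs_sideIncr_le hn0 hε hϑ0 hθ0 hK0 hB0 i).trans hC
    have h4 : |η * (U i / n)| ≤ 1 := by
      rw [abs_mul, abs_div, Nat.abs_cast, abs_of_pos hη]
      have : |U i| / n ≤ C := (div_le_self (abs_nonneg _) hn').trans h3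
      nlinarith
    have h5 := exp_le_one_add_add_sq h4
    have h6 : (η * (U i / n)) ^ 2 ≤ η / n * (C / n) := by
      have h7 : (U i) ^ 2 ≤ C ^ 2 := by
        rw [← sq_abs]; gcongr
      calc (η * (U i / n)) ^ 2 = η ^ 2 / n ^ 2 * (U i) ^ 2 := by ring
        _ ≤ η ^ 2 / n ^ 2 * C ^ 2 := by gcongr
        _ = η / n * (C / n) * (η * C) := by ring
        _ ≤ η / n * (C / n) * 1 := by gcongr
        _ = _ := mul_one _
    have h7 := Real.exp_le_exp.2 (mul_le_mul_of_nonneg_left h2 hη.le)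
    have h8 := mul_le_mul_of_nonneg_left (h7.trans (h5.trans (add_le_add le_rfl h6))) (h.nonneg i)
    refine h8.trans (le_of_eq ?_)
    ring
  refine (Finset.sum_le_sum fun i _ => h1 i).trans ?_
  rw [Finset.sum_add_distrib, ← Finset.mul_sum, ← Finset.mul_sum, h.sum_eq_one, mul_one]
  have h2 := h.sum_sideIncr_le hn hk₁ hk₂ hk₂' (K := K) hε hϑ hθ hB hM1 hM2
  have h3 : (B + 1) * θ * wm / n ≤ C / n := by
    gcongr
    have e1 : 0 ≤ wm * ϑ * Real.exp (ϑ * wm) := by positivity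
    have e2 : (B + 1) * (θ * wm) ≤ (B + 1) * (θ + (1 + θ * wm) + K) := by
      gcongr; linarith
    linarith [Real.exp_pos (ϑ * wm)]
  have h4 := mul_le_mul_of_nonneg_left (h2.trans (add_le_add (add_le_add le_rfl h3) le_rfl))
    (show 0 ≤ η / n by positivity)
  have h5 : η / n * (2 * C / n) = η / n * (C / n) + η / n * (C / n) := by ring
  simp only [mul_add] at h4 ⊢
  linarith

end MeanBiased

/-- There is a bounded potential which drifts down, up to small errors, when nearly all bins are on
the same side of the mean and the loads are typically close to the mean. -/
theorem exists_sidePot {k₁ k₂ : ℝ} (hk₁ : 1 ≤ k₁) (hk₂ : 0 < k₂) (hk₂' : k₂ ≤ 1) (wm : ℕ) :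
    ∃ C M : ℝ, 1 ≤ C ∧ 0 < M ∧ ∀ ε : ℝ, 0 ≤ ε → ε ≤ 1 →
      ∃ G : ∀ n : ℕ, (Fin n → ℕ) → ℝ, (∀ n, 0 < n → ∀ x, |G n x| ≤ C) ∧
        ∀ n, 2 ≤ n → ∀ (c : ℝ) (wp : ℕ) (x : Fin n → ℕ) (p : Fin n → ℝ),
          MeanBiased k₁ k₂ c wp wm x p → ∀ η : ℝ, 0 < η → η * C ≤ 1 →
          ∑ i, p i * Real.exp (η * (G n (place x i (weight wp wm x i)) - G n x)) ≤
            1 + η / n * (-Real.exp (-(M * absPot x / n)) + C * (ε + 1 / n + midInd ε x)) := by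
  obtain ⟨ϑ, hϑ⟩ : ∃ ϑ, ϑ = 16 / k₂ := ⟨_, rfl⟩
  obtain ⟨θ, hθ⟩ : ∃ θ, θ = 2 * k₁ := ⟨_, rfl⟩
  obtain ⟨K, hK⟩ : ∃ K, K = 1 + θ * wm := ⟨_, rfl⟩
  obtain ⟨B, hB⟩ : ∃ B, B = wm * ϑ * Real.exp (ϑ * wm) * Real.exp (2 * θ * wm) := ⟨_, rfl⟩
  obtain ⟨C₀, hC₀⟩ : ∃ C₀, C₀ = wm * ϑ * Real.exp (ϑ * wm) + Real.exp (ϑ * wm)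
      + (B + 1) * (θ + (1 + θ * wm) + K) := ⟨_, rfl⟩
  have hϑ0 : 0 ≤ ϑ := by rw [hϑ]; positivity
  have hθ0 : 0 < θ := by linarith
  have hB0 : 0 ≤ B := by rw [hB]; positivity
  have hK0 : 1 ≤ K := by rw [hK]; have : 0 ≤ θ * wm := by positivity
                         linarith
  have hC₀0 : 1 ≤ C₀ := by
    have h1 : 1 ≤ Real.exp (ϑ * wm) := Real.one_le_exp (by positivity)
    have h2 : 0 ≤ wm * ϑ * Real.exp (ϑ * wm) := by positivity
    have h3 : 0 ≤ (B + 1) * (θ + (1 + θ * wm) + K) := by positivity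
    linarith
  obtain ⟨C₁, hC₁⟩ : ∃ C₁, C₁ = 6 * (B + (B + 1) * k₁ + 1) := ⟨_, rfl⟩
  have hC₁0 : 0 ≤ C₁ := by rw [hC₁]; positivity
  have hBK : 0 ≤ (B + 1) * K := by positivity
  have hBK1 : 0 ≤ (B + 1) * (K + 1) := by positivity
  -- One constant covers the step size, the error coefficients and the supremum of the potential. It
  -- does not involve ε, so ε can later be chosen in terms of it.
  refine ⟨2 * C₀ + C₁ + (B + 1) * K + Real.exp (ϑ * wm) + (B + 1) * (K + 1), θ + ϑ, ?_, by linarith,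
    fun ε hε hε' => ⟨fun n => sidePot ε ϑ θ wm K B, ?_, ?_⟩⟩
  · linarith [Real.exp_pos (ϑ * wm)]
  · intro n hn x
    have h1 := abs_lowPot_le hn (w := wm) hϑ0 x
    have h2 := abs_thresholdPot_le hn hε hε' hθ0.le (show 0 ≤ K by linarith) x (mean x)
    have h3 := abs_sub (lowPot ϑ wm x) ((B + 1) * thresholdPot ε θ K x (mean x))
    rw [abs_mul, abs_of_nonneg (show 0 ≤ B + 1 by linarith)] at h3
    have h4 := mul_le_mul_of_nonneg_left h2 (show 0 ≤ B + 1 by linarith)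
    change |sidePot ε ϑ θ wm K B x| ≤ _
    rw [sidePot]
    linarith
  · intro n hn c wp x p h η hη hη1
    have hn' : (0 : ℝ) < n := by positivity
    have h1 := h.sum_exp_sidePot_le hn hk₁ hk₂ hk₂' hε hϑ hθ hB (M := θ + ϑ) (by linarith)
      (by linarith) hK.ge hC₀.ge hη
      (le_trans (mul_le_mul_of_nonneg_left (by linarith [Real.exp_pos (ϑ * wm)]) hη.le) hη1)
    refine h1.trans ?_
    have h2 := midInd_nonneg ε x
    have h3 : 0 ≤ 1 / (n : ℝ) := by positivity
    have h5 := Real.exp_pos (ϑ * wm)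
    set C := 2 * C₀ + C₁ + (B + 1) * K + Real.exp (ϑ * wm) + (B + 1) * (K + 1) with hC
    have e1 : 6 * ε * (B + (B + 1) * k₁ + 1) ≤ C * ε := by
      have : 6 * ε * (B + (B + 1) * k₁ + 1) = C₁ * ε := by rw [hC₁]; ring
      rw [this]; gcongr; linarith
    have e2 : 2 * C₀ / n ≤ C * (1 / n) := by
      rw [mul_one_div]; gcongr; linarith
    have e3 : (B + 1) * K * midInd ε x ≤ C * midInd ε x := by gcongr; linarith
    exact add_le_add le_rfl (mul_le_mul_of_nonneg_left (by linarith) (by positivity))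

/-! ### The geometric mean of the three potentials -/

theorem exp_mean_le (u v w : ℝ) :
    Real.exp ((u + v + w) / 3) ≤ (Real.exp u + Real.exp v + Real.exp w) / 3 := by
  have key : ∀ z, Real.exp ((u + v + w) / 3) * (1 + (z - (u + v + w) / 3)) ≤ Real.exp z := by
    intro z
    have h1 := Real.add_one_le_exp (z - (u + v + w) / 3)
    have h2 : Real.exp z = Real.exp ((u + v + w) / 3) * Real.exp (z - (u + v + w) / 3) := by
      rw [← Real.exp_add]; congr 1; ring
    rw [h2]
    exact mul_le_mul_of_nonneg_left (by linarith) (Real.exp_pos _).le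
  have h1 := key u
  have h2 := key v
  have h3 := key w
  nlinarith

/-- The geometric mean of the three potentials. -/
noncomputable def mixedPot (α η₂ η₃ : ℝ) (G : (Fin n → ℕ) → ℝ) (x : Fin n → ℕ) : ℝ :=
  Real.exp ((Real.log (coshPot α x) + η₂ * (rootPot x - n) + η₃ * G x) / 3)

theorem mixedPot_pos (α η₂ η₃ : ℝ) (G : (Fin n → ℕ) → ℝ) (x : Fin n → ℕ) :
    0 < mixedPot α η₂ η₃ G x := Real.exp_pos _

theorem coshPot_pos (hn : 0 < n) (α : ℝ) (x : Fin n → ℕ) : 0 < coshPot α x := by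
  have : (0 : ℝ) < n := by positivity
  linarith [two_mul_le_coshPot α x]

theorem mixedPot_le_mul (hn : 0 < n) (α η₂ η₃ : ℝ) (G : (Fin n → ℕ) → ℝ) (x x' : Fin n → ℕ) :
    mixedPot α η₂ η₃ G x' ≤ mixedPot α η₂ η₃ G x *
      ((coshPot α x' / coshPot α x + Real.exp (η₂ * (rootPot x' - rootPot x)) +
        Real.exp (η₃ * (G x' - G x))) / 3) := by
  have h1 := exp_mean_le (Real.log (coshPot α x') - Real.log (coshPot α x))
    (η₂ * (rootPot x' - rootPot x)) (η₃ * (G x' - G x))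
  rw [Real.exp_sub, Real.exp_log (coshPot_pos hn α x), Real.exp_log (coshPot_pos hn α x')] at h1
  refine le_trans (le_of_eq ?_) (mul_le_mul_of_nonneg_left h1 (mixedPot_pos α η₂ η₃ G x).le)
  rw [mixedPot, mixedPot, ← Real.exp_add]
  congr 1
  ring

theorem exp_abs_le_mixedPot (hn : 0 < n) {α η₂ η₃ C : ℝ} (hη₂ : 0 ≤ η₂)
    (hη₃ : 0 ≤ η₃) {G : (Fin n → ℕ) → ℝ} (hG : ∀ x, |G x| ≤ C) (x : Fin n → ℕ) (i : Fin n) :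
    Real.exp (α / 3 * |normLoad x i|) ≤ Real.exp (η₃ * C / 3) * mixedPot α η₂ η₃ G x := by
  rw [mixedPot, ← Real.exp_add]
  apply Real.exp_le_exp.2
  have h1 := (Real.le_log_iff_exp_le (coshPot_pos hn α x)).2 (exp_abs_le_coshPot α x i)
  have h2 : 0 ≤ η₂ * (rootPot x - n) := mul_nonneg hη₂ (by linarith [le_rootPot x])
  have h3 := mul_le_mul_of_nonneg_left (abs_le.1 (hG x)).1 hη₃
  linarith

theorem quadPot_le {α : ℝ} (hα : 0 ≤ α) (x : Fin n → ℕ) :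
    α ^ 2 * quadPot x ≤ 2 * coshPot α x := by
  rw [quadPot, coshPot, Finset.mul_sum, Finset.mul_sum]
  refine Finset.sum_le_sum fun i _ => ?_
  have h1 := Real.exp_pos (α * normLoad x i)
  have h2 := Real.exp_pos (-α * normLoad x i)
  rcases le_total 0 (normLoad x i) with h | h
  · have := Real.quadratic_le_exp_of_nonneg (show 0 ≤ α * normLoad x i by positivity)
    have h3 : 0 ≤ α * normLoad x i := by positivity
    nlinarith
  · have h3 : 0 ≤ -α * normLoad x i := by nlinarith
    have := Real.quadratic_le_exp_of_nonneg h3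
    nlinarith

theorem rootPot_sub_le (hn : 0 < n) (x : Fin n → ℕ) : rootPot x - n ≤ quadPot x / n := by
  have hn' : (0 : ℝ) < n := by positivity
  have h1 := rootPot_sq x
  have h2 := le_rootPot x
  rw [le_div_iff₀ hn']
  nlinarith

/-- A cosine potential of order n forces `quadPot` to be of order n, hence `rootPot` - n to be
bounded; the other two factors are then constants. -/
theorem mixedPot_le (hn : 0 < n) {α η₂ η₃ C lam : ℝ} (hα : 0 < α) (hη₂ : 0 ≤ η₂)
    (hη₃ : 0 ≤ η₃) {G : (Fin n → ℕ) → ℝ} (hG : ∀ x, |G x| ≤ C) {x : Fin n → ℕ}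
    (hx : coshPot α x ≤ lam * n) :
    mixedPot α η₂ η₃ G x ≤ lam * Real.exp ((η₂ * (2 * lam / α ^ 2) + η₃ * C) / 3) * n := by
  have hn' : (1 : ℝ) ≤ n := by exact_mod_cast hn
  have hL := two_mul_le_coshPot α x
  have hL0 : 0 < coshPot α x := coshPot_pos hn α x
  have h1 : 0 ≤ Real.log (coshPot α x) := Real.log_nonneg (by linarith)
  have h2 : rootPot x - n ≤ 2 * lam / α ^ 2 := by
    refine (rootPot_sub_le hn x).trans ?_
    rw [div_le_div_iff₀ (by linarith) (by positivity)]
    have := quadPot_le hα.le x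
    nlinarith
  have h3 := mul_le_mul_of_nonneg_left h2 hη₂
  have h4 := mul_le_mul_of_nonneg_left (abs_le.1 (hG x)).2 hη₃
  calc mixedPot α η₂ η₃ G x
      ≤ Real.exp (Real.log (coshPot α x) + (η₂ * (2 * lam / α ^ 2) + η₃ * C) / 3) :=
        Real.exp_le_exp.2 (by linarith)
    _ = coshPot α x * Real.exp ((η₂ * (2 * lam / α ^ 2) + η₃ * C) / 3) := by
        rw [Real.exp_add, Real.exp_log hL0]
    _ ≤ lam * n * Real.exp ((η₂ * (2 * lam / α ^ 2) + η₃ * C) / 3) := by gcongr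
    _ = _ := by ring

theorem coshPot_zero (α : ℝ) : coshPot α (fun _ : Fin n => 0) = 2 * n := by
  simp only [coshPot, normLoad, total]
  simp
  ring

/-- If nearly all bins are on the same side of the mean but not all loads agree, then `1 / n` is
small. -/
theorem one_div_le_of_side (hn : 0 < n) {α ε : ℝ} {x : Fin n → ℕ} (hx : 2 * n < coshPot α x)
    (h : meanQuantile x ≤ ε ∨ 1 - ε ≤ meanQuantile x) : 1 / (n : ℝ) ≤ ε := by
  rcases h with h | h
  · exact (one_div_le_meanQuantile hn x).trans h
  -- Without underloaded bins all deviations would vanish and the cosine potential would equal 2n.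
  · have hne : (underloaded x).Nonempty := by
      rw [Finset.nonempty_iff_ne_empty]
      intro h0
      have h1 := (sum_over_normLoad hn x).2
      rw [h0, Finset.sum_empty] at h1
      have h2 : ∑ i, |normLoad x i| = 0 := by rw [← absPot]; linarith
      rw [Finset.sum_eq_zero_iff_of_nonneg (fun _ _ => abs_nonneg _)] at h2
      have h3 : coshPot α x = 2 * n := by
        have : ∀ i, normLoad x i = 0 := fun i => abs_eq_zero.1 (h2 i (Finset.mem_univ i))
        simp only [coshPot, this]
        simp
        ring
      linarith
    have h1 : (1 : ℝ) ≤ (underloaded x).card := by exact_mod_cast hne.card_pos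
    have hn' : (0 : ℝ) < n := by positivity
    rw [card_underloaded_eq hn] at h1
    rw [div_le_iff₀ hn']
    nlinarith

namespace MeanBiased

variable {k₁ k₂ c : ℝ} {wp wm : ℕ} {x : Fin n → ℕ} {p : Fin n → ℝ}

theorem sum_mixedPot_le (h : MeanBiased k₁ k₂ c wp wm x p) (hn : 0 < n) (α η₂ η₃ : ℝ)
    (G : (Fin n → ℕ) → ℝ) {D₁ D₂ D₃ : ℝ}
    (h1 : ∑ i, p i * coshPot α (place x i (weight wp wm x i)) ≤ coshPot α x * (1 + D₁ / n))
    (h2 : ∑ i, p i * Real.exp (η₂ * (rootPot (place x i (weight wp wm x i)) - rootPot x)) ≤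
      1 + D₂ / n)
    (h3 : ∑ i, p i * Real.exp (η₃ * (G (place x i (weight wp wm x i)) - G x)) ≤ 1 + D₃ / n) :
    ∑ i, p i * mixedPot α η₂ η₃ G (place x i (weight wp wm x i)) ≤
      mixedPot α η₂ η₃ G x * (1 + (D₁ + D₂ + D₃) / (3 * n)) := by
  have hL := coshPot_pos hn α x
  have hn' : (0 : ℝ) < n := by positivity
  set V := mixedPot α η₂ η₃ G x
  have hV : 0 < V := mixedPot_pos _ _ _ _ _
  set f := fun i => place x i (weight wp wm x i)
  have e1 : ∀ i, p i * mixedPot α η₂ η₃ G (f i) ≤ V / 3 * (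
      (p i * coshPot α (f i)) / coshPot α x + p i * Real.exp (η₂ * (rootPot (f i) - rootPot x)) +
        p i * Real.exp (η₃ * (G (f i) - G x))) := by
    intro i
    refine (mul_le_mul_of_nonneg_left (mixedPot_le_mul hn α η₂ η₃ G x (f i)) (h.nonneg i)).trans
      (le_of_eq ?_)
    ring
  refine (Finset.sum_le_sum fun i _ => e1 i).trans ?_
  rw [← Finset.mul_sum, Finset.sum_add_distrib, Finset.sum_add_distrib, ← Finset.sum_div]
  have h1' : (∑ i, p i * coshPot α (f i)) / coshPot α x ≤ 1 + D₁ / n := by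
    rw [div_le_iff₀ hL]; linarith
  calc _ ≤ V / 3 * ((1 + D₁ / n) + (1 + D₂ / n) + (1 + D₃ / n)) := by
        gcongr
    _ = _ := by field_simp; ring

end MeanBiased

/-! ### Arithmetic of the constants -/

theorem boundary_le {α w lam L N : ℝ} (hN : 0 < N) (hα : 0 < α) (h1 : 4 * w ≤ lam * α)
    (h2 : lam * N ≤ L) : 4 * α * w ≤ L * (α ^ 2 / N) := by
  rw [← mul_div_assoc, le_div_iff₀ hN]
  calc 4 * α * w * N = α * N * (4 * w) := by ring
    _ ≤ α * N * (lam * α) := by gcongr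
    _ = lam * N * α ^ 2 := by ring
    _ ≤ L * α ^ 2 := by gcongr

/-- In units of α²: the `rootPot` drift q+3 pays q+1 for the cosine potential and 1 for the side
error, leaving 1. -/
theorem sum_drift_le_of_far {q c K₂ K₃ α η₂ η₃ e s : ℝ} (hη₂ : η₂ = K₂ * α ^ 2)
    (hη₃ : η₃ = K₃ * α ^ 2) (hK₂ : K₂ * (c / 64) = q + 3) (hK₃ : 0 ≤ K₃) (he : 0 ≤ e)
    (hs : K₃ * s ≤ 1) :
    (q + 1) * α ^ 2 + -(η₂ * (c / 64)) + η₃ * (-e + s) ≤ -α ^ 2 := by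
  have h1 : η₂ * (c / 64) = (q + 3) * α ^ 2 := by rw [hη₂, ← hK₂]; ring
  have h2 : η₃ * (-e + s) = (K₃ * s - K₃ * e) * α ^ 2 := by rw [hη₃]; ring
  have h3 : (K₃ * s - K₃ * e) * α ^ 2 ≤ 1 * α ^ 2 := by
    gcongr
    have := mul_nonneg hK₃ he
    linarith
  rw [h1, h2]
  linarith

/-- Now the side potential pays, for the growth of the `rootPot` factor as well. -/
theorem sum_drift_le_of_near {q w K₂ K₃ α η₂ η₃ e e' s : ℝ} (hη₂ : η₂ = K₂ * α ^ 2)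
    (hη₃ : η₃ = K₃ * α ^ 2) (hK₃ : 0 ≤ K₃) (hK₃e : K₃ * e' = q + 3 + 2 * w ^ 2 * K₂)
    (he : e' ≤ e) (hs : K₃ * s ≤ 1) :
    (q + 1) * α ^ 2 + η₂ * (2 * w ^ 2) + η₃ * (-e + s) ≤ -α ^ 2 := by
  have h2 : η₃ * (-e + s) = (K₃ * s - K₃ * e) * α ^ 2 := by rw [hη₃]; ring
  have h3 : (K₃ * s - K₃ * e) * α ^ 2 ≤ (1 - K₃ * e') * α ^ 2 := by
    gcongr
  have h4 : (1 - K₃ * e') * α ^ 2 =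
      α ^ 2 - (q + 3) * α ^ 2 - 2 * w ^ 2 * K₂ * α ^ 2 := by rw [hK₃e]; ring
  have h5 : η₂ * (2 * w ^ 2) = 2 * w ^ 2 * K₂ * α ^ 2 := by rw [hη₂]; ring
  rw [h2, h5]
  linarith

/-- The gain is linear in α and every loss quadratic. The slack `r` lets `Q` encode a further
smallness requirement on α. -/
theorem sum_drift_le_of_mid {q w c C ε K₂ K₃ Q α η₂ η₃ e s r : ℝ} (hη₂ : η₂ = K₂ * α ^ 2)
    (hη₃ : η₃ = K₃ * α ^ 2) (hη₃0 : 0 ≤ η₃) (he : 0 ≤ e) (hs : s ≤ 3 * C) (hr : 0 ≤ r)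
    (hQ : Q = q + 2 + 2 * w ^ 2 * K₂ + 3 * C * K₃ + r) (hα : α * Q = c * ε / 4) :
    (q + 1) * α ^ 2 - α * (c * ε / 4) + η₂ * (2 * w ^ 2) + η₃ * (-e + s) ≤ -α ^ 2 := by
  have h1 : η₃ * (-e + s) ≤ η₃ * (3 * C) := mul_le_mul_of_nonneg_left (by linarith) hη₃0
  have h2 : η₃ * (3 * C) = 3 * C * K₃ * α ^ 2 := by rw [hη₃]; ring
  have h5 : η₂ * (2 * w ^ 2) = 2 * w ^ 2 * K₂ * α ^ 2 := by rw [hη₂]; ring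
  have h6 : α * (α * Q) = (q + 2) * α ^ 2 + 2 * w ^ 2 * K₂ * α ^ 2 + 3 * C * K₃ * α ^ 2 +
      r * α ^ 2 := by rw [hQ]; ring
  have h7 : 0 ≤ r * α ^ 2 := by positivity
  rw [← hα]
  linarith

/-- When V is already O(N), bounded relative growth fits into the additive term and no contraction
is needed. -/
theorem bounded_step_le {V E N α D D₀ : ℝ} (hN : 1 ≤ N) (hV : 0 ≤ V) (hVE : V ≤ E * N)
    (hD : D ≤ D₀) (hD₀ : 0 ≤ D₀) :
    V * (1 + D / (3 * N)) ≤ (1 - α ^ 2 / 3 / N) * V + E * (1 + α ^ 2 + D₀) * N := by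
  have h1 : D / (3 * N) ≤ D₀ := by
    rw [div_le_iff₀ (by positivity)]; nlinarith
  have h2 : V * (1 + D / (3 * N)) ≤ V * (1 + D₀) := by gcongr
  have h3 : V * (1 + D₀) ≤ E * N * (1 + D₀) := by gcongr
  have h4 : α ^ 2 / 3 / N ≤ α ^ 2 := by
    rw [div_div, div_le_iff₀ (by positivity)]; nlinarith [sq_nonneg α]
  have h5 : α ^ 2 / 3 / N * V ≤ α ^ 2 * (E * N) := by gcongr
  have h6 : E * (1 + α ^ 2 + D₀) * N = E * N * (1 + D₀) + α ^ 2 * (E * N) := by ring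
  rw [h6]
  linarith

set_option maxHeartbeats 1600000 in
/-- The Lyapunov function of a mean-biased process: it dominates an exponential of the maximum
deviation and contracts in expectation, up to an additive term that is linear in `n`. -/
theorem exists_lyapunov {k₁ k₂ c : ℝ} (hk₁ : 1 ≤ k₁) (hk₂ : 0 < k₂) (hk₂' : k₂ ≤ 1) (hc : 0 < c)
    (hc1 : c ≤ 1) {wm : ℕ} (hwm : 1 ≤ wm) :
    ∃ a A γ b : ℝ, 0 < a ∧ 0 < A ∧ 0 < γ ∧ γ ≤ 1 ∧ 0 < b ∧ ∀ n : ℕ, 2 ≤ n →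
      ∃ V : (Fin n → ℕ) → ℝ, (∀ x, 0 < V x) ∧
        (∀ x i, Real.exp (a * |normLoad x i|) ≤ A * V x) ∧
        V (fun _ => 0) ≤ b * n ∧
        ∀ wp x p, MeanBiased k₁ k₂ c wp wm x p →
          ∑ i, p i * V (place x i (weight wp wm x i)) ≤ (1 - γ / n) * V x + b * n := by
  have hw : (1 : ℝ) ≤ wm := by exact_mod_cast hwm
  obtain ⟨w, hwdef⟩ : ∃ w : ℝ, w = wm := ⟨_, rfl⟩
  rw [← hwdef] at hw
  obtain ⟨C, M, hC, hM, hside⟩ := exists_sidePot hk₁ hk₂ hk₂' wm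
  obtain ⟨q, hq⟩ : ∃ q, q = 2 * k₁ * w ^ 2 := ⟨_, rfl⟩
  have hw2 : 1 ≤ w ^ 2 := one_le_pow₀ hw
  have hww : w ≤ w ^ 2 := by nlinarith
  have hqw : 2 * w ≤ q := by rw [hq]; nlinarith
  have hq0 : 0 < q := by linarith
  obtain ⟨K₂, hK₂⟩ : ∃ K₂, K₂ = 64 * (q + 3) / c := ⟨_, rfl⟩
  have hK₂0 : 0 < K₂ := by rw [hK₂]; positivity
  have hK₂c : K₂ * (c / 64) = q + 3 := by rw [hK₂]; field_simp
  obtain ⟨C', hC'⟩ : ∃ C', C' = 16 * w ^ 2 / c := ⟨_, rfl⟩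
  obtain ⟨K₃, hK₃⟩ : ∃ K₃, K₃ = (q + 3 + 2 * w ^ 2 * K₂) * Real.exp (M * C') := ⟨_, rfl⟩
  have hK₃e : K₃ * Real.exp (-(M * C')) = q + 3 + 2 * w ^ 2 * K₂ := by
    rw [hK₃, mul_assoc, ← Real.exp_add]; simp
  have hK₃1 : 1 ≤ K₃ := by
    have h1 : 1 ≤ Real.exp (M * C') := Real.one_le_exp (by rw [hC']; positivity)
    have h2 : 1 ≤ q + 3 + 2 * w ^ 2 * K₂ := by
      have : 0 ≤ 2 * w ^ 2 * K₂ := by positivity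
      linarith
    rw [hK₃]; nlinarith
  have hK₃0 : 0 ≤ K₃ := by linarith
  -- With 1/n ≤ ε the side error C(ε + 1/n) is at most 2Cε = 1/K₃.
  obtain ⟨ε, hε⟩ : ∃ ε, ε = 1 / (2 * C * K₃) := ⟨_, rfl⟩
  have hCK : 1 ≤ C * K₃ := one_le_mul_of_one_le_of_one_le hC hK₃1
  have hε0 : 0 < ε := by rw [hε]; positivity
  have hε1 : ε ≤ 1 := by rw [hε, div_le_one (by positivity)]; linarith
  have hεC : K₃ * (2 * C * ε) = 1 := by rw [hε]; field_simp
  obtain ⟨G, hG, hGdrift⟩ := hside ε hε0.le hε1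
  -- The last summand makes η₂ small enough for the drift of `rootPot`; the one before it also gives
  -- η₃C ≤ 1.
  obtain ⟨Q, hQ⟩ : ∃ Q, Q = q + 2 + 2 * w ^ 2 * K₂ + 3 * C * K₃ + 128 * k₁ * w ^ 2 * K₂ := ⟨_, rfl⟩
  have hp1 : 0 ≤ 2 * w ^ 2 * K₂ := by positivity
  have hp2 : 0 ≤ 128 * k₁ * w ^ 2 * K₂ := by positivity
  have hCK3 : 3 * C * K₃ = 3 * (C * K₃) := by ring
  have hQ1 : 1 ≤ Q := by linarith
  obtain ⟨α, hα⟩ : ∃ α, α = c * ε / (4 * Q) := ⟨_, rfl⟩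
  have hα0 : 0 < α := by rw [hα]; positivity
  have hαQ : α * Q = c * ε / 4 := by rw [hα]; field_simp
  have hαQ1 : α * Q ≤ c / 4 := by
    rw [hαQ]; linarith [mul_le_of_le_one_right hc.le hε1]
  have hα1 : α ≤ 1 := by linarith [le_mul_of_one_le_right hα0.le hQ1]
  have hαα : α ^ 2 ≤ α := pow_le_of_le_one hα0.le hα1 two_ne_zero
  have hααQ : α ^ 2 * Q ≤ c / 4 :=
    (mul_le_mul_of_nonneg_right hαα (by linarith)).trans hαQ1
  have hαw : α * w ≤ 1 / 2 := by
    have : w ≤ Q := by linarith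
    linarith [mul_le_mul_of_nonneg_left this hα0.le]
  obtain ⟨η₂, hη₂⟩ : ∃ η₂, η₂ = K₂ * α ^ 2 := ⟨_, rfl⟩
  obtain ⟨η₃, hη₃⟩ : ∃ η₃, η₃ = K₃ * α ^ 2 := ⟨_, rfl⟩
  have hα2 : 0 < α ^ 2 := by positivity
  have hη₂0 : 0 < η₂ := by rw [hη₂]; positivity
  have hη₃0 : 0 < η₃ := by rw [hη₃]; positivity
  have hη₂1 : η₂ * (128 * k₁ * w ^ 2) ≤ c := by
    have h1 : η₂ * (128 * k₁ * w ^ 2) = α ^ 2 * (128 * k₁ * w ^ 2 * K₂) := by rw [hη₂]; ring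
    have h2 : α ^ 2 * (128 * k₁ * w ^ 2 * K₂) ≤ α ^ 2 * Q :=
      mul_le_mul_of_nonneg_left (by linarith) hα2.le
    linarith
  have hη₃1 : η₃ * C ≤ 1 := by
    have h1 : η₃ * C = α ^ 2 * (C * K₃) := by rw [hη₃]; ring
    have h2 : α ^ 2 * (C * K₃) ≤ α ^ 2 * Q :=
      mul_le_mul_of_nonneg_left (by linarith) hα2.le
    linarith
  -- The first term makes the additive 4αw at most α²/n times the cosine potential; the 3 puts the
  -- threshold above 2n, the value at equal loads.
  obtain ⟨lam, hlam⟩ : ∃ lam, lam = 4 * w / α + 3 := ⟨_, rfl⟩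
  have hlam3 : 3 < lam := by rw [hlam]; have : 0 < 4 * w / α := by positivity
                             linarith
  have hlamα : 4 * w ≤ lam * α := by
    have : lam * α = 4 * w + 3 * α := by rw [hlam]; field_simp
    linarith
  obtain ⟨E, hE⟩ : ∃ E, E = lam * Real.exp ((η₂ * (2 * lam / α ^ 2) + η₃ * C) / 3) := ⟨_, rfl⟩
  have hE0 : 0 < E := by rw [hE]; positivity
  obtain ⟨D₀, hD₀⟩ : ∃ D₀, D₀ = q * α ^ 2 + 4 * α * w + η₂ * (2 * w ^ 2) + η₃ * (3 * C) := ⟨_, rfl⟩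
  have hD₀0 : 0 ≤ D₀ := by rw [hD₀]; positivity
  refine ⟨α / 3, Real.exp (η₃ * C / 3), α ^ 2 / 3, E * (1 + α ^ 2 + D₀), by positivity,
    by positivity, by positivity, by linarith, by positivity, fun n hn => ?_⟩
  have hn0 : 0 < n := by omega
  have hn' : (1 : ℝ) ≤ n := by exact_mod_cast hn0
  have hE1 : E * n ≤ E * (1 + α ^ 2 + D₀) * n := by
    gcongr
    exact le_mul_of_one_le_right hE0.le (by linarith)
  refine ⟨mixedPot α η₂ η₃ (G n), mixedPot_pos α η₂ η₃ (G n),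
    exp_abs_le_mixedPot hn0 hη₂0.le hη₃0.le (hG n hn0), ?_, ?_⟩
  · refine le_trans ?_ hE1
    rw [hE]
    refine mixedPot_le hn0 hα0 hη₂0.le hη₃0.le (hG n hn0) ?_
    rw [coshPot_zero]
    gcongr
    linarith
  intro wp x p h
  set V := mixedPot α η₂ η₃ (G n) x with hV
  have hV0 : 0 < V := mixedPot_pos _ _ _ _ _
  have hL0 := coshPot_pos hn0 α x
  have hL2 := two_mul_le_coshPot α x
  have hm0 := midInd_nonneg ε x
  have hm1 := midInd_le_one ε x
  have hα1w : α * (wm : ℝ) ≤ 1 / 2 := by rw [← hwdef]; exact hαw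
  have hηw : η₂ * (128 * k₁ * (wm : ℝ) ^ 2) ≤ c := by rw [← hwdef]; exact hη₂1
  have c3' : ∑ i, p i * Real.exp (η₃ * (G n (place x i (weight wp wm x i)) - G n x)) ≤
      1 + (η₃ * (-Real.exp (-(M * absPot x / n)) + C * (ε + 1 / n + midInd ε x))) / n := by
    refine (hGdrift n hn c wp x p h η₃ hη₃0 hη₃1).trans (le_of_eq ?_)
    ring
  have c2 := h.sum_exp_rootPot_le_always hn0 hk₁ hc hc1 hη₂0 hηw
  rw [← hwdef] at c2
  have c1 := h.sum_coshPot_le_always hn0 hk₁ hc hα0 hα1w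
  rw [← hwdef] at c1
  have hn1 : 1 / (n : ℝ) ≤ 1 := by rw [div_le_one (by linarith)]; exact hn'
  have hs3 : C * (ε + 1 / n + midInd ε x) ≤ 3 * C := by
    calc C * (ε + 1 / n + midInd ε x) ≤ C * (1 + 1 + 1) := by gcongr
      _ = _ := by ring
  rcases le_or_gt (lam * n) (coshPot α x) with hbig | hsmall
  · have hbound := boundary_le (by linarith : (0 : ℝ) < n) hα0 hlamα hbig
    have hb1 : 2 * k₁ * w ^ 2 * α ^ 2 / n * coshPot α x = coshPot α x * (q * α ^ 2 / n) := by
      rw [hq]; ring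
    have c1' : ∑ i, p i * coshPot α (place x i (weight wp wm x i)) ≤
        coshPot α x * (1 + (q + 1) * α ^ 2 / n) := by
      have : coshPot α x * (1 + (q + 1) * α ^ 2 / n) = coshPot α x +
        coshPot α x * (q * α ^ 2 / n) + coshPot α x * (α ^ 2 / n) := by ring
      linarith
    have finish : ∀ D₁ D₂ D₃ : ℝ,
        ∑ i, p i * coshPot α (place x i (weight wp wm x i)) ≤ coshPot α x * (1 + D₁ / n) →
        ∑ i, p i * Real.exp (η₂ * (rootPot (place x i (weight wp wm x i)) - rootPot x)) ≤
          1 + D₂ / n →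
        ∑ i, p i * Real.exp (η₃ * (G n (place x i (weight wp wm x i)) - G n x)) ≤ 1 + D₃ / n →
        D₁ + D₂ + D₃ ≤ -α ^ 2 →
        ∑ i, p i * mixedPot α η₂ η₃ (G n) (place x i (weight wp wm x i)) ≤
          (1 - α ^ 2 / 3 / n) * V + E * (1 + α ^ 2 + D₀) * n := by
      intro D₁ D₂ D₃ g1 g2 g3 g4
      refine (h.sum_mixedPot_le hn0 α η₂ η₃ (G n) g1 g2 g3).trans ?_
      have e1 : (D₁ + D₂ + D₃) / (3 * n) ≤ -α ^ 2 / (3 * n) := by gcongr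
      have e2 : -α ^ 2 / (3 * (n : ℝ)) = -(α ^ 2 / 3 / n) := by field_simp
      have e3 := mul_le_mul_of_nonneg_left e1 hV0.le
      have e4 : 0 ≤ E * (1 + α ^ 2 + D₀) * n := by positivity
      rw [e2] at e3
      linarith
    by_cases hside : meanQuantile x ≤ ε ∨ 1 - ε ≤ meanQuantile x
    · have hnε : 1 / (n : ℝ) ≤ ε := one_div_le_of_side hn0 (lt_of_lt_of_le
        (mul_lt_mul_of_pos_right (by linarith) (by linarith)) hbig) hside
      have hmid : midInd ε x = 0 := by rw [midInd, if_pos hside]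
      have hKε : K₃ * (C * (ε + 1 / n + midInd ε x)) ≤ 1 := by
        have : 2 * C * ε = C * (ε + ε + 0) := by ring
        refine le_trans ?_ hεC.le
        rw [hmid, this]
        gcongr
      by_cases habs : C' * n ≤ absPot x
      · have c2' := h.sum_exp_rootPot_le_of_absPot hn0 hk₁ hc hc1 hη₂0 hηw
          (by rw [← hwdef, ← hC']; exact habs)
        exact finish _ (-(η₂ * (c / 64))) _ c1' (by rw [neg_div]; exact c2') c3'
          (sum_drift_le_of_far hη₂ hη₃ hK₂c hK₃0 (Real.exp_pos _).le hKε)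
      · push Not at habs
        refine finish _ _ _ c1' c2 c3'
          (sum_drift_le_of_near hη₂ hη₃ hK₃0 hK₃e ?_ hKε)
        apply Real.exp_le_exp.2
        rw [neg_le_neg_iff, mul_div_assoc]
        gcongr
        rw [div_le_iff₀ (by linarith)]
        exact habs.le
    · push Not at hside
      have c1m := h.sum_coshPot_le_of_mid hn0 hk₁ hc hα0 hα1w hside.1.le hside.2.le
      rw [← hwdef] at c1m
      have c1'' : ∑ i, p i * coshPot α (place x i (weight wp wm x i)) ≤
          coshPot α x * (1 + ((q + 1) * α ^ 2 - α * (c * ε / 4)) / n) := by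
        have e1 : α * c * ε / (2 * n) * (coshPot α x / 2) ≤
            α * c * ε / (2 * n) * (coshPot α x - n) := by
          gcongr
          linarith
        have : coshPot α x * (1 + ((q + 1) * α ^ 2 - α * (c * ε / 4)) / n) = coshPot α x +
          coshPot α x * (q * α ^ 2 / n) + coshPot α x * (α ^ 2 / n) -
          α * c * ε / (2 * n) * (coshPot α x / 2) := by field_simp; ring
        linarith
      exact finish _ _ _ c1'' c2 c3'
        (sum_drift_le_of_mid hη₂ hη₃ hη₃0.le (Real.exp_pos _).le hs3 hp2 hQ hαQ)
  · have hVE : V ≤ E * n := by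
      rw [hE]
      exact mixedPot_le hn0 hα0 hη₂0.le hη₃0.le (hG n hn0) hsmall.le
    have c1' : ∑ i, p i * coshPot α (place x i (weight wp wm x i)) ≤
        coshPot α x * (1 + (q * α ^ 2 + 4 * α * w) / n) := by
      have e1 : 4 * α * w ≤ coshPot α x * (4 * α * w / n) := by
        rw [← mul_div_assoc, le_div_iff₀ (by linarith)]
        rw [mul_comm (coshPot α x)]
        exact mul_le_mul_of_nonneg_left (by linarith) (by positivity)
      have : coshPot α x * (1 + (q * α ^ 2 + 4 * α * w) / n) = coshPot α x +
        2 * k₁ * w ^ 2 * α ^ 2 / n * coshPot α x + coshPot α x * (4 * α * w / n) := by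
        rw [hq]; ring
      linarith
    refine (h.sum_mixedPot_le hn0 α η₂ η₃ (G n) c1' c2 c3').trans
      (bounded_step_le hn' hV0.le hVE ?_ hD₀0)
    have e1 := Real.exp_pos (-(M * absPot x / n))
    rw [hD₀]
    gcongr
    linarith

/-! ### From majorization to drift -/

theorem Iic_fin_last (N : ℕ) : Finset.Iic (Fin.last N) = Finset.univ := by
  ext i; simp [Fin.le_last]

theorem Majorizes.card_mul_le_sum {N : ℕ} {v : Fin N → ℝ} {q : ℝ} (h : Majorizes v fun _ => q) :
    N * q ≤ ∑ i, v i := by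
  cases N with
  | zero => simp
  | succ N =>
    have := h (Fin.last N)
    rw [Iic_fin_last] at this
    simpa using this

/-- Abel summation by induction: passing to a smaller last weight can only lower its product with a
nonnegative prefix sum. -/
theorem last_mul_sum_le {N : ℕ} (g z : Fin (N + 1) → ℝ) (hg : Antitone g)
    (hz : ∀ k, 0 ≤ ∑ i ∈ Finset.Iic k, z i) : g (Fin.last N) * ∑ i, z i ≤ ∑ i, g i * z i := by
  induction N with
  | zero => simp
  | succ N ih =>
    have hz' : ∀ k : Fin (N + 1), ∑ i ∈ Finset.Iic k, z i.castSucc =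
        ∑ i ∈ Finset.Iic k.castSucc, z i := by
      intro k
      rw [← Fin.map_castSuccEmb_Iic, Finset.sum_map]
      rfl
    have h1 := ih (fun i => g i.castSucc) (fun i => z i.castSucc)
      (fun a b hab => hg (by simpa using hab)) (fun k => by rw [hz']; exact hz _)
    rw [Fin.sum_univ_castSucc, Fin.sum_univ_castSucc (fun i => g i * z i)]
    have h2 : 0 ≤ ∑ i : Fin (N + 1), z i.castSucc := by
      have := hz' (Fin.last N)
      rw [Iic_fin_last] at this
      rw [this]; exact hz _
    have h3 : g (Fin.last (N + 1)) ≤ g (Fin.last N).castSucc := hg (Fin.le_last _)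
    nlinarith [mul_le_mul_of_nonneg_right h3 h2]

theorem sum_mul_nonneg_of_prefix {N : ℕ} (g z : Fin N → ℝ) (hg : Antitone g) (hg0 : ∀ i, 0 ≤ g i)
    (hz : ∀ k, 0 ≤ ∑ i ∈ Finset.Iic k, z i) : 0 ≤ ∑ i, g i * z i := by
  cases N with
  | zero => simp
  | succ N =>
    refine le_trans (mul_nonneg (hg0 _) ?_) (last_mul_sum_le g z hg hz)
    have := hz (Fin.last N)
    rwa [Iic_fin_last] at this

theorem sum_filter_lt {m : ℕ} (hm : m ≤ n) (f : Fin n → ℝ) :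
    ∑ k ∈ Finset.univ.filter (fun k : Fin n => k.val < m), f k = ∑ j : Fin m, f (Fin.castLE hm j) := by
  symm
  refine Finset.sum_bij (fun j _ => Fin.castLE hm j) (fun j _ => by simp)
    (fun a _ b _ hab => by simpa [Fin.ext_iff] using hab) (fun k hk => ?_) (fun _ _ => rfl)
  simp only [Finset.mem_filter, Finset.mem_univ, true_and] at hk
  exact ⟨⟨k, hk⟩, Finset.mem_univ _, by ext; simp⟩

theorem sum_filter_ge {m : ℕ} (f : Fin n → ℝ) :
    ∑ k ∈ Finset.univ.filter (fun k : Fin n => m ≤ k.val), f k =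
      ∑ j : Fin (n - m), f (Fin.rev (Fin.castLE (Nat.sub_le n m) j)) := by
  symm
  refine Finset.sum_bij (fun j _ => Fin.rev (Fin.castLE (Nat.sub_le n m) j)) (fun j _ => ?_)
    (fun a _ b _ hab => by
      have := congrArg Fin.val (show _ = _ from hab)
      simp only [Fin.val_rev, Fin.val_castLE] at this
      ext; omega) (fun k hk => ?_) (fun _ _ => rfl)
  · simp only [Finset.mem_filter, Finset.mem_univ, true_and, Fin.val_rev, Fin.val_castLE]
    omega
  · simp only [Finset.mem_filter, Finset.mem_univ, true_and] at hk
    refine ⟨⟨n - 1 - k, by omega⟩, Finset.mem_univ _, ?_⟩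
    ext
    simp only [Fin.val_rev, Fin.val_castLE]
    omega

namespace AllocProcess

variable (P : AllocProcess n)

theorem normLoad_label_antitone (h : History n) :
    Antitone fun k => normLoad (load h) (P.label h k) := by
  intro k l hkl
  have : (load h (P.label h l) : ℝ) ≤ load h (P.label h k) := by
    exact_mod_cast P.label_sorted h hkl
  simp only [normLoad_eq]
  linarith

/-- In the sorted order the overloaded bins form an initial segment, whose length is their number.
-/
theorem label_mem_overloaded (h : History n) (k : Fin n) :
    P.label h k ∈ overloaded (load h) ↔ (k : ℕ) < (overloaded (load h)).card := by
  set T := Finset.univ.filter fun k => P.label h k ∈ overloaded (load h) with hT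
  have hcard : T.card = (overloaded (load h)).card := by
    refine Finset.card_bij (fun k _ => P.label h k) (fun k hk => by simpa [hT] using hk)
      (fun a _ b _ hab => (P.label h).injective hab) (fun i hi => ?_)
    exact ⟨(P.label h).symm i, by simpa [hT] using hi, by simp⟩
  have hlow : ∀ k l, k ≤ l → l ∈ T → k ∈ T := by
    intro k l hkl hl
    simp only [hT, Finset.mem_filter, Finset.mem_univ, true_and, mem_overloaded] at hl ⊢
    exact hl.trans (P.normLoad_label_antitone h hkl)
  rw [← hcard]
  constructor
  · intro hk
    have h1 : Finset.Iic k ⊆ T := fun l hl =>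
      hlow l k (Finset.mem_Iic.1 hl) (by simpa [hT] using hk)
    have h2 := Finset.card_le_card h1
    rw [Fin.card_Iic] at h2
    omega
  · intro hk
    by_contra hk'
    have h1 : T ⊆ Finset.Iio k := fun l hl => by
      rw [Finset.mem_Iio]
      by_contra hlk
      exact hk' (by simpa [hT] using hlow k l (not_lt.1 hlk) hl)
    have h2 := Finset.card_le_card h1
    rw [Fin.card_Iio] at h2
    omega

theorem sum_overloaded_eq (h : History n) (F : Fin n → ℝ) :
    ∑ i ∈ overloaded (load h), F i = ∑ j : Fin (overloaded (load h)).card,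
      F (P.label h (Fin.castLE (card_overloaded_le (load h)) j)) := by
  rw [← sum_filter_lt (card_overloaded_le (load h)) (fun k => F (P.label h k))]
  symm
  refine Finset.sum_bij (fun k _ => P.label h k) (fun k hk => ?_)
    (fun a _ b _ hab => (P.label h).injective hab) (fun i hi => ?_) (fun _ _ => rfl)
  · rw [P.label_mem_overloaded]; simpa using hk
  · refine ⟨(P.label h).symm i, ?_, by simp⟩
    have := (P.label_mem_overloaded h ((P.label h).symm i)).1 (by simpa using hi)
    simpa using this

theorem sum_underloaded_eq (h : History n) (F : Fin n → ℝ) :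
    ∑ i ∈ underloaded (load h), F i = ∑ j : Fin (n - (overloaded (load h)).card),
      F (P.label h (Fin.rev (Fin.castLE (Nat.sub_le n (overloaded (load h)).card) j))) := by
  rw [← sum_filter_ge (fun k => F (P.label h k))]
  have hmem : ∀ k, P.label h k ∈ underloaded (load h) ↔ (overloaded (load h)).card ≤ (k : ℕ) := by
    intro k
    rw [← not_lt, ← P.label_mem_overloaded, mem_overloaded, mem_underloaded, not_le]
  symm
  refine Finset.sum_bij (fun k _ => P.label h k) (fun k hk => ?_)
    (fun a _ b _ hab => (P.label h).injective hab) (fun i hi => ?_) (fun _ _ => rfl)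
  · rw [hmem]; simpa using hk
  · refine ⟨(P.label h).symm i, ?_, by simp⟩
    have := (hmem ((P.label h).symm i)).1 (by simpa using hi)
    simpa using this

theorem binProb_nonneg (h : History n) (i : Fin n) : 0 ≤ P.binProb h i := ENNReal.toReal_nonneg

theorem sum_binProb (h : History n) : ∑ i, P.binProb h i = 1 := by
  have h1 := ((P.step h).map Prod.fst).tsum_coe
  rw [tsum_fintype] at h1
  unfold binProb
  rw [← ENNReal.toReal_sum (fun i _ => PMF.apply_ne_top _ i), h1, ENNReal.toReal_one]

theorem meanWeight_binProb (wp wm : ℕ) (h : History n) :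
    meanWeight wp wm (load h) (P.binProb h) =
      wp * (1 - P.underProb h) + wm * P.underProb h := by
  have h1 := sum_over_add_sum_under (load h) (P.binProb h)
  rw [P.sum_binProb, ← underProb] at h1
  have h2 : 1 - P.underProb h = ∑ i ∈ overloaded (load h), P.binProb h i := by linarith
  rw [meanWeight, ← sum_over_add_sum_under, h2, underProb, Finset.mul_sum, Finset.mul_sum]
  congr 1
  · exact Finset.sum_congr rfl fun i hi => by rw [weight_of_over hi]; ring
  · exact Finset.sum_congr rfl fun i hi => by rw [weight_of_under hi]; ring

theorem underProb_nonneg (h : History n) : 0 ≤ P.underProb h :=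
  Finset.sum_nonneg fun i _ => P.binProb_nonneg h i

theorem underProb_le_one (h : History n) : P.underProb h ≤ 1 := by
  rw [← P.sum_binProb h]
  exact Finset.sum_le_univ_sum_of_nonneg (P.binProb_nonneg h)

/-- Majorization by constant vectors yields the drift conditions. -/
theorem meanBiased_of_majorizes {k₁ k₂ c : ℝ} {wp wm : ℕ} (h : History n)
    (hwp : 1 ≤ wp) (hw : wp ≤ wm)
    (hover : ∀ i ∈ overloaded (load h), P.binProb h i ≤ k₁ / n)
    (hunder : ∀ i ∈ underloaded (load h), k₂ / n ≤ P.binProb h i)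
    {q r : ℝ} (hq : Majorizes (fun _ => q) (P.overVec h))
    (hr : Majorizes (P.underVec h) (fun _ => r))
    (hq' : wp * q - meanWeight wp wm (load h) (P.binProb h) / n ≤
      -(c * (1 - meanQuantile (load h)) / n))
    (hr' : (underloaded (load h)).Nonempty → c * meanQuantile (load h) / n ≤
      wm * r - meanWeight wp wm (load h) (P.binProb h) / n) :
    MeanBiased k₁ k₂ c wp wm (load h) (P.binProb h) where
  nonneg := P.binProb_nonneg h
  sum_eq_one := P.sum_binProb h
  one_le_wp := hwp
  wp_le_wm := hw
  over_le := hover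
  under_ge := hunder
  over_drift := by
    intro f hf hf0
    rw [← sub_nonneg, Finset.mul_sum, ← Finset.sum_sub_distrib]
    set W := meanWeight wp wm (load h) (P.binProb h)
    set D := c * (1 - meanQuantile (load h)) / n
    have h1 : ∀ i ∈ overloaded (load h), -D * f (normLoad (load h) i) -
        f (normLoad (load h) i) * loadDrift wp wm (load h) (P.binProb h) i =
        f (normLoad (load h) i) * (-D - (wp * P.binProb h i - W / n)) := by
      intro i hi
      rw [loadDrift, weight_of_over hi]; ring
    rw [Finset.sum_congr rfl h1,
      P.sum_overloaded_eq h (fun i => f (normLoad (load h) i) * (-D - (wp * P.binProb h i - W / n)))]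
    have hmem : ∀ j : Fin (overloaded (load h)).card,
        0 ≤ normLoad (load h) (P.label h (Fin.castLE (card_overloaded_le (load h)) j)) := by
      intro j
      rw [← mem_overloaded, P.label_mem_overloaded]
      simp
    -- Listed heaviest first, the weights f are non-increasing, as Abel summation requires; the
    -- underloaded bins are listed lightest first for the same reason.
    refine sum_mul_nonneg_of_prefix
      (fun j => f (normLoad (load h) (P.label h (Fin.castLE (card_overloaded_le (load h)) j)))) _
      (fun a b hab => hf (hmem b) (hmem a) (P.normLoad_label_antitone h ?_))
      (fun j => hf0 _ (hmem j)) (fun k => ?_)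
    · simpa using hab
    · have h2 := hq k
      have h3 : ∑ i ∈ Finset.Iic k, P.overVec h i = ∑ i ∈ Finset.Iic k,
        P.binProb h (P.label h (Fin.castLE (card_overloaded_le (load h)) i)) := rfl
      rw [h3, Finset.sum_const, nsmul_eq_mul] at h2
      have h4 : ∑ i ∈ Finset.Iic k, (-D - (wp * P.binProb h (P.label h
          (Fin.castLE (card_overloaded_le (load h)) i)) - W / n)) =
          (Finset.Iic k).card * (-D + W / n) - wp * ∑ i ∈ Finset.Iic k,
            P.binProb h (P.label h (Fin.castLE (card_overloaded_le (load h)) i)) := by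
        rw [Finset.mul_sum, ← nsmul_eq_mul, ← Finset.sum_const, ← Finset.sum_sub_distrib]
        exact Finset.sum_congr rfl fun i _ => by ring
      rw [h4]
      have h5 := mul_le_mul_of_nonneg_left h2 (show (0 : ℝ) ≤ wp by positivity)
      have h6 := mul_le_mul_of_nonneg_left hq' (show (0 : ℝ) ≤ (Finset.Iic k).card by positivity)
      linarith
  under_drift := by
    intro f hf hf0
    rw [← sub_nonneg, Finset.mul_sum, ← Finset.sum_sub_distrib]
    set W := meanWeight wp wm (load h) (P.binProb h)
    set D := c * meanQuantile (load h) / n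
    rcases (underloaded (load h)).eq_empty_or_nonempty with hemp | hne
    · rw [hemp]; simp
    have hr'' := hr' hne
    have h1 : ∀ i ∈ underloaded (load h),
        f (normLoad (load h) i) * loadDrift wp wm (load h) (P.binProb h) i -
          D * f (normLoad (load h) i) =
        f (normLoad (load h) i) * ((wm * P.binProb h i - W / n) - D) := by
      intro i hi
      rw [loadDrift, weight_of_under hi]; ring
    rw [Finset.sum_congr rfl h1,
      P.sum_underloaded_eq h (fun i => f (normLoad (load h) i) * ((wm * P.binProb h i - W / n) - D))]
    have hmem : ∀ j : Fin (n - (overloaded (load h)).card),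
        normLoad (load h) (P.label h
          (Fin.rev (Fin.castLE (Nat.sub_le n (overloaded (load h)).card) j))) < 0 := by
      intro j
      rw [← not_le, ← mem_overloaded, P.label_mem_overloaded]
      simp only [Fin.val_rev, Fin.val_castLE]
      omega
    refine sum_mul_nonneg_of_prefix
      (fun j => f (normLoad (load h) (P.label h
        (Fin.rev (Fin.castLE (Nat.sub_le n (overloaded (load h)).card) j))))) _
      (fun a b hab => hf (hmem a) (hmem b) (P.normLoad_label_antitone h ?_))
      (fun j => hf0 _ (hmem j)) (fun k => ?_)
    · rw [Fin.rev_le_rev]; simpa using hab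
    · have h2 := hr k
      have h3 : ∑ i ∈ Finset.Iic k, P.underVec h i = ∑ i ∈ Finset.Iic k,
        P.binProb h (P.label h
          (Fin.rev (Fin.castLE (Nat.sub_le n (overloaded (load h)).card) i))) := rfl
      rw [h3, Finset.sum_const, nsmul_eq_mul] at h2
      have h4 : ∑ i ∈ Finset.Iic k, ((wm * P.binProb h (P.label h
          (Fin.rev (Fin.castLE (Nat.sub_le n (overloaded (load h)).card) i))) - W / n) - D) =
          wm * ∑ i ∈ Finset.Iic k, P.binProb h (P.label h
          (Fin.rev (Fin.castLE (Nat.sub_le n (overloaded (load h)).card) i))) -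
          (Finset.Iic k).card * (D + W / n) := by
        rw [Finset.mul_sum, ← nsmul_eq_mul, ← Finset.sum_const, ← Finset.sum_sub_distrib]
        exact Finset.sum_congr rfl fun i _ => by ring
      rw [h4]
      have h5 := mul_le_mul_of_nonneg_left h2 (show (0 : ℝ) ≤ wm by positivity)
      have h6 := mul_le_mul_of_nonneg_left hr'' (show (0 : ℝ) ≤ (Finset.Iic k).card by positivity)
      linarith

theorem wp_le_meanWeight {wp wm : ℕ} (hw : wp ≤ wm) (h : History n) :
    (wp : ℝ) ≤ meanWeight wp wm (load h) (P.binProb h) ∧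
      meanWeight wp wm (load h) (P.binProb h) ≤ wm := by
  have h1 := P.underProb_nonneg h
  have h2 := P.underProb_le_one h
  have h3 : (wp : ℝ) ≤ wm := by exact_mod_cast hw
  rw [P.meanWeight_binProb]
  constructor <;> nlinarith

/-- Probability bias. -/
theorem meanBiased_of_condP2 (hn : 0 < n) {k₁ wp wm : ℕ} {k₂ k₃ k₄ c : ℝ}
    (hP : P.CondP2 k₁ k₂ k₃ k₄) (hW : P.CondW1 wp wm) (hc3 : c ≤ k₃) (hc4 : c ≤ k₄)
    {h : History n} (hh : P.Reachable h) :
    MeanBiased k₁ k₂ c wp wm (load h) (P.binProb h) := by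
  have hn' : (0 : ℝ) < n := by positivity
  -- The mean weight lies between the two weights, so unequal weights only strengthen the bias, and
  -- weights of at least one preserve the rates k₃ and k₄.
  obtain ⟨hW1, hW2⟩ := P.wp_le_meanWeight hW.wplus_le_wminus h
  have hwp : (1 : ℝ) ≤ wp := by exact_mod_cast hW.one_le_wplus
  have hδ0 := meanQuantile_nonneg (load h)
  have hδ1 := meanQuantile_le_one (load h)
  refine P.meanBiased_of_majorizes h hW.one_le_wplus hW.wplus_le_wminus (hP.over_max h hh)
    (hP.under_min h hh) (hP.over_maj h hh) (hP.under_maj h hh) ?_ (fun _ => ?_)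
  · have h1 : (wp : ℝ) * (1 / n - k₃ * (1 - meanQuantile (load h)) / n) -
        meanWeight wp wm (load h) (P.binProb h) / n =
        (wp * (1 - k₃ * (1 - meanQuantile (load h))) -
          meanWeight wp wm (load h) (P.binProb h)) / n := by ring
    rw [h1, ← neg_div]
    gcongr
    have h2 : 0 ≤ k₃ * (1 - meanQuantile (load h)) := mul_nonneg hP.k₃_mem.1.le (by linarith)
    have h3 : c * (1 - meanQuantile (load h)) ≤ k₃ * (1 - meanQuantile (load h)) :=
      mul_le_mul_of_nonneg_right hc3 (by linarith)
    nlinarith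
  · have h1 : (wm : ℝ) * (1 / n + k₄ * meanQuantile (load h) / n) -
        meanWeight wp wm (load h) (P.binProb h) / n =
        (wm * (1 + k₄ * meanQuantile (load h)) -
          meanWeight wp wm (load h) (P.binProb h)) / n := by ring
    rw [h1]
    gcongr
    have h2 : 0 ≤ k₄ * meanQuantile (load h) := mul_nonneg hP.k₄_mem.1.le hδ0
    have h3 : c * meanQuantile (load h) ≤ k₄ * meanQuantile (load h) := by
      gcongr
    nlinarith

theorem one_sub_meanQuantile_le_underProb (hn : 0 < n) {k₁ : ℕ} {k₂ : ℝ} (hP : P.CondP1 k₁ k₂)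
    {h : History n} (hh : P.Reachable h) : 1 - meanQuantile (load h) ≤ P.underProb h := by
  have hn' : (0 : ℝ) < n := by positivity
  have hm := hP.under_maj h hh
  have hcard := card_overloaded_eq hn (load h)
  have hle := card_overloaded_le (load h)
  have hsum : ∑ j, P.underVec h j = P.underProb h := (P.sum_underloaded_eq h (P.binProb h)).symm
  have h2 : ((n - (overloaded (load h)).card : ℕ) : ℝ) = (1 - meanQuantile (load h)) * n := by
    rw [Nat.cast_sub hle, hcard]; ring
  have hall := hm.card_mul_le_sum
  rw [hsum, h2] at hall
  calc _ = (1 - meanQuantile (load h)) * n * (1 / n) := by field_simp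
    _ ≤ _ := hall

/-- Weight bias. -/
theorem meanBiased_of_condW2 (hn : 0 < n) {k₁ wp wm : ℕ} {k₂ c : ℝ} (hc : c ≤ 1)
    (hP : P.CondP1 k₁ k₂) (hW : P.CondW2 wp wm) {h : History n} (hh : P.Reachable h) :
    MeanBiased k₁ k₂ c wp wm (load h) (P.binProb h) := by
  have hn' : (0 : ℝ) < n := by positivity
  have hU := P.one_sub_meanQuantile_le_underProb hn hP hh
  have hU1 := P.underProb_le_one h
  have hw : (wp : ℝ) + 1 ≤ wm := by exact_mod_cast hW.wplus_lt_wminus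
  have hwp : (0 : ℝ) ≤ wp := by positivity
  have hδ0 := meanQuantile_nonneg (load h)
  have hδ1 := meanQuantile_le_one (load h)
  set δ := meanQuantile (load h) with hδ
  set u := P.underProb h
  refine P.meanBiased_of_majorizes h hW.one_le_wplus hW.wplus_le_wminus (hP.over_max h hh)
    (hP.under_min h hh) (hP.over_maj h hh) (hW.under_maj_avg h hh) ?_ (fun hne => ?_)
  -- The uniform bound 1/n leaves the drift -(w₋ - w₊)u/n, where w₋ - w₊ ≥ 1 and u ≥ 1-δ.
  · rw [P.meanWeight_binProb]
    have h1 : (wp : ℝ) * (1 / n) - (wp * (1 - u) + wm * u) / n = -(((wm : ℝ) - wp) * u / n) := by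
      ring
    rw [h1, neg_le_neg_iff]
    have h2 : c * (1 - δ) ≤ 1 * (1 - δ) := mul_le_mul_of_nonneg_right hc (by linarith)
    exact div_le_div_of_nonneg_right (by nlinarith) hn'.le
  · rw [P.meanWeight_binProb, card_underloaded_eq hn]
    have hδ2 : 0 < 1 - δ := by
      have h1 : (0 : ℝ) < (underloaded (load h)).card := by exact_mod_cast hne.card_pos
      rw [card_underloaded_eq hn] at h1
      exact pos_of_mul_pos_left h1 hn'.le
    -- Splitting u/(1-δ) = u + uδ/(1-δ) cancels w₋u. Since u ≥ 1-δ, what remains is at least w₋δ -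
    -- w₊δ ≥ δ.
    have h1 : c * δ ≤ wm * (u / (1 - δ)) - (wp * (1 - u) + wm * u) := by
      have e1 : u / (1 - δ) = u + u / (1 - δ) * δ := by field_simp; ring
      have e2 : 1 ≤ u / (1 - δ) := by rw [le_div_iff₀ hδ2]; linarith
      have e3 : (wm : ℝ) * δ ≤ wm * (u / (1 - δ) * δ) := by
        have : δ ≤ u / (1 - δ) * δ := by nlinarith
        gcongr
      have e0 : c * δ ≤ 1 * δ := mul_le_mul_of_nonneg_right hc hδ0
      have e4 : (wp : ℝ) * (1 - u) ≤ wp * δ := by gcongr; linarith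
      have e5 : (wm : ℝ) * (u / (1 - δ)) = wm * u + wm * (u / (1 - δ) * δ) := by
        rw [← mul_add, ← e1]
      nlinarith
    have h2 : (wm : ℝ) * (u / ((1 - δ) * n)) - (wp * (1 - u) + wm * u) / n =
        (wm * (u / (1 - δ)) - (wp * (1 - u) + wm * u)) / n := by
      field_simp
    rw [← hδ, h2]
    gcongr

end AllocProcess

/-! ### Expectations along the process and the tail bound -/

theorem tsum_bind_mul {α β : Type*} (q : PMF α) (g : α → PMF β) (f : β → ENNReal) :
    ∑' b, (q.bind g) b * f b = ∑' a, q a * ∑' b, g a b * f b := by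
  simp only [PMF.bind_apply, ← ENNReal.tsum_mul_right, ← ENNReal.tsum_mul_left]
  rw [ENNReal.tsum_comm]
  simp only [mul_assoc]

theorem tsum_map_mul {α β : Type*} (q : PMF α) (g : α → β) (f : β → ENNReal) :
    ∑' b, (q.map g) b * f b = ∑' a, q a * f (g a) := by
  rw [PMF.map, tsum_bind_mul]
  refine tsum_congr fun a => ?_
  congr 1
  rw [tsum_eq_single (g a)]
  · simp
  · intro b hb
    simp [hb]

theorem load_cons (h : History n) (a : Fin n × ℕ) : load (a :: h) = place (load h) a.1 a.2 := by
  funext j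
  by_cases hj : a.1 = j
  · simp [load, place, hj, add_comm]
  · simp [load, place, hj, Ne.symm hj]

theorem load_nil : load ([] : History n) = fun _ => 0 := by
  funext j; simp [load]

theorem gap_le_maxDeviation (hn : 0 < n) (x : Fin n → ℕ) : gap x ≤ maxDeviation x := by
  have : Nonempty (Fin n) := ⟨⟨0, hn⟩⟩
  rw [gap, sub_le_iff_le_add]
  refine ciSup_le fun i => ?_
  have h1 : |normLoad x i| ≤ maxDeviation x :=
    le_ciSup (f := fun i => |normLoad x i|) (Set.finite_range _).bddAbove i
  have h2 := le_abs_self (normLoad x i)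
  rw [normLoad] at h2
  rw [normLoad] at h1
  linarith

namespace AllocProcess

variable (P : AllocProcess n)

/-- The expectation of a function of the load vector after `t` rounds. -/
noncomputable def expLoad (V : (Fin n → ℕ) → ℝ) (t : ℕ) : ENNReal :=
  ∑' h, P.histLaw t h * ENNReal.ofReal (V (load h))

/-- On the support of the step the bin determines the number of balls, so only the marginal law of
the bin matters. -/
theorem sum_step_eq {wp wm : ℕ} (hW : P.CondW1 wp wm) {V : (Fin n → ℕ) → ℝ} (hV : ∀ x, 0 ≤ V x)
    {h : History n} (hh : P.Reachable h) :
    ∑' a, P.step h a * ENNReal.ofReal (V (load (a :: h))) =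
      ENNReal.ofReal (∑ i, P.binProb h i *
        V (place (load h) i (weight wp wm (load h) i))) := by
  have h1 : ∀ a, P.step h a * ENNReal.ofReal (V (load (a :: h))) = P.step h a *
      ENNReal.ofReal (V (place (load h) a.1 (weight wp wm (load h) a.1))) := by
    intro a
    by_cases ha : a ∈ (P.step h).support
    · rw [load_cons, hW.balls_eq h hh a ha]; rfl
    · rw [PMF.mem_support_iff, not_not] at ha
      rw [ha, zero_mul, zero_mul]
  rw [tsum_congr h1, ← tsum_map_mul (P.step h) Prod.fst
    (fun i => ENNReal.ofReal (V (place (load h) i (weight wp wm (load h) i)))), tsum_fintype,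
    ENNReal.ofReal_sum_of_nonneg fun i _ => mul_nonneg (P.binProb_nonneg h i) (hV _)]
  refine Finset.sum_congr rfl fun i _ => ?_
  rw [ENNReal.ofReal_mul (P.binProb_nonneg h i), binProb,
    ENNReal.ofReal_toReal (PMF.apply_ne_top _ i)]

theorem expLoad_succ_le {wp wm : ℕ} (hW : P.CondW1 wp wm) {V : (Fin n → ℕ) → ℝ}
    (hV : ∀ x, 0 ≤ V x) {r s : ℝ} (hr : 0 ≤ r) (hs : 0 ≤ s)
    (hstep : ∀ h, P.Reachable h → ∑ i, P.binProb h i *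
      V (place (load h) i (weight wp wm (load h) i)) ≤ r * V (load h) + s) (t : ℕ) :
    P.expLoad V (t + 1) ≤ ENNReal.ofReal r * P.expLoad V t + ENNReal.ofReal s := by
  have h1 : P.expLoad V (t + 1) =
      ∑' h, P.histLaw t h * ∑' a, P.step h a * ENNReal.ofReal (V (load (a :: h))) := by
    rw [expLoad, histLaw, tsum_bind_mul]
    exact tsum_congr fun h => by rw [tsum_map_mul]
  rw [h1]
  calc _ ≤ ∑' h, (ENNReal.ofReal r * (P.histLaw t h * ENNReal.ofReal (V (load h))) +
        P.histLaw t h * ENNReal.ofReal s) := by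
        refine ENNReal.tsum_le_tsum fun h => ?_
        by_cases hh : h ∈ (P.histLaw t).support
        · have hh' : P.Reachable h := ⟨t, hh⟩
          rw [P.sum_step_eq hW hV hh']
          calc _ ≤ P.histLaw t h * ENNReal.ofReal (r * V (load h) + s) := by
                gcongr; exact hstep h hh'
            _ = _ := by
                rw [ENNReal.ofReal_add (mul_nonneg hr (hV _)) hs, ENNReal.ofReal_mul hr]
                ring
        · rw [PMF.mem_support_iff, not_not] at hh
          rw [hh]; simp
    _ = _ := by
        rw [ENNReal.tsum_add, ENNReal.tsum_mul_left, ENNReal.tsum_mul_right, PMF.tsum_coe, one_mul,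
          expLoad]

theorem expLoad_le {wp wm : ℕ} (hW : P.CondW1 wp wm) {V : (Fin n → ℕ) → ℝ}
    (hV : ∀ x, 0 ≤ V x) {r s B : ℝ} (hr : 0 ≤ r) (hs : 0 ≤ s)
    (hstep : ∀ h, P.Reachable h → ∑ i, P.binProb h i *
      V (place (load h) i (weight wp wm (load h) i)) ≤ r * V (load h) + s)
    (h0 : V (fun _ => 0) ≤ B) (hB : r * B + s ≤ B) (t : ℕ) :
    P.expLoad V t ≤ ENNReal.ofReal B := by
  have hB0 : 0 ≤ B := (hV _).trans h0
  induction t with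
  | zero =>
    rw [expLoad, histLaw, tsum_eq_single []]
    · rw [load_nil]
      simpa using ENNReal.ofReal_le_ofReal h0
    · intro h hh
      simp [hh]
  | succ t ih =>
    refine (P.expLoad_succ_le hW hV hr hs hstep t).trans ?_
    calc _ ≤ ENNReal.ofReal r * ENNReal.ofReal B + ENNReal.ofReal s := by gcongr
      _ = ENNReal.ofReal (r * B + s) := by
        rw [← ENNReal.ofReal_mul hr, ← ENNReal.ofReal_add (mul_nonneg hr hB0) hs]
      _ ≤ _ := ENNReal.ofReal_le_ofReal hB

/-- Markov's inequality for the load vector. -/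
theorem loadLaw_real_le {V : (Fin n → ℕ) → ℝ} {t : ℕ} {B T : ℝ} (hB : 0 ≤ B)
    (hE : P.expLoad V t ≤ ENNReal.ofReal B) (hT : 0 < T) {S : Set (Fin n → ℕ)}
    (hS : ∀ x ∈ S, T ≤ V x) : (P.loadLaw t).toMeasure.real S ≤ B / T := by
  have hE' : ∑' x, P.loadLaw t x * ENNReal.ofReal (V x) ≤ ENNReal.ofReal B := by
    rw [loadLaw, tsum_map_mul]; exact hE
  have h1 : (P.loadLaw t).toMeasure S * ENNReal.ofReal T ≤ ENNReal.ofReal B := by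
    refine le_trans ?_ hE'
    rw [PMF.toMeasure_apply _ (MeasurableSet.of_discrete), ← ENNReal.tsum_mul_right]
    refine ENNReal.tsum_le_tsum fun x => ?_
    by_cases hx : x ∈ S
    · rw [Set.indicator_of_mem hx]
      gcongr
      exact hS x hx
    · rw [Set.indicator_of_notMem hx]; simp
  rw [le_div_iff₀ hT, MeasureTheory.measureReal_def]
  have h2 := ENNReal.toReal_mono ENNReal.ofReal_ne_top h1
  rwa [ENNReal.toReal_mul, ENNReal.toReal_ofReal hT.le, ENNReal.toReal_ofReal hB] at h2

end AllocProcess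

/-- For mean-biased processes the maximum deviation is logarithmic with high probability. -/
theorem exists_deviation_bound {k₁ k₂ c : ℝ} (hk₁ : 1 ≤ k₁) (hk₂ : 0 < k₂) (hk₂' : k₂ ≤ 1)
    (hc : 0 < c) (hc1 : c ≤ 1) {wm : ℕ} (hwm : 1 ≤ wm) :
    ∃ κ : ℝ, 0 < κ ∧ ∀ n : ℕ, 2 ≤ n → ∀ (P : AllocProcess n) (wp : ℕ), P.CondW1 wp wm →
      (∀ h, P.Reachable h → MeanBiased k₁ k₂ c wp wm (load h) (P.binProb h)) → ∀ m : ℕ,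
        (P.loadLaw m).toMeasure.real {x | κ * Real.log n < maxDeviation x} ≤ (n : ℝ) ^ (-4 : ℤ) := by
  obtain ⟨a, A, γ, b, ha, hA, hγ, hγ1, hb, hlyap⟩ := exists_lyapunov hk₁ hk₂ hk₂' hc hc1 hwm
  obtain ⟨s, hs⟩ := pow_unbounded_of_one_lt (b * A / γ) (one_lt_two : (1 : ℝ) < 2)
  -- Of the power n^(6+s), two factors pay for the expectation bound bn²/γ, s factors absorb bA/γ <
  -- 2^s ≤ n^s, and four remain.
  refine ⟨(6 + s) / a, by positivity, fun n hn P wp hW hbias m => ?_⟩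
  obtain ⟨V, hV0, hVexp, hVinit, hVstep⟩ := hlyap n hn
  have hn0 : 0 < n := by omega
  have hn2 : (2 : ℝ) ≤ n := by exact_mod_cast hn
  have hn' : (0 : ℝ) < n := by positivity
  have : Nonempty (Fin n) := ⟨⟨0, hn0⟩⟩
  have hγn : γ / n ≤ 1 := by rw [div_le_one hn']; linarith
  -- The bound bn²/γ is the fixed point of the one-step recursion.
  have hE := P.expLoad_le hW (fun x => (hV0 x).le) (r := 1 - γ / n) (s := b * n)
    (B := b * n ^ 2 / γ) (by linarith) (by positivity)
    (fun h hh => hVstep wp (load h) _ (hbias h hh))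
    (by
      refine hVinit.trans ?_
      rw [le_div_iff₀ hγ]
      have : b * n * γ ≤ b * n * n := by gcongr; linarith
      linarith)
    (le_of_eq (by field_simp; ring)) m
  have hS : ∀ x ∈ {x : Fin n → ℕ | (6 + s) / a * Real.log n < maxDeviation x},
      (n : ℝ) ^ (6 + s) / A ≤ V x := by
    intro x hx
    obtain ⟨i, hi⟩ := exists_lt_of_lt_ciSup (f := fun i => |normLoad x i|) hx
    rw [div_le_iff₀ hA, mul_comm]
    refine le_trans ?_ (hVexp x i)
    have h1 : (n : ℝ) ^ (6 + s) = Real.exp (((6 + s : ℕ) : ℝ) * Real.log n) := by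
      rw [Real.exp_nat_mul, Real.exp_log hn']
    rw [h1]
    apply Real.exp_le_exp.2
    have h2 := mul_le_mul_of_nonneg_left hi.le ha.le
    refine le_trans (le_of_eq ?_) h2
    push_cast
    field_simp
  refine (P.loadLaw_real_le (by positivity) hE (by positivity) hS).trans ?_
  have h3 : b * A / γ ≤ (n : ℝ) ^ s := hs.le.trans (by gcongr)
  have h4 : b * (n : ℝ) ^ 2 / γ / ((n : ℝ) ^ (6 + s) / A) =
      (b * A / γ) * (n : ℝ) ^ (-4 : ℤ) / (n : ℝ) ^ s := by
    rw [zpow_neg]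
    have : (n : ℝ) ^ (4 : ℤ) = (n : ℝ) ^ 4 := by norm_cast
    rw [this]
    field_simp
    ring
  rw [h4, div_le_iff₀ (by positivity), mul_comm]
  gcongr

end BalancedAllocation

open BalancedAllocation in
theorem theorem3p1 (k₁ wplus wminus : ℕ) (k₂ k₃ k₄ : ℝ) :
    ∃ κ : ℝ, 0 < κ ∧
      ∀ n : ℕ, 1 ≤ n → ∀ P : AllocProcess n,
        ((P.CondP2 k₁ k₂ k₃ k₄ ∧ P.CondW1 wplus wminus) ∨
          (P.CondP1 k₁ k₂ ∧ P.CondW2 wplus wminus)) →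
        ∀ m : ℕ,
          1 - (n : ℝ) ^ (-4 : ℤ) ≤
              (P.loadLaw m).toMeasure.real {x | maxDeviation x ≤ κ * Real.log n} ∧
            1 - (n : ℝ) ^ (-4 : ℤ) ≤
              (P.loadLaw m).toMeasure.real {x | gap x ≤ κ * Real.log n} := by
  -- For inadmissible constants no process qualifies, and any κ serves.
  by_cases hconst : 1 ≤ k₁ ∧ (0 < k₂ ∧ k₂ ≤ 1) ∧ 1 ≤ wminus
  swap
  · refine ⟨1, one_pos, fun n _ P hP => absurd ?_ hconst⟩
    rcases hP with ⟨h1, h2⟩ | ⟨h1, h2⟩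
    · exact ⟨h1.one_le_k₁, h1.k₂_mem, h2.one_le_wplus.trans h2.wplus_le_wminus⟩
    · exact ⟨h1.one_le_k₁, h1.k₂_mem, h2.one_le_wplus.trans h2.wplus_le_wminus⟩
  obtain ⟨hk₁, ⟨hk₂, hk₂'⟩, hwm⟩ := hconst
  obtain ⟨c, hc, hc1, hc34⟩ : ∃ c : ℝ, 0 < c ∧ c ≤ 1 ∧
      (k₃ ∈ Set.Ioc (0 : ℝ) 1 → k₄ ∈ Set.Ioc (0 : ℝ) 1 → c ≤ k₃ ∧ c ≤ k₄) := by
    -- The constants k₃ and k₄ are constrained only under probability bias; weight bias admits every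
    -- c ≤ 1.
    by_cases h : k₃ ∈ Set.Ioc (0 : ℝ) 1 ∧ k₄ ∈ Set.Ioc (0 : ℝ) 1
    · exact ⟨min k₃ k₄, lt_min h.1.1 h.2.1, (min_le_left _ _).trans h.1.2,
        fun _ _ => ⟨min_le_left _ _, min_le_right _ _⟩⟩
    · exact ⟨1, one_pos, le_rfl, fun h3 h4 => absurd ⟨h3, h4⟩ h⟩
  obtain ⟨κ, hκ, hdev⟩ := exists_deviation_bound (k₁ := k₁) (by exact_mod_cast hk₁) hk₂ hk₂' hc hc1
    hwm
  refine ⟨κ, hκ, fun n hn P hP m => ?_⟩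
  have hmax : 1 - (n : ℝ) ^ (-4 : ℤ) ≤
      (P.loadLaw m).toMeasure.real {x | maxDeviation x ≤ κ * Real.log n} := by
    rcases hn.eq_or_lt with rfl | hn2
    -- For a single bin the claimed lower bound is zero.
    · simp
    · have hW : P.CondW1 wplus wminus := by
        rcases hP with ⟨_, h2⟩ | ⟨_, h2⟩
        · exact h2
        · exact h2.toCondW1
      have hbias : ∀ h, P.Reachable h →
          MeanBiased k₁ k₂ c wplus wminus (load h) (P.binProb h) := by
        intro h hh
        rcases hP with ⟨h1, h2⟩ | ⟨h1, h2⟩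
        · obtain ⟨h3, h4⟩ := hc34 h1.k₃_mem h1.k₄_mem
          exact P.meanBiased_of_condP2 hn h1 h2 h3 h4 hh
        · exact P.meanBiased_of_condW2 hn hc1 h1 h2 hh
      have h1 := hdev n hn2 P wplus hW hbias m
      have h2 : {x : Fin n → ℕ | maxDeviation x ≤ κ * Real.log n} =
          {x | κ * Real.log n < maxDeviation x}ᶜ := by
        ext x; simp
      rw [h2, MeasureTheory.probReal_compl_eq_one_sub MeasurableSet.of_discrete]
      linarith
  refine ⟨hmax, hmax.trans (MeasureTheory.measureReal_mono fun x hx => ?_)⟩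
  exact (gap_le_maxDeviation hn x).trans hx
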